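/- Let $D=\mathrm{diag}(d_1,\dots,d_n)$ with all $d_i>0$ (for example the diagonal matrix in an eigen-decomposition $\tfrac12 Q=V^{\top}DV$ of a symmetric matrix $Q\succ 0$ with $V$ orthogonal, in the coordinates $y=Vx$). Let $t_0\ge 0$, and let $\eta_0:\mathbb R^n\to\mathbb R$ be measurable with $\int_{\mathbb R^n} e^{-\varepsilon|z|^2}|\eta_0(z)|\,dz<\infty$ for every $\varepsilon>0$. For $t>t_0$ put $$\kappa_{++}(t_0,y,t,z)=\frac{\det(M_{tt_0})^{1/4}}{(2\pi)^{n/2}\sqrt{\det\big(\sinh(2(t-t_0)\sqrt D)\big)}}\exp\!\Big(-\tfrac12\begin{pmatrix}y^{\top}&z^{\top}\end{pmatrix}M_{tt_0}\begin{pmatrix}y\\ z\end{pmatrix}\Big),$$ $$M_{tt_0}=\begin{bmatrix}\sqrt D\coth(2(t-t_0)\sqrt D)&-\sqrt D\,\mathrm{csch}(2(t-t_0)\sqrt D)\\-\sqrt D\,\mathrm{csch}(2(t-t_0)\sqrt D)&\sqrt D\coth(2(t-t_0)\sqrt D)\end{bmatrix},$$ where a function of a diagonal matrix is applied to its diagonal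 entries. By a solution of the initial value problem $$\partial_t\eta=\Delta\eta-(y^{\top}Dy)\,\eta\quad\text{on }(t_0,\infty)\times\mathbb R^n,\qquad \eta(t_0,\cdot)=\eta_0,$$ we mean a classical ($C^{1,2}$) solution $\eta$ on $(t_0,\infty)\times\mathbb R^n$ with $\eta(t,\cdot)\to\eta_0$ in $L^1_{\mathrm{loc}}(\mathbb R^n)$ as $t\downarrow t_0$ and such that for every $T>t_0$ there is $a\in\mathbb R$ with $\sup_{t_0<t\le T}\int_{\mathbb R^n} e^{-a|y|^2}|\eta(t,y)|\,dy<\infty$. Then: (i) the function $\eta(t,y)=\int_{\mathbb R^n}\kappa_{++}(t_0,y,t,z)\,\eta_0(z)\,dz$ ($t>t_0$) is a solution, and it is the only one; (ii) at every point $y$ at which $\eta_0$ is continuous, $\eta(t,y')\to\eta_0(y)$ as $t\downarrow t_0$ and $y'\to y$; (iii) for all $t>t_0$ and $y\in\mathbb R^n$ this integral converges absolutely and is the sum of the (unconditionally convergent) Hermite series $$\int_{\mathbb R^n}\kappa_{++}(t_0,y,t,z)\,\eta_0(z)\,dz=\sum_{m\in\mathbb N_0^n}\int_{\mathbb R^n}\prod_{i=1}^n\frac{d_i^{1/4}}{\sqrt\pi\,2^{m_i}m_i!}\,e^{-(t-t_0)\sqrt{d_i}(2m_i+1)-\frac{(y_i^2+z_i^2)\sqrt{d_i}}{2}}\,H_{m_i}(d_i^{1/4}y_i)\,H_{m_i}(d_i^{1/4}z_i)\;\eta_0(z)\,dz,$$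 each term being an absolutely convergent integral, where $H_k(x)=(-1)^k e^{x^2}\frac{d^k}{dx^k}e^{-x^2}$ are the physicist's Hermite polynomials. -/

import Mathlib

open Real Set Filter Topology MeasureTheory
open scoped Matrix Nat

noncomputable section

/-- The function `g` applied to the diagonal matrix with diagonal `d`, in the sense of matrix
functions: the diagonal matrix with entries `g (d i)`. -/
def diagFun {n : ℕ} (g : ℝ → ℝ) (d : Fin n → ℝ) : Matrix (Fin n) (Fin n) ℝ :=
  Matrix.diagonal fun i => g (d i)

/-- The `2n × 2n` block matrix with diagonal blocks `√D coth (2 τ √D)` and off-diagonal blocks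
`-√D csch (2 τ √D)`, where `D = diag d` and `τ` is the elapsed time. -/
def kernelMatrix {n : ℕ} (d : Fin n → ℝ) (τ : ℝ) : Matrix (Fin n ⊕ Fin n) (Fin n ⊕ Fin n) ℝ :=
  Matrix.fromBlocks
    (diagFun (fun x => √x) d * diagFun (fun x => cosh (2 * τ * √x) / sinh (2 * τ * √x)) d)
    (-(diagFun (fun x => √x) d * diagFun (fun x => 1 / sinh (2 * τ * √x)) d))
    (-(diagFun (fun x => √x) d * diagFun (fun x => 1 / sinh (2 * τ * √x)) d))
    (diagFun (fun x => √x) d * diagFun (fun x => cosh (2 * τ * √x) / sinh (2 * τ * √x)) d)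

/-- The closed-form kernel `κ₊₊(t₀, y, t, z)` for the positive diagonal matrix `D = diag d`. -/
def kernelPP {n : ℕ} (d : Fin n → ℝ) (t₀ : ℝ) (y : EuclideanSpace ℝ (Fin n)) (t : ℝ)
    (z : EuclideanSpace ℝ (Fin n)) : ℝ :=
  (kernelMatrix d (t - t₀)).det ^ (1 / 4 : ℝ) /
      ((2 * π) ^ ((n : ℝ) / 2) * √(diagFun (fun x => sinh (2 * (t - t₀) * √x)) d).det) *
    exp (-(1 / 2) *
      (Sum.elim y.ofLp z.ofLp ⬝ᵥ (kernelMatrix d (t - t₀) *ᵥ Sum.elim y.ofLp z.ofLp)))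

/-- The physicist's Hermite polynomial, `H_k(x) = (-1)^k e^{x²} (d/dx)^k e^{-x²}`. -/
def physHermite (k : ℕ) (x : ℝ) : ℝ :=
  (-1) ^ k * exp (x ^ 2) * iteratedDeriv k (fun s : ℝ => exp (-s ^ 2)) x

/-- The term with multi-index `m` of the Hermite (separation of variables) expansion of the
solution operator. -/
def hermiteTerm {n : ℕ} (d : Fin n → ℝ) (t₀ t : ℝ) (m : Fin n → ℕ)
    (y z : EuclideanSpace ℝ (Fin n)) : ℝ :=
  ∏ i, (d i ^ (1 / 4 : ℝ) / (√π * 2 ^ m i * ((m i)! : ℝ)) *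
    exp (-(t - t₀) * √(d i) * (2 * (m i : ℝ) + 1) - (y i ^ 2 + z i ^ 2) * √(d i) / 2) *
    physHermite (m i) (d i ^ (1 / 4 : ℝ) * y i) * physHermite (m i) (d i ^ (1 / 4 : ℝ) * z i))

/-- `η` is a classical (`C^{1,2}`) solution on `(t₀, ∞) × ℝⁿ` of
`∂η/∂t = Δη - (yᵀ D y) η`, `D = diag d`, with initial datum `η₀` at time `t₀`. The datum need not
be continuous and is attained in `L¹_loc`; as usual on an unbounded domain, a growth condition
is part of the notion of solution: at most Gaussian growth in the mean, locally uniformly in time.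
Only the values `η t y` with `t₀ < t` matter. -/
structure IsIVPSolution {n : ℕ} (d : Fin n → ℝ) (t₀ : ℝ) (η₀ : EuclideanSpace ℝ (Fin n) → ℝ)
    (η : ℝ → EuclideanSpace ℝ (Fin n) → ℝ) : Prop where
  contDiff : ∀ t, t₀ < t → ContDiff ℝ 2 (η t)
  continuousOn : ∀ k ≤ 2, ContinuousOn
    (fun p : ℝ × EuclideanSpace ℝ (Fin n) => iteratedFDeriv ℝ k (η p.1) p.2) (Ioi t₀ ×ˢ univ)
  pde : ∀ t, t₀ < t → ∀ y : EuclideanSpace ℝ (Fin n), HasDerivAt (fun s => η s y)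
    (Laplacian.laplacian (η t) y
      - (y.ofLp ⬝ᵥ (Matrix.diagonal d *ᵥ y.ofLp)) * η t y) t
  initial : ∀ K : Set (EuclideanSpace ℝ (Fin n)), IsCompact K →
    (∀ t, t₀ < t → IntegrableOn (fun y => η t y - η₀ y) K) ∧
      Tendsto (fun t => ∫ y in K, |η t y - η₀ y|) (𝓝[>] t₀) (𝓝 0)
  growth : ∀ T, t₀ < T → ∃ a C : ℝ, ∀ t ∈ Ioc t₀ T,
    Integrable (fun y => exp (-a * ‖y‖ ^ 2) * η t y) ∧
      ∫ y, exp (-a * ‖y‖ ^ 2) * |η t y| ≤ C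

end

/-! Because D is diagonal, everything splits into coordinates: with ω = √dᵢ the kernel is a product
of Mehler kernels (`kernelPP_eq_prod`). Write A = ω coth(2τω) and B = ω csch(2τω), so that A² - B² =
ω².

Hermite series. Mehler's formula `hasSum_mehler` is obtained by writing one Hermite factor as a
Fourier integral and summing the generating function of the other under the integral sign. A
weighted arithmetic-geometric mean inequality bounds the terms by those of the series on the
diagonal, which yields a Gaussian majorant in z (`exists_hermiteTerm_bound`); dominated convergence
then permits integration against the datum.

Existence. As a function of z the kernel is the exponential of a quadratic polynomial whose
coefficients depend smoothly on time and y. The kernel integral is therefore a smooth prefactor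
times a Laplace-type integral (`kernelInt_eq`), differentiable under the integral sign to all
orders. The equation reduces to A' = -2B², B' = -2AB and A² - B² = ω². The ground state ψ(y) =
exp(-∑ √dᵢ yᵢ²/2) is an eigenfunction with factor at most 1; as the kernel is positive and
symmetric, the propagator contracts L¹ with weight ψ (`groundState_mul_kernelInt`), which gives the
growth bound. Convergence at points of continuity follows by comparison with a multiple of ψ and
smallness of the kernel off the diagonal; density of continuous functions and the contraction then
give convergence in L¹_loc.

Uniqueness. For the difference u of two solutions, of Gaussian growth rate a, a smoothed |u| is
integrated against a cut-off weight exp(-b(t)|y|²). Kato's inequality and Green's identity move the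
Laplacian onto the weight, where it produces 4b²|y|²; the rate b increases fast enough for -b'|y|²
to absorb this. The cut-off costs O(exp(-R/2)), which vanishes as R grows
(`integral_energyDensity_le`). This works on time intervals of length 1/(16(a+1)), and iteration
covers (t₀, T]. -/

noncomputable section

/-! ### The one-dimensional Mehler kernel and factorisation of the closed form. -/

/-- The diagonal coefficient `ω coth (2 τ ω)` of the quadratic form of the Mehler kernel. -/
def mehlerCoth (ω τ : ℝ) : ℝ := ω * (cosh (2 * τ * ω) / sinh (2 * τ * ω))

/-- The off-diagonal coefficient `ω csch (2 τ ω)` of the quadratic form of the Mehler kernel. -/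
def mehlerCsch (ω τ : ℝ) : ℝ := ω / sinh (2 * τ * ω)

/-- The normalising factor of the one-dimensional Mehler kernel. -/
def mehlerAmp (ω τ : ℝ) : ℝ := √(ω / (2 * π * sinh (2 * τ * ω)))

/-- The one-dimensional Mehler kernel of `∂ₜ - ∂ᵧ² + ω² y²`. -/
def mehlerKernel (ω τ y z : ℝ) : ℝ :=
  mehlerAmp ω τ *
    exp (-(mehlerCoth ω τ / 2) * (y ^ 2 + z ^ 2) + mehlerCsch ω τ * (y * z))

section Coefficients

variable {ω τ : ℝ}

lemma sinh_two_mul_pos (hω : 0 < ω) (hτ : 0 < τ) : 0 < sinh (2 * τ * ω) :=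
  sinh_pos_iff.2 (by positivity)

lemma mehlerCoth_pos (hω : 0 < ω) (hτ : 0 < τ) : 0 < mehlerCoth ω τ := by
  have := sinh_two_mul_pos hω hτ
  have := cosh_pos (2 * τ * ω)
  unfold mehlerCoth; positivity

lemma mehlerCsch_pos (hω : 0 < ω) (hτ : 0 < τ) : 0 < mehlerCsch ω τ := by
  have := sinh_two_mul_pos hω hτ
  unfold mehlerCsch; positivity

lemma mehlerAmp_pos (hω : 0 < ω) (hτ : 0 < τ) : 0 < mehlerAmp ω τ := by
  have := sinh_two_mul_pos hω hτ
  unfold mehlerAmp; positivity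

lemma mehlerKernel_pos (hω : 0 < ω) (hτ : 0 < τ) (y z : ℝ) : 0 < mehlerKernel ω τ y z :=
  mul_pos (mehlerAmp_pos hω hτ) (exp_pos _)

/-- This is cosh² - sinh² = 1. It evaluates the determinant, supplies the potential term of the
equation and identifies the ground state. -/
lemma mehlerCoth_sq_sub (hω : 0 < ω) (hτ : 0 < τ) :
    mehlerCoth ω τ ^ 2 - mehlerCsch ω τ ^ 2 = ω ^ 2 := by
  have h := (sinh_two_mul_pos hω hτ).ne'
  have h2 := cosh_sq (2 * τ * ω)
  unfold mehlerCoth mehlerCsch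
  generalize sinh (2 * τ * ω) = s at *
  generalize cosh (2 * τ * ω) = c at *
  field_simp
  rw [h2]; ring

lemma mehlerCsch_lt_mehlerCoth (hω : 0 < ω) (hτ : 0 < τ) : mehlerCsch ω τ < mehlerCoth ω τ := by
  nlinarith [mehlerCoth_sq_sub hω hτ, mehlerCoth_pos hω hτ, mehlerCsch_pos hω hτ, sq_pos_of_pos hω]

end Coefficients

lemma mehlerKernel_comm (ω τ y z : ℝ) : mehlerKernel ω τ y z = mehlerKernel ω τ z y := by
  unfold mehlerKernel; ring_nf

lemma continuous_mehlerKernel (ω τ : ℝ) :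
    Continuous fun p : ℝ × ℝ => mehlerKernel ω τ p.1 p.2 := by
  unfold mehlerKernel; fun_prop

/-- All blocks are diagonal, so the Schur complement gives the product of coth² - csch² over the
coordinates. The determinant is thus independent of time. -/
lemma det_kernelMatrix {n : ℕ} (d : Fin n → ℝ) (hd : ∀ i, 0 < d i) {τ : ℝ} (hτ : 0 < τ) :
    (kernelMatrix d τ).det = ∏ i, d i := by
  have hω : ∀ i, 0 < √(d i) := fun i => sqrt_pos.2 (hd i)
  have e1 : diagFun (fun x => √x) d * diagFun (fun x => cosh (2 * τ * √x) / sinh (2 * τ * √x)) d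
      = Matrix.diagonal fun i => mehlerCoth (√(d i)) τ := by
    simp [diagFun, Matrix.diagonal_mul_diagonal, mehlerCoth]
  have e2 : diagFun (fun x => √x) d * diagFun (fun x => 1 / sinh (2 * τ * √x)) d
      = Matrix.diagonal fun i => mehlerCsch (√(d i)) τ := by
    simp [diagFun, Matrix.diagonal_mul_diagonal, mehlerCsch, div_eq_mul_inv]
  have hne : ∀ i, mehlerCoth (√(d i)) τ ≠ 0 := fun i => (mehlerCoth_pos (hω i) hτ).ne'
  rw [kernelMatrix, e1, e2]
  let inv : Invertible (Matrix.diagonal fun i => mehlerCoth (√(d i)) τ) :=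
    ⟨Matrix.diagonal fun i => (mehlerCoth (√(d i)) τ)⁻¹,
      by simp [Matrix.diagonal_mul_diagonal, hne],
      by simp [Matrix.diagonal_mul_diagonal, hne]⟩
  have hinv : ⅟(Matrix.diagonal fun i => mehlerCoth (√(d i)) τ)
      = Matrix.diagonal fun i => (mehlerCoth (√(d i)) τ)⁻¹ := rfl
  rw [Matrix.det_fromBlocks₁₁, hinv]
  simp only [Matrix.neg_mul, Matrix.mul_neg, neg_neg, Matrix.diagonal_mul_diagonal,
    Matrix.diagonal_sub, Matrix.det_diagonal, ← Finset.prod_mul_distrib]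
  refine Finset.prod_congr rfl fun i _ => ?_
  have h1 := mehlerCoth_sq_sub (hω i) hτ
  have h2 := hne i
  rw [sq_sqrt (hd i).le] at h1
  field_simp
  linarith

lemma kernelPP_eq_prod {n : ℕ} (d : Fin n → ℝ) (hd : ∀ i, 0 < d i) {t₀ t : ℝ} (ht : t₀ < t)
    (y z : EuclideanSpace ℝ (Fin n)) :
    kernelPP d t₀ y t z = ∏ i, mehlerKernel (√(d i)) (t - t₀) (y i) (z i) := by
  have hτ : 0 < t - t₀ := sub_pos.2 ht
  have hω : ∀ i, 0 < √(d i) := fun i => sqrt_pos.2 (hd i)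
  have hs : ∀ i, 0 < sinh (2 * (t - t₀) * √(d i)) := fun i => sinh_two_mul_pos (hω i) hτ
  unfold kernelPP mehlerKernel
  rw [Finset.prod_mul_distrib, ← exp_sum, det_kernelMatrix d hd hτ]
  congr 1
  · have h1 : (∏ i, d i) ^ (1 / 4 : ℝ) = ∏ i, √(√(d i)) := by
      rw [← finsetProd_rpow _ _ fun i _ => (hd i).le]
      refine Finset.prod_congr rfl fun i _ => ?_
      rw [sqrt_eq_rpow, sqrt_eq_rpow, ← rpow_mul (hd i).le]; norm_num
    have h2 : (2 * π) ^ ((n : ℝ) / 2) = ∏ _i : Fin n, √(2 * π) := by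
      rw [Finset.prod_const, Finset.card_univ, Fintype.card_fin, sqrt_eq_rpow, ← rpow_natCast,
        ← rpow_mul (by positivity)]
      ring_nf
    have h3 : √(diagFun (fun x => sinh (2 * (t - t₀) * √x)) d).det
        = ∏ i, √(sinh (2 * (t - t₀) * √(d i))) := by
      rw [diagFun, Matrix.det_diagonal, sqrt_eq_rpow, ← finsetProd_rpow _ _ fun i _ => (hs i).le]
      simp [sqrt_eq_rpow]
    rw [h1, h2, h3, ← Finset.prod_mul_distrib, ← Finset.prod_div_distrib]
    refine Finset.prod_congr rfl fun i _ => ?_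
    rw [mehlerAmp, sqrt_div (hω i).le, sqrt_mul (by positivity : (0 : ℝ) ≤ 2 * π) (sinh _)]
  · congr 1
    have e : ∀ g : ℝ → ℝ, diagFun g d = Matrix.diagonal fun i => g (d i) := fun g => rfl
    simp only [kernelMatrix, e, Matrix.diagonal_mul_diagonal, Matrix.fromBlocks_mulVec,
      dotProduct, Fintype.sum_sum_type, Sum.elim_inl, Sum.elim_inr, Sum.elim_comp_inl,
      Sum.elim_comp_inr, Pi.add_apply, Matrix.neg_mulVec, Pi.neg_apply, Matrix.mulVec_diagonal]
    rw [← Finset.sum_add_distrib, Finset.mul_sum]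
    refine Finset.sum_congr rfl fun i _ => ?_
    unfold mehlerCoth mehlerCsch
    ring

end

/-! ### Hermite polynomials: Cauchy bounds, generating function, Fourier representation. -/

noncomputable section

/-- Both sides differentiate the same curve along the real axis. This gives the Rodrigues formula
access to the Cauchy estimates and Taylor series of an entire function. -/
lemma iteratedDeriv_ofReal_eq {f : ℂ → ℂ} {g : ℝ → ℝ} (hf : Differentiable ℂ f)
    (hg : ContDiff ℝ (⊤ : ℕ∞) g) (hfg : ∀ x : ℝ, f x = g x) (k : ℕ) (x : ℝ) :
    iteratedDeriv k f x = (iteratedDeriv k g x : ℝ) := by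
  induction k generalizing x with
  | zero => simpa using hfg x
  | succ k ih =>
    rw [iteratedDeriv_succ, iteratedDeriv_succ]
    have hf' : ContDiff ℂ (⊤ : ℕ∞) f := hf.contDiff
    have h1 : HasDerivAt (iteratedDeriv k f) (deriv (iteratedDeriv k f) x) (x : ℂ) :=
      (hf'.differentiable_iteratedDeriv k (by exact_mod_cast WithTop.coe_lt_top _)
        |>.differentiableAt).hasDerivAt
    have h2 : HasDerivAt (iteratedDeriv k g) (deriv (iteratedDeriv k g) x) x :=
      (hg.differentiable_iteratedDeriv k (by exact_mod_cast WithTop.coe_lt_top _)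
        |>.differentiableAt).hasDerivAt
    have h3 := h1.comp_ofReal
    have h4 := h2.ofReal_comp
    rw [show (fun y : ℝ => iteratedDeriv k f (y : ℂ)) = fun y => ((iteratedDeriv k g y : ℝ) : ℂ)
      from funext ih] at h3
    exact h3.unique h4

lemma contDiff_exp_neg_sq : ContDiff ℝ (⊤ : ℕ∞) (fun s : ℝ => exp (-s ^ 2)) := by fun_prop

lemma differentiable_cexp_neg_sq : Differentiable ℂ (fun s : ℂ => Complex.exp (-s ^ 2)) := by
  fun_prop

lemma iteratedDeriv_cexp_neg_sq (k : ℕ) (x : ℝ) :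
    iteratedDeriv k (fun s : ℂ => Complex.exp (-s ^ 2)) x
      = ((-1) ^ k * exp (-x ^ 2) * physHermite k x : ℝ) := by
  rw [iteratedDeriv_ofReal_eq differentiable_cexp_neg_sq contDiff_exp_neg_sq (by simp) k x]
  congr 1
  unfold physHermite
  have h1 : ((-1 : ℝ) ^ k) * (-1) ^ k = 1 := by rw [← mul_pow]; simp
  have h2 : exp (-x ^ 2) * exp (x ^ 2) = 1 := by rw [← exp_add]; simp
  calc _ = (((-1 : ℝ) ^ k) * (-1) ^ k) * (exp (-x ^ 2) * exp (x ^ 2)) *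
        iteratedDeriv k (fun s : ℝ => exp (-s ^ 2)) x := by rw [h1, h2]; ring
    _ = _ := by ring

lemma continuous_physHermite (k : ℕ) : Continuous (physHermite k) := by
  unfold physHermite
  have := contDiff_exp_neg_sq.continuous_iteratedDeriv k (by exact_mod_cast le_top)
  fun_prop

/-- Cauchy's estimate for exp(-z²) on the circle of radius ρ about x, where |exp(-z²)| ≤ exp(-x²)
exp(2|x|ρ + ρ²). The radius stays free so that it can later be matched to the Fourier variable. -/
lemma abs_physHermite_le (k : ℕ) (x : ℝ) {ρ : ℝ} (hρ : 0 < ρ) :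
    |physHermite k x| ≤ (k ! : ℝ) * exp (2 * |x| * ρ + ρ ^ 2) / ρ ^ k := by
  have h := Complex.norm_iteratedDeriv_le_of_forall_mem_sphere_norm_le (c := (x : ℂ)) (R := ρ)
    (C := exp (-x ^ 2) * exp (2 * |x| * ρ + ρ ^ 2))
    (f := fun s : ℂ => Complex.exp (-s ^ 2)) k hρ differentiable_cexp_neg_sq.diffContOnCl
    (by
      intro z hz
      rw [Complex.norm_exp, ← exp_add]
      refine exp_le_exp.2 ?_
      obtain ⟨w, rfl⟩ : ∃ w : ℂ, z = x + w := ⟨z - x, by ring⟩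
      have hw : ‖w‖ = ρ := by simpa using hz
      have h1 : |w.re| ≤ ρ := hw ▸ Complex.abs_re_le_norm w
      have h2 : |w.im| ≤ ρ := hw ▸ Complex.abs_im_le_norm w
      have h3 : |x * w.re| ≤ |x| * ρ := by rw [abs_mul]; gcongr
      have h4 : w.im ^ 2 ≤ ρ ^ 2 := sq_le_sq' (by linarith [neg_abs_le w.im])
        (by linarith [le_abs_self w.im])
      have h5 := neg_abs_le (x * w.re)
      have : (-(↑x + w) ^ 2 : ℂ).re = -((x + w.re) ^ 2 - w.im ^ 2) := by
        simp [pow_two]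
      rw [this]
      nlinarith [sq_nonneg w.re])
  rw [iteratedDeriv_cexp_neg_sq, Complex.norm_real, norm_mul, norm_mul, norm_pow, norm_neg,
    norm_one, one_pow, one_mul, norm_of_nonneg (exp_pos _).le, Real.norm_eq_abs] at h
  have he := exp_pos (-x ^ 2)
  rw [show (k ! : ℝ) * (exp (-x ^ 2) * exp (2 * |x| * ρ + ρ ^ 2)) / ρ ^ k
    = exp (-x ^ 2) * ((k ! : ℝ) * exp (2 * |x| * ρ + ρ ^ 2) / ρ ^ k) by ring] at h
  exact le_of_mul_le_mul_left h he

/-- The generating function of the physicist's Hermite polynomials. -/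
lemma hasSum_physHermite_generating (x : ℝ) (s : ℂ) :
    HasSum (fun k : ℕ => (k ! : ℂ)⁻¹ * s ^ k * (physHermite k x : ℂ))
      (Complex.exp (2 * x * s - s ^ 2)) := by
  -- Expanding about x and evaluating at x - s makes the powers (-s)^k, whose signs cancel those of
  -- the Rodrigues formula.
  have h := Complex.hasSum_taylorSeries_of_entire differentiable_cexp_neg_sq (x : ℂ) (x - s)
  have h2 := h.mul_left (Complex.exp (x ^ 2))
  have e0 : Complex.exp ((x : ℂ) ^ 2) * Complex.exp (-((x : ℂ)) ^ 2) = 1 := by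
    rw [← Complex.exp_add]; simp
  have e1 : ∀ k : ℕ, (k ! : ℂ)⁻¹ * s ^ k * (physHermite k x : ℂ) = Complex.exp ((x : ℂ) ^ 2) *
      ((k ! : ℂ)⁻¹ • ((x : ℂ) - s - x) ^ k •
        iteratedDeriv k (fun s : ℂ => Complex.exp (-s ^ 2)) x) := fun k => by
    rw [iteratedDeriv_cexp_neg_sq, smul_eq_mul, smul_eq_mul]
    push_cast
    have h1 : (-1 : ℂ) ^ k * (-1) ^ k = 1 := by rw [← mul_pow]; simp
    rw [show (x : ℂ) - s - x = -1 * s by ring, mul_pow]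
    calc _ = ((-1 : ℂ) ^ k * (-1) ^ k) *
          (Complex.exp ((x : ℂ) ^ 2) * Complex.exp (-((x : ℂ)) ^ 2)) *
            ((k ! : ℂ)⁻¹ * s ^ k * (physHermite k x : ℂ)) := by rw [h1, e0]; ring
      _ = _ := by ring
  have e2 : Complex.exp (2 * x * s - s ^ 2)
      = Complex.exp ((x : ℂ) ^ 2) * Complex.exp (-((x : ℂ) - s) ^ 2) := by
    rw [← Complex.exp_add]; congr 1; ring
  rw [e2, funext e1]
  exact h2

lemma integrable_exp_quadratic {b : ℝ} (hb : 0 < b) (c : ℝ) :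
    Integrable fun x : ℝ => exp (-b * x ^ 2 + c * x) := by
  have h := (integrable_cexp_quadratic (b := (b : ℂ)) (by simpa using hb) c 0).norm
  refine h.congr (Eventually.of_forall fun x => ?_)
  simp only [Complex.norm_exp]
  congr 1
  have : (-(b : ℂ) * x ^ 2 + c * x + 0) = ((-b * x ^ 2 + c * x : ℝ) : ℂ) := by push_cast; ring
  rw [this, Complex.ofReal_re]

lemma integral_exp_quadratic {b : ℝ} (hb : 0 < b) (c : ℝ) :
    ∫ x : ℝ, exp (-b * x ^ 2 + c * x) = √(π / b) * exp (c ^ 2 / (4 * b)) := by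
  rw [← integral_gaussian, ← integral_add_right_eq_self _ (c / (2 * b)),
    ← integral_mul_const]
  refine integral_congr_ae (Eventually.of_forall fun x => ?_)
  simp only [← exp_add]
  congr 1
  field_simp
  ring

lemma integrable_exp_quadratic_abs {b : ℝ} (hb : 0 < b) (c : ℝ) :
    Integrable fun x : ℝ => exp (-b * x ^ 2 + c * |x|) := by
  refine ((integrable_exp_quadratic hb c).add (integrable_exp_quadratic hb (-c))).mono'
    (by fun_prop) (Eventually.of_forall fun x => ?_)
  rw [norm_of_nonneg (exp_pos _).le]
  have h1 := exp_pos (-b * x ^ 2 + c * x)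
  have h2 := exp_pos (-b * x ^ 2 + -c * x)
  simp only [Pi.add_apply]
  rcases abs_cases x with ⟨h, _⟩ | ⟨h, _⟩
  · rw [h]; linarith
  · rw [h, show c * -x = -c * x by ring]; linarith

open scoped FourierTransform in
-- The function exp(-t²) is √π times the Fourier transform of exp(-π²v²). Each derivative multiplies
-- the integrand by -2πiv, and the Rodrigues sign turns this into 2πiv.
lemma physHermite_eq_integral (k : ℕ) (y : ℝ) :
    ((exp (-y ^ 2) * physHermite k y : ℝ) : ℂ) = √π * ∫ v : ℝ,
      (2 * π * Complex.I * v) ^ k * Complex.exp (-2 * π * v * y * Complex.I + -π ^ 2 * v ^ 2) := by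
  have hG := fourier_gaussian_pi (b := (π : ℂ)) (by simpa using pi_pos)
  have hsq : (π : ℂ) ^ (1 / 2 : ℂ) = (√π : ℝ) := by
    rw [sqrt_eq_rpow, Complex.ofReal_cpow pi_pos.le]; simp
  have hπ : ((√π : ℝ) : ℂ) ≠ 0 := by
    exact_mod_cast (sqrt_pos.2 pi_pos).ne'
  have hπ' : (π : ℂ) ≠ 0 := by exact_mod_cast pi_ne_zero
  set f : ℝ → ℂ := fun x : ℝ => Complex.exp (-π * π * x ^ 2) with hf
  have hfun : (fun t : ℝ => ((exp (-t ^ 2) : ℝ) : ℂ)) = fun t => (√π : ℝ) * 𝓕 f t := by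
    rw [hG]
    ext t
    rw [hsq, neg_div, div_self hπ']
    push_cast
    field_simp
  have hint : ∀ n : ℕ, Integrable fun x : ℝ => x ^ n • f x := by
    intro n
    -- Moments are absorbed through |x|^n ≤ n! exp|x|.
    have h1 : Integrable fun x : ℝ => ((n ! : ℝ) * exp (-π ^ 2 * x ^ 2 + 1 * |x|)) :=
      (integrable_exp_quadratic_abs (by positivity) 1).const_mul _
    refine h1.mono' (by simp only [hf]; fun_prop) (Eventually.of_forall fun x => ?_)
    rw [norm_smul, norm_pow, Real.norm_eq_abs, hf]
    simp only [Complex.norm_exp]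
    have e : (-(π : ℂ) * π * x ^ 2) = ((-π ^ 2 * x ^ 2 : ℝ) : ℂ) := by push_cast; ring
    rw [e, Complex.ofReal_re, exp_add, one_mul]
    have := pow_div_factorial_le_exp |x| (abs_nonneg x) n
    rw [div_le_iff₀ (by positivity)] at this
    nlinarith [exp_pos (-π ^ 2 * x ^ 2)]
  have hit := Real.iteratedDeriv_fourier (f := f) (N := ⊤) (n := k) (fun n _ => hint n) le_top
  have hsm : ContDiff ℝ k (𝓕 f) := by
    rw [hG]
    have : ContDiff ℝ k (fun t : ℝ => (t : ℂ)) := Complex.ofRealCLM.contDiff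
    exact contDiff_const.mul (contDiff_const.mul (this.pow 2)).cexp
  have h1 : iteratedDeriv k (fun t : ℝ => ((exp (-t ^ 2) : ℝ) : ℂ)) y
      = ((iteratedDeriv k (fun t : ℝ => exp (-t ^ 2)) y : ℝ) : ℂ) := by
    have := ((contDiff_exp_neg_sq.of_le (by exact_mod_cast le_top)).contDiffAt (x := y) :
      ContDiffAt ℝ k _ y)
    have h := Complex.ofRealCLM.iteratedFDeriv_comp_left this le_rfl
    rw [iteratedDeriv_eq_iteratedFDeriv, iteratedDeriv_eq_iteratedFDeriv]
    exact congrArg (fun M => M fun _ => (1 : ℝ)) h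
  have h2 : ((iteratedDeriv k (fun t : ℝ => exp (-t ^ 2)) y : ℝ) : ℂ)
      = √π * 𝓕 (fun x : ℝ => (-2 * π * Complex.I * x) ^ k • f x) y := by
    rw [← h1, hfun, iteratedDeriv_const_mul_field, hit]
  have h3 : exp (-y ^ 2) * physHermite k y
      = (-1) ^ k * iteratedDeriv k (fun t : ℝ => exp (-t ^ 2)) y := by
    unfold physHermite
    have : exp (-y ^ 2) * exp (y ^ 2) = 1 := by rw [← exp_add]; simp
    linear_combination ((-1) ^ k * iteratedDeriv k (fun t : ℝ => exp (-t ^ 2)) y) * this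
  rw [h3, Complex.ofReal_mul, h2, fourier_real_eq_integral_exp_smul, mul_left_comm,
    ← integral_const_mul]
  congr 2
  ext v
  push_cast
  rw [smul_eq_mul, smul_eq_mul, hf]
  simp only
  rw [show -π ^ 2 * (v : ℂ) ^ 2 = -π * π * v ^ 2 by ring, Complex.exp_add,
    show (-2 * (π : ℂ) * Complex.I * v) = (-1) * (2 * π * Complex.I * v) by ring, mul_pow (-1 : ℂ)]
  have h1 : (-1 : ℂ) ^ k * (-1) ^ k = 1 := by rw [← mul_pow]; simp
  linear_combination (Complex.exp (-2 * π * v * y * Complex.I) *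
    ((2 * π * Complex.I * v) ^ k * Complex.exp (-π * π * v ^ 2))) * h1

end

/-! ### Mehler's formula. -/

noncomputable section

/-- The Cauchy radius is π|v|q with q slightly above r. The quotient of the radii supplies a
geometric factor, and for q < 1 the growth exp(π²q²v²) is still beaten by exp(-π²v²). -/
lemma norm_physHermite_mul_pow_le (k : ℕ) (x v : ℝ) {r q : ℝ} (hr : 0 < r) (hrq : r < q)
    (hv : v ≠ 0) :
    ((k ! : ℝ))⁻¹ * (π * |v| * r) ^ k * |physHermite k x|
      ≤ (r / q) ^ k * exp (2 * |x| * (π * |v| * q) + (π * |v| * q) ^ 2) := by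
  have hq : 0 < q := hr.trans hrq
  have hv' : 0 < |v| := abs_pos.2 hv
  have hρ : 0 < π * |v| * q := by positivity
  calc _ ≤ ((k ! : ℝ))⁻¹ * (π * |v| * r) ^ k *
        ((k ! : ℝ) * exp (2 * |x| * (π * |v| * q) + (π * |v| * q) ^ 2) / (π * |v| * q) ^ k) := by
        gcongr
        exact abs_physHermite_le k x hρ
    _ = ((π * |v| * r) ^ k / (π * |v| * q) ^ k) *
        exp (2 * |x| * (π * |v| * q) + (π * |v| * q) ^ 2) := by
        field_simp
    _ = _ := by
        rw [← div_pow, mul_div_mul_left _ _ (by positivity)]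

/-- **Mehler's formula** for the physicist's Hermite polynomials. -/
lemma hasSum_mehler {r : ℝ} (hr : 0 < r) (hr1 : r < 1) (x y : ℝ) :
    HasSum (fun k : ℕ => r ^ k / (2 ^ k * (k ! : ℝ)) * physHermite k x * physHermite k y)
      ((√(1 - r ^ 2))⁻¹ * exp (y ^ 2 - (y - x * r) ^ 2 / (1 - r ^ 2))) := by
  -- The lower bound on q makes r/q summable geometrically; the upper bound keeps the majorant
  -- integrable in v.
  obtain ⟨q, hrq, hq1⟩ := exists_between hr1
  have hq : 0 < q := hr.trans hrq
  have hr2 : 0 < 1 - r ^ 2 := by nlinarith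
  have hq2 : 0 < 1 - q ^ 2 := by nlinarith
  set E : ℝ → ℂ := fun v => Complex.exp (-2 * π * v * y * Complex.I + -π ^ 2 * v ^ 2) with hE
  have hEnorm : ∀ v, ‖E v‖ = exp (-π ^ 2 * v ^ 2) := fun v => by
    rw [hE]
    simp only [Complex.norm_exp]
    have : (-2 * (π : ℂ) * v * y * Complex.I + -π ^ 2 * v ^ 2)
      = ((-π ^ 2 * v ^ 2 : ℝ) : ℂ) + ((-2 * π * v * y : ℝ) : ℂ) * Complex.I := by push_cast; ring
    rw [this, Complex.add_re, Complex.re_ofReal_mul, Complex.ofReal_re, Complex.I_re]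
    simp
  set F : ℕ → ℝ → ℂ := fun k v =>
    ((k ! : ℂ)⁻¹ * (π * Complex.I * v * r) ^ k * (physHermite k x : ℂ)) * E v with hF
  -- With the second Hermite factor written as a Fourier integral, the sum over k is the generating
  -- function at s = iπvr.
  have hsum : HasSum (fun k => ∫ v, F k v) (∫ v : ℝ,
      Complex.exp (2 * x * (π * Complex.I * v * r) - (π * Complex.I * v * r) ^ 2) * E v) := by
    refine hasSum_integral_of_dominated_convergence
      (fun k v => (r / q) ^ k * exp (-(π ^ 2 * (1 - q ^ 2)) * v ^ 2 + 2 * |x| * π * q * |v|))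
      (fun k => by simp only [hF, hE]; fun_prop) (fun k => ?_) ?_ ?_ ?_
    -- The null set v = 0 is discarded because the Cauchy radius must be positive.
    · filter_upwards [compl_mem_ae_iff.2 (measure_singleton (0 : ℝ))] with v hv
      have h1 := norm_physHermite_mul_pow_le k x v hr hrq hv
      simp only [hF]
      rw [norm_mul, hEnorm]
      simp only [norm_mul, norm_inv, norm_pow, Complex.norm_natCast, Complex.norm_I,
        Complex.norm_real, Real.norm_eq_abs, mul_one, abs_of_pos pi_pos, abs_of_pos hr]
      calc _ ≤ (r / q) ^ k * exp (2 * |x| * (π * |v| * q) + (π * |v| * q) ^ 2) *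
            exp (-π ^ 2 * v ^ 2) := by gcongr
        _ = _ := by
          rw [mul_assoc, ← exp_add]
          congr 2
          rw [mul_pow, mul_pow, sq_abs]; ring
    · refine Eventually.of_forall fun v => Summable.mul_right _ ?_
      exact summable_geometric_of_lt_one (by positivity) ((div_lt_one hq).2 hrq)
    · simp_rw [tsum_mul_right]
      exact (integrable_exp_quadratic_abs (by positivity) _).const_mul _
    · exact Eventually.of_forall fun v => (hasSum_physHermite_generating x _).mul_right _
  have hπ : ((√π : ℝ) : ℂ) ≠ 0 := by
    exact_mod_cast (sqrt_pos.2 pi_pos).ne'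
  have hπ' : (π : ℂ) ≠ 0 := by exact_mod_cast pi_ne_zero
  have hterm : ∀ k : ℕ, √π * ∫ v, F k v = ((r ^ k / (2 ^ k * (k ! : ℝ)) * physHermite k x *
      (exp (-y ^ 2) * physHermite k y) : ℝ) : ℂ) := fun k => by
    rw [Complex.ofReal_mul, physHermite_eq_integral, mul_left_comm]
    refine congrArg (fun w => ((√π : ℝ) : ℂ) * w) ?_
    rw [← integral_const_mul]
    refine integral_congr_ae (Eventually.of_forall fun v => ?_)
    simp only [hF, hE]
    push_cast
    rw [show (π : ℂ) * Complex.I * v * r = (2 * π * Complex.I * v) * (r / 2) by ring, mul_pow,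
      div_pow]
    field_simp
  -- What remains is the Fourier transform of exp(-π²(1 - r²)v²) at the frequency y - xr.
  have hval : √π * ∫ v : ℝ,
      Complex.exp (2 * x * (π * Complex.I * v * r) - (π * Complex.I * v * r) ^ 2) * E v
      = (((√(1 - r ^ 2))⁻¹ * exp (- (y - x * r) ^ 2 / (1 - r ^ 2)) : ℝ) : ℂ) := by
    have hb : 0 < ((π * (1 - r ^ 2) : ℝ) : ℂ).re := by rw [Complex.ofReal_re]; positivity
    have h1 := congrFun (fourier_gaussian_pi hb) (y - x * r)
    rw [fourier_real_eq_integral_exp_smul] at h1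
    have h2 : ((π * (1 - r ^ 2) : ℝ) : ℂ) ^ (1 / 2 : ℂ) = ((√π * √(1 - r ^ 2) : ℝ) : ℂ) := by
      rw [← sqrt_mul pi_pos.le, sqrt_eq_rpow, Complex.ofReal_cpow (by positivity)]; simp
    rw [h2] at h1
    calc _ = √π * ∫ v : ℝ, Complex.exp (((-2 * π * v * (y - x * r) : ℝ) : ℂ) * Complex.I) •
          Complex.exp (-π * ((π * (1 - r ^ 2) : ℝ) : ℂ) * v ^ 2) := by
          congr 2
          ext v
          rw [hE, smul_eq_mul, ← Complex.exp_add, ← Complex.exp_add]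
          congr 1
          push_cast
          linear_combination (-π ^ 2 * v ^ 2 * r ^ 2 : ℂ) * Complex.I_sq
      _ = _ := by
          rw [h1]
          have h3 : ((√(1 - r ^ 2) : ℝ) : ℂ) ≠ 0 := by exact_mod_cast (sqrt_pos.2 hr2).ne'
          have h4 : (1 - r ^ 2 : ℂ) ≠ 0 := by exact_mod_cast hr2.ne'
          push_cast
          field_simp
  have hreal := hsum.mul_left ((√π : ℝ) : ℂ)
  rw [hval] at hreal
  simp only [hterm] at hreal
  have hreal' := (Complex.hasSum_ofReal.1 hreal).mul_left (exp (y ^ 2))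
  have e0 : exp (y ^ 2) * exp (-y ^ 2) = 1 := by rw [← exp_add]; simp
  rw [show exp (y ^ 2) * ((√(1 - r ^ 2))⁻¹ * exp (-(y - x * r) ^ 2 / (1 - r ^ 2)))
    = (√(1 - r ^ 2))⁻¹ * exp (y ^ 2 - (y - x * r) ^ 2 / (1 - r ^ 2)) by
      rw [mul_left_comm, ← exp_add]; ring_nf] at hreal'
  refine hreal'.congr_fun fun k => ?_
  linear_combination (-(r ^ k / (2 ^ k * (k ! : ℝ)) * physHermite k x * physHermite k y)) * e0

end

/-! ### Gaussian integrability and the Hermite expansion in n dimensions. -/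

noncomputable section

section Gaussian

variable {n : ℕ}

/-- `f` is integrable against every centred Gaussian. -/
def GaussIntegrable (f : EuclideanSpace ℝ (Fin n) → ℝ) : Prop :=
  ∀ ε : ℝ, 0 < ε → Integrable fun z => exp (-ε * ‖z‖ ^ 2) * f z

/-- Only a Gaussian bound on the multiplier is needed, of any positive rate: multiplied by
exp(ε|z|²) it is bounded, and the inverse weight goes to the datum. -/
lemma GaussIntegrable.integrable_mul {f g : EuclideanSpace ℝ (Fin n) → ℝ}
    (hf : GaussIntegrable f) (hg : AEStronglyMeasurable g) {C ε : ℝ} (hε : 0 < ε)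
    (hgC : ∀ z, |g z| ≤ C * exp (-ε * ‖z‖ ^ 2)) : Integrable fun z => g z * f z := by
  have h : Integrable fun z => (g z * exp (ε * ‖z‖ ^ 2)) * (exp (-ε * ‖z‖ ^ 2) * f z) := by
    refine (hf ε hε).bdd_mul (c := C) (hg.mul (by fun_prop)) (Eventually.of_forall fun z => ?_)
    rw [norm_mul, norm_of_nonneg (exp_pos _).le, Real.norm_eq_abs]
    calc _ ≤ (C * exp (-ε * ‖z‖ ^ 2)) * exp (ε * ‖z‖ ^ 2) := by gcongr; exact hgC z
      _ = C := by rw [mul_assoc, ← exp_add]; simp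
  refine h.congr (Eventually.of_forall fun z => ?_)
  have : exp (ε * ‖z‖ ^ 2) * exp (-ε * ‖z‖ ^ 2) = 1 := by rw [← exp_add]; simp
  simp only
  linear_combination g z * f z * this

lemma exists_pos_forall_le {ι : Type*} [Finite ι] {β : ι → ℝ} (hβ : ∀ i, 0 < β i) :
    ∃ ε : ℝ, 0 < ε ∧ ∀ i, ε ≤ β i := by
  rcases isEmpty_or_nonempty ι with h | h
  · exact ⟨1, one_pos, fun i => h.elim i⟩
  · obtain ⟨i, hi⟩ := Finite.exists_min β
    exact ⟨β i, hβ i, hi⟩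

lemma norm_sq_eq_sum (z : EuclideanSpace ℝ (Fin n)) : ‖z‖ ^ 2 = ∑ i, z i ^ 2 := by
  simp [EuclideanSpace.norm_sq_eq]

lemma prod_exp_le {β : Fin n → ℝ} {ε : ℝ} (hβ : ∀ i, ε ≤ β i) (z : EuclideanSpace ℝ (Fin n)) :
    ∏ i, exp (-β i * z i ^ 2) ≤ exp (-ε * ‖z‖ ^ 2) := by
  rw [← exp_sum, norm_sq_eq_sum, Finset.mul_sum]
  refine exp_le_exp.2 (Finset.sum_le_sum fun i _ => ?_)
  nlinarith [hβ i, sq_nonneg (z i)]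

end Gaussian

lemma hasSum_mul_real {ι κ : Type*} {f : ι → ℝ} {g : κ → ℝ} {a b : ℝ} (hf : HasSum f a)
    (hg : HasSum g b) : HasSum (fun p : ι × κ => f p.1 * g p.2) (a * b) :=
  hf.mul hg (summable_mul_of_summable_norm hf.summable.norm hg.summable.norm)

/-- Termwise product of finitely many absolutely convergent series. -/
lemma hasSum_prod_of_hasSum {n : ℕ} {f : Fin n → ℕ → ℝ} {a : Fin n → ℝ}
    (h : ∀ i, HasSum (f i) (a i)) :
    HasSum (fun m : Fin n → ℕ => ∏ i, f i (m i)) (∏ i, a i) := by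
  induction n with
  | zero => simp
  | succ n ih =>
    have h0 := ih (f := fun i => f i.succ) (a := fun i => a i.succ) fun i => h i.succ
    have h1 := hasSum_mul_real (h 0) h0
    rw [Fin.prod_univ_succ, ← (Fin.consEquiv fun _ : Fin (n + 1) => ℕ).hasSum_iff]
    refine h1.congr_fun fun p => ?_
    simp [Fin.consEquiv, Fin.prod_univ_succ]

/-- The one-dimensional factor of `hermiteTerm`, with `ω = √d`. -/
def hermiteFactor (ω τ : ℝ) (k : ℕ) (y z : ℝ) : ℝ :=
  √ω / (√π * 2 ^ k * (k ! : ℝ)) *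
    exp (-τ * ω * (2 * (k : ℝ) + 1) - (y ^ 2 + z ^ 2) * ω / 2) *
    physHermite k (√ω * y) * physHermite k (√ω * z)

lemma hermiteTerm_eq_prod {n : ℕ} (d : Fin n → ℝ) (hd : ∀ i, 0 < d i) (t₀ t : ℝ) (m : Fin n → ℕ)
    (y z : EuclideanSpace ℝ (Fin n)) :
    hermiteTerm d t₀ t m y z = ∏ i, hermiteFactor (√(d i)) (t - t₀) (m i) (y i) (z i) := by
  refine Finset.prod_congr rfl fun i _ => ?_
  have : d i ^ (1 / 4 : ℝ) = √(√(d i)) := by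
    rw [sqrt_eq_rpow, sqrt_eq_rpow, ← rpow_mul (hd i).le]; norm_num
  rw [hermiteFactor, this]

lemma continuous_hermiteFactor (ω τ : ℝ) (k : ℕ) (y : ℝ) :
    Continuous (hermiteFactor ω τ k y) := by
  unfold hermiteFactor
  have := continuous_physHermite k
  fun_prop

/-- Mehler's formula with r = exp(-2τω) and arguments scaled by √ω. Since sinh(2τω) = (1 - r²)/(2r),
the factor exp(-τω) = √r turns 1/√(1 - r²) into 1/√(2 sinh(2τω)). -/
lemma hasSum_hermiteFactor {ω τ : ℝ} (hω : 0 < ω) (hτ : 0 < τ) (y z : ℝ) :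
    HasSum (fun k => hermiteFactor ω τ k y z) (mehlerKernel ω τ y z) := by
  set r := exp (-(2 * τ * ω)) with hr
  have hr0 : 0 < r := exp_pos _
  have hr1 : r < 1 := exp_lt_one_iff.2 (by have := mul_pos hτ hω; linarith)
  have hr2 : 0 < 1 - r ^ 2 := by nlinarith
  have hωs : √ω ^ 2 = ω := sq_sqrt hω.le
  have h := (hasSum_mehler hr0 hr1 (√ω * y) (√ω * z)).mul_left
    (√ω / √π * exp (-τ * ω) * exp (-(y ^ 2 + z ^ 2) * ω / 2))
  have hinv : exp (2 * τ * ω) = r⁻¹ := by rw [hr, exp_neg, inv_inv]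
  have hsinh : sinh (2 * τ * ω) = (1 - r ^ 2) / (2 * r) := by
    rw [sinh_eq, ← hr, hinv]; field_simp
  have hcosh : cosh (2 * τ * ω) = (1 + r ^ 2) / (2 * r) := by
    rw [cosh_eq, ← hr, hinv]; field_simp
  have hval : √ω / √π * exp (-τ * ω) * exp (-(y ^ 2 + z ^ 2) * ω / 2) *
      ((√(1 - r ^ 2))⁻¹ * exp ((√ω * z) ^ 2 - (√ω * z - √ω * y * r) ^ 2 / (1 - r ^ 2)))
      = mehlerKernel ω τ y z := by
    have h1 : mehlerAmp ω τ = √ω / √π * exp (-τ * ω) * (√(1 - r ^ 2))⁻¹ := by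
      have : exp (-τ * ω) = √r := by rw [hr, ← exp_half]; ring_nf
      rw [mehlerAmp, hsinh, this, ← sqrt_inv, ← sqrt_div hω.le, ← sqrt_mul (by positivity),
        ← sqrt_mul (by positivity)]
      congr 1; field_simp
    have h2 : -(y ^ 2 + z ^ 2) * ω / 2 +
        ((√ω * z) ^ 2 - (√ω * z - √ω * y * r) ^ 2 / (1 - r ^ 2))
        = -(mehlerCoth ω τ / 2) * (y ^ 2 + z ^ 2) + mehlerCsch ω τ * (y * z) := by
      rw [mehlerCoth, mehlerCsch, hsinh, hcosh,
        show (√ω * z - √ω * y * r) ^ 2 = √ω ^ 2 * (z - y * r) ^ 2 by ring, mul_pow, hωs]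
      field_simp
      ring
    rw [mehlerKernel, h1, ← h2, exp_add]
    ring
  rw [hval] at h
  refine h.congr_fun fun k => ?_
  have : exp (-τ * ω * (2 * (k : ℝ) + 1) - (y ^ 2 + z ^ 2) * ω / 2)
      = r ^ k * exp (-τ * ω) * exp (-(y ^ 2 + z ^ 2) * ω / 2) := by
    rw [hr, ← exp_nat_mul, ← exp_add, ← exp_add]; ring_nf
  rw [hermiteFactor, this]
  field_simp

/-- Weighted arithmetic-geometric mean bound for a term of Mehler's expansion. -/
lemma abs_hermiteFactor_le {ω τ : ℝ} (k : ℕ) (y z : ℝ) {c : ℝ} (hc : 0 < c) :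
    |hermiteFactor ω τ k y z|
      ≤ (c * hermiteFactor ω τ k y y + c⁻¹ * hermiteFactor ω τ k z z) / 2 := by
  set A := √ω / (√π * 2 ^ k * (k ! : ℝ)) * exp (-τ * ω * (2 * (k : ℝ) + 1)) with hA
  have hA0 : 0 ≤ A := by positivity
  set G : ℝ → ℝ := fun x => exp (-x ^ 2 * ω / 2) * physHermite k (√ω * x) with hG
  -- Each term is a nonnegative constant times G(u)G(v), so the diagonal terms are nonnegative and
  -- the inequality of means applies to G(y)G(z).
  have key : ∀ u v, hermiteFactor ω τ k u v = A * (G u * G v) := fun u v => by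
    have : exp (-τ * ω * (2 * (k : ℝ) + 1) - (u ^ 2 + v ^ 2) * ω / 2)
      = exp (-τ * ω * (2 * (k : ℝ) + 1)) * exp (-u ^ 2 * ω / 2) * exp (-v ^ 2 * ω / 2) := by
      rw [← exp_add, ← exp_add]; ring_nf
    rw [hermiteFactor, this, hA, hG]
    ring
  rw [key, key, key, abs_mul, abs_of_nonneg hA0]
  have h2 : |G y * G z| ≤ (c * (G y * G y) + c⁻¹ * (G z * G z)) / 2 := by
    have hs : c = √c ^ 2 := (sq_sqrt hc.le).symm
    have hs0 : √c ≠ 0 := (sqrt_pos.2 hc).ne'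
    have e1 : c * (G y * G y) = (√c * G y) ^ 2 := by rw [mul_pow, ← hs]; ring
    have e2 : c⁻¹ * (G z * G z) = ((√c)⁻¹ * G z) ^ 2 := by rw [mul_pow, inv_pow, ← hs]; ring
    have e3 : G y * G z = (√c * G y) * ((√c)⁻¹ * G z) := by field_simp
    rw [e1, e2, e3, abs_le]
    constructor <;> nlinarith [sq_nonneg (√c * G y + (√c)⁻¹ * G z),
      sq_nonneg (√c * G y - (√c)⁻¹ * G z)]
  calc A * |G y * G z| ≤ A * ((c * (G y * G y) + c⁻¹ * (G z * G z)) / 2) := by gcongr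
    _ = _ := by ring

section Series

variable {n : ℕ} {d : Fin n → ℝ} {t₀ t : ℝ} {η₀ : EuclideanSpace ℝ (Fin n) → ℝ}

/-- The Hermite expansion of the kernel converges absolutely, with a Gaussian majorant. -/
lemma exists_hermiteTerm_bound (hd : ∀ i, 0 < d i) (ht : t₀ < t)
    (y : EuclideanSpace ℝ (Fin n)) :
    ∃ (b : (Fin n → ℕ) → EuclideanSpace ℝ (Fin n) → ℝ) (s : EuclideanSpace ℝ (Fin n) → ℝ)
      (C ε : ℝ), 0 < ε ∧ Continuous s ∧ (∀ z, |s z| ≤ C * exp (-ε * ‖z‖ ^ 2)) ∧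
      (∀ z, HasSum (fun m => b m z) (s z)) ∧ ∀ m z, |hermiteTerm d t₀ t m y z| ≤ b m z := by
  have hτ : 0 < t - t₀ := sub_pos.2 ht
  set τ := t - t₀ with hτdef
  have hω : ∀ i, 0 < √(d i) := fun i => sqrt_pos.2 (hd i)
  -- On the diagonal the one-dimensional kernel is its amplitude times exp(-2βx²).
  set β : Fin n → ℝ := fun i => (mehlerCoth (√(d i)) τ - mehlerCsch (√(d i)) τ) / 2 with hβdef
  have hβ : ∀ i, 0 < β i := fun i => half_pos (sub_pos.2 (mehlerCsch_lt_mehlerCoth (hω i) hτ))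
  obtain ⟨ε, hε, hεβ⟩ := exists_pos_forall_le hβ
  set B : Fin n → ℝ := fun i =>
    (mehlerKernel (√(d i)) τ (y i) (y i) + mehlerAmp (√(d i)) τ) / 2 with hB
  have hB0 : ∀ i, 0 < B i := fun i =>
    half_pos (add_pos (mehlerKernel_pos (hω i) hτ _ _) (mehlerAmp_pos (hω i) hτ))
  have hdiag : ∀ i x, mehlerKernel (√(d i)) τ x x = mehlerAmp (√(d i)) τ *
      (exp (-β i * x ^ 2) * exp (-β i * x ^ 2)) := fun i x => by
    rw [mehlerKernel, ← exp_add]; congr 2; simp only [hβdef]; ring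
  -- The weight splits the diagonal decay evenly. With c = exp(-βz²), both c κ(y,y) and c⁻¹ κ(z,z)
  -- are constants times exp(-βz²); with c = 1 the term κ(y,y) would not decay in z.
  set c : Fin n → ℝ → ℝ := fun i x => exp (-β i * x ^ 2) with hc
  refine ⟨fun m z => ∏ i, (c i (z i) * hermiteFactor (√(d i)) τ (m i) (y i) (y i) +
    (c i (z i))⁻¹ * hermiteFactor (√(d i)) τ (m i) (z i) (z i)) / 2,
    fun z => ∏ i, (B i * exp (-β i * z i ^ 2)), ∏ i, B i, ε, hε, by fun_prop, fun z => ?_,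
    fun z => ?_, fun m z => ?_⟩
  · rw [abs_of_pos (Finset.prod_pos fun i _ => mul_pos (hB0 i) (exp_pos _)),
      Finset.prod_mul_distrib]
    exact mul_le_mul_of_nonneg_left (prod_exp_le hεβ z) (Finset.prod_nonneg fun i _ => (hB0 i).le)
  · refine hasSum_prod_of_hasSum (f := fun i k =>
      (c i (z i) * hermiteFactor (√(d i)) τ k (y i) (y i) +
        (c i (z i))⁻¹ * hermiteFactor (√(d i)) τ k (z i) (z i)) / 2) fun i => ?_
    have h := (((hasSum_hermiteFactor (hω i) hτ (y i) (y i)).mul_left (c i (z i))).add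
      ((hasSum_hermiteFactor (hω i) hτ (z i) (z i)).mul_left (c i (z i))⁻¹)).div_const 2
    have hne : exp (-β i * z i ^ 2) ≠ 0 := (exp_pos _).ne'
    have e : B i * exp (-β i * z i ^ 2) = (c i (z i) * mehlerKernel (√(d i)) τ (y i) (y i) +
        (c i (z i))⁻¹ * mehlerKernel (√(d i)) τ (z i) (z i)) / 2 := by
      rw [hdiag i (z i)]
      simp only [hB, hc]
      field_simp
    rw [e]
    exact h
  · rw [hermiteTerm_eq_prod d hd, Finset.abs_prod]
    exact Finset.prod_le_prod (fun i _ => abs_nonneg _) fun i _ =>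
      abs_hermiteFactor_le _ _ _ (exp_pos _)

lemma continuous_hermiteTerm (hd : ∀ i, 0 < d i) (m : Fin n → ℕ) (y : EuclideanSpace ℝ (Fin n)) :
    Continuous (hermiteTerm d t₀ t m y) := by
  have : hermiteTerm d t₀ t m y = fun z : EuclideanSpace ℝ (Fin n) =>
      ∏ i, hermiteFactor (√(d i)) (t - t₀) (m i) (y i) (z i) :=
    funext fun z => hermiteTerm_eq_prod d hd t₀ t m y z
  rw [this]
  refine continuous_finsetProd _ fun i _ => ?_
  exact (continuous_hermiteFactor _ _ _ _).comp (by fun_prop)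

lemma integrable_hermiteTerm_mul (hd : ∀ i, 0 < d i) (hη : GaussIntegrable η₀) (ht : t₀ < t)
    (m : Fin n → ℕ) (y : EuclideanSpace ℝ (Fin n)) :
    Integrable fun z => hermiteTerm d t₀ t m y z * η₀ z := by
  obtain ⟨b, s, C, ε, hε, hs, hsC, hsum, hb⟩ := exists_hermiteTerm_bound hd ht y
  refine hη.integrable_mul (continuous_hermiteTerm hd m y).aestronglyMeasurable hε (C := C)
    fun z => (hb m z).trans (((le_hasSum (hsum z) m fun j _ =>
      (abs_nonneg _).trans (hb j z))).trans ((le_abs_self _).trans (hsC z)))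

/-- The majorant sums to a Gaussian-bounded function, so dominated convergence applies along finite
sets of multi-indices and the resulting convergence is unconditional. -/
lemma hasSum_integral_hermiteTerm (hd : ∀ i, 0 < d i) (hη : GaussIntegrable η₀) (ht : t₀ < t)
    (y : EuclideanSpace ℝ (Fin n)) :
    HasSum (fun m : Fin n → ℕ => ∫ z, hermiteTerm d t₀ t m y z * η₀ z)
      (∫ z, kernelPP d t₀ y t z * η₀ z) := by
  obtain ⟨b, s, C, ε, hε, hs, hsC, hsum, hb⟩ := exists_hermiteTerm_bound hd ht y
  have habs : ∀ z, HasSum (fun m => b m z * |η₀ z|) (s z * |η₀ z|) := fun z =>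
    (hsum z).mul_right _
  refine hasSum_integral_of_dominated_convergence (fun m z => b m z * |η₀ z|)
    (fun m => (integrable_hermiteTerm_mul hd hη ht m y).aestronglyMeasurable)
    (fun m => Eventually.of_forall fun z => ?_) (Eventually.of_forall fun z => (habs z).summable)
    ?_ (Eventually.of_forall fun z => ?_)
  · rw [norm_mul, Real.norm_eq_abs, Real.norm_eq_abs]
    exact mul_le_mul_of_nonneg_right (hb m z) (abs_nonneg _)
  · simp_rw [fun z => (habs z).tsum_eq]
    have h0 : ∀ z, 0 ≤ s z := fun z => (hsum z).nonneg fun m => (abs_nonneg _).trans (hb m z)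
    refine (hη.integrable_mul hs.aestronglyMeasurable hε hsC).norm.congr
      (Eventually.of_forall fun z => ?_)
    simp only [norm_mul, Real.norm_eq_abs, abs_of_nonneg (h0 z)]
  · rw [kernelPP_eq_prod d hd ht]
    simp_rw [hermiteTerm_eq_prod d hd]
    exact (hasSum_prod_of_hasSum fun i =>
      hasSum_hermiteFactor (sqrt_pos.2 (hd i)) (sub_pos.2 ht) (y i) (z i)).mul_right _

end Series

end

/-! ### Differentiation under the integral sign for exponential families. -/

noncomputable section

section ExponentialFamily

variable {α : Type*} [MeasurableSpace α] {μ : Measure α}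
  {V : Type*} [NormedAddCommGroup V] [NormedSpace ℝ V]
  {F : Type*} [NormedAddCommGroup F] [NormedSpace ℝ F]
  {T : α → V →L[ℝ] ℝ} {h : α → F} {θ : V} {δ : ℝ}

lemma exp_mul_le_inv_mul_exp {δ t : ℝ} (hδ : 0 < δ) : t ≤ δ⁻¹ * exp (δ * t) := by
  rw [inv_mul_eq_div, le_div_iff₀ hδ, mul_comm]
  linarith [add_one_le_exp (δ * t)]

lemma exp_half_mul_norm_le {x t δ : ℝ} (hδ : 0 < δ) :
    exp (x + δ / 2 * t) * t ≤ (δ / 2)⁻¹ * exp (x + δ * t) := by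
  calc exp (x + δ / 2 * t) * t ≤ exp (x + δ / 2 * t) * ((δ / 2)⁻¹ * exp (δ / 2 * t)) := by
        gcongr; exact exp_mul_le_inv_mul_exp (half_pos hδ)
    _ = (δ / 2)⁻¹ * exp (x + δ * t) := by
        rw [mul_left_comm, ← exp_add]; ring_nf

/-- Differentiation under the integral sign for exponential families. -/
lemma hasFDerivAt_integral_exp_smul (hT : AEStronglyMeasurable T μ) (hh : AEStronglyMeasurable h μ)
    (hδ : 0 < δ) (hint : Integrable (fun a => exp (T a θ + δ * ‖T a‖) * ‖h a‖) μ) :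
    HasFDerivAt (fun θ => ∫ a, exp (T a θ) • h a ∂μ)
      (∫ a, exp (T a θ) • (T a).smulRight (h a) ∂μ) θ := by
  have hTm : ∀ θ, AEStronglyMeasurable (fun a => exp (T a θ)) μ := fun θ =>
    continuous_exp.comp_aestronglyMeasurable (hT.apply_continuousLinearMap θ)
  -- On a ball of radius δ/2 half of the margin δ‖T‖ covers the variation of the exponent; the other
  -- half absorbs the factor ‖T‖ produced by the derivative.
  refine hasFDerivAt_integral_of_dominated_of_fderiv_le
    (F' := fun θ a => exp (T a θ) • (T a).smulRight (h a))
    (bound := fun a => (δ / 2)⁻¹ * (exp (T a θ + δ * ‖T a‖) * ‖h a‖))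
    (Metric.ball_mem_nhds θ (half_pos hδ)) (Eventually.of_forall fun θ => (hTm θ).smul hh) ?_ ?_
    (Eventually.of_forall fun a x hx => ?_) (hint.const_mul _)
    (Eventually.of_forall fun a x _ => ?_)
  · refine hint.mono ((hTm θ).smul hh) (Eventually.of_forall fun a => ?_)
    rw [norm_smul, norm_mul, norm_norm]
    gcongr
    rw [norm_of_nonneg (exp_pos _).le, norm_of_nonneg (exp_pos _).le]
    exact exp_le_exp.2 (by have := mul_nonneg hδ.le (norm_nonneg (T a)); linarith)
  · exact (hTm θ).smul ((ContinuousLinearMap.smulRightL ℝ V F).aestronglyMeasurable_comp₂ hT hh)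
  · rw [norm_smul, ContinuousLinearMap.norm_smulRight_apply, norm_of_nonneg (exp_pos _).le]
    have h1 : T a x ≤ T a θ + δ / 2 * ‖T a‖ := by
      have h2 := (le_abs_self _).trans ((T a).le_opNorm (x - θ))
      have h3 : ‖x - θ‖ ≤ δ / 2 := by rw [← dist_eq_norm]; exact (Metric.mem_ball.1 hx).le
      have h4 : ‖T a‖ * ‖x - θ‖ ≤ ‖T a‖ * (δ / 2) := by gcongr
      rw [map_sub] at h2
      linarith
    calc exp (T a x) * (‖T a‖ * ‖h a‖)
        ≤ exp (T a θ + δ / 2 * ‖T a‖) * (‖T a‖ * ‖h a‖) := by gcongr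
      _ = (exp (T a θ + δ / 2 * ‖T a‖) * ‖T a‖) * ‖h a‖ := by ring
      _ ≤ ((δ / 2)⁻¹ * exp (T a θ + δ * ‖T a‖)) * ‖h a‖ :=
          mul_le_mul_of_nonneg_right (exp_half_mul_norm_le hδ) (norm_nonneg _)
      _ = _ := by ring
  · have h1 : HasFDerivAt (fun θ => exp (T a θ)) (exp (T a x) • T a) x := (T a).hasFDerivAt.exp
    have h2 := h1.smul_const (h a)
    convert h2 using 1
    ext v
    simp [mul_smul]

end ExponentialFamily

/-- A convergent exponential family of integrals is smooth in its parameter. -/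
lemma contDiffOn_integral_exp_smul {α : Type*} [MeasurableSpace α] {μ : Measure α}
    {V : Type} [NormedAddCommGroup V] [NormedSpace ℝ V] {T : α → V →L[ℝ] ℝ} {U : Set V}
    (hU : IsOpen U) (hT : AEStronglyMeasurable T μ) (k : ℕ)
    {F : Type} [NormedAddCommGroup F] [NormedSpace ℝ F] {h : α → F}
    (hh : AEStronglyMeasurable h μ)
    (hint : ∀ θ ∈ U, ∃ δ > 0, Integrable (fun a => exp (T a θ + δ * ‖T a‖) * ‖h a‖) μ) :
    ContDiffOn ℝ k (fun θ => ∫ a, exp (T a θ) • h a ∂μ) U := by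
  -- The derivative is an integral of the same kind with values in V →L[ℝ] F, so the target space
  -- must vary; placing V and F in `Type` keeps it in one universe.
  induction k generalizing F with
  | zero =>
    refine contDiffOn_zero.2 fun θ hθ => ?_
    obtain ⟨δ, hδ, hi⟩ := hint θ hθ
    exact (hasFDerivAt_integral_exp_smul hT hh hδ hi).continuousAt.continuousWithinAt
  | succ k ih =>
    have hd : ∀ θ ∈ U, HasFDerivAt (fun θ => ∫ a, exp (T a θ) • h a ∂μ)
        (∫ a, exp (T a θ) • (T a).smulRight (h a) ∂μ) θ := fun θ hθ => by
      obtain ⟨δ, hδ, hi⟩ := hint θ hθ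
      exact hasFDerivAt_integral_exp_smul hT hh hδ hi
    have hm : AEStronglyMeasurable (fun a => (T a).smulRight (h a)) μ :=
      (ContinuousLinearMap.smulRightL ℝ V F).aestronglyMeasurable_comp₂ hT hh
    rw [show ((k + 1 : ℕ) : WithTop ℕ∞) = (k : WithTop ℕ∞) + 1 by push_cast; rfl,
      contDiffOn_succ_iff_fderiv_of_isOpen hU]
    refine ⟨fun θ hθ => (hd θ hθ).differentiableAt.differentiableWithinAt, by simp, ?_⟩
    refine (ih hm fun θ hθ => ?_).congr fun θ hθ => (hd θ hθ).fderiv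
    obtain ⟨δ, hδ, hi⟩ := hint θ hθ
    refine ⟨δ / 2, half_pos hδ, (hi.const_mul (δ / 2)⁻¹).mono' ?_
      (Eventually.of_forall fun a => ?_)⟩
    · have h1 : AEStronglyMeasurable (fun a => T a θ + δ / 2 * ‖T a‖) μ :=
        (hT.apply_continuousLinearMap θ).add (hT.norm.const_mul _)
      exact (continuous_exp.comp_aestronglyMeasurable h1).mul hm.norm
    · rw [norm_mul, norm_norm, ContinuousLinearMap.norm_smulRight_apply,
        norm_of_nonneg (exp_pos _).le]
      calc _ = (exp (T a θ + δ / 2 * ‖T a‖) * ‖T a‖) * ‖h a‖ := by ring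
        _ ≤ ((δ / 2)⁻¹ * exp (T a θ + δ * ‖T a‖)) * ‖h a‖ :=
          mul_le_mul_of_nonneg_right (exp_half_mul_norm_le hδ) (norm_nonneg _)
        _ = _ := by ring

end

/-! ### Gaussian-weighted Laplace transforms. -/

noncomputable section

variable {n : ℕ}

lemma GaussIntegrable.aestronglyMeasurable {f : EuclideanSpace ℝ (Fin n) → ℝ}
    (hf : GaussIntegrable f) : AEStronglyMeasurable f := by
  have h := (hf 1 one_pos).aestronglyMeasurable
  have h2 : AEStronglyMeasurable
      (fun z : EuclideanSpace ℝ (Fin n) => exp (‖z‖ ^ 2) * (exp (-1 * ‖z‖ ^ 2) * f z)) :=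
    AEStronglyMeasurable.mul (by fun_prop) h
  refine h2.congr (Eventually.of_forall fun z => ?_)
  simp only
  rw [← mul_assoc, ← exp_add]
  simp

/-- Differentiating the kernel produces moments of the datum, which have to be admissible data
again. The polynomial factor costs half of the Gaussian rate. -/
lemma GaussIntegrable.coord_mul {f : EuclideanSpace ℝ (Fin n) → ℝ} (hf : GaussIntegrable f)
    (i : Fin n) : GaussIntegrable fun z => z i * f z := by
  intro ε hε
  have h := hf.integrable_mul (g := fun z => exp (-ε * ‖z‖ ^ 2) * z i) (C := 1 + (ε / 2)⁻¹)
    (ε := ε / 2) (by fun_prop) (half_pos hε) fun z => ?_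
  · exact h.congr (Eventually.of_forall fun z => by simp only; ring)
  · rw [abs_mul, abs_of_pos (exp_pos _)]
    have h1 : |z i| ≤ ‖z‖ := by simpa using PiLp.norm_apply_le z i
    have h2 : |z i| ≤ 1 + ‖z‖ ^ 2 := by nlinarith [sq_nonneg (‖z‖ - 1), norm_nonneg z]
    have h3 : ‖z‖ ^ 2 ≤ (ε / 2)⁻¹ * exp (ε / 2 * ‖z‖ ^ 2) := exp_mul_le_inv_mul_exp (half_pos hε)
    have h4 : 1 ≤ exp (ε / 2 * ‖z‖ ^ 2) := one_le_exp (by positivity)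
    calc exp (-ε * ‖z‖ ^ 2) * |z i|
        ≤ exp (-ε * ‖z‖ ^ 2) * ((1 + (ε / 2)⁻¹) * exp (ε / 2 * ‖z‖ ^ 2)) := by
          gcongr; linarith
      _ = (1 + (ε / 2)⁻¹) * exp (-(ε / 2) * ‖z‖ ^ 2) := by
          rw [mul_left_comm, ← exp_add]; ring_nf

/-- The linear form `(p, q) ↦ ∑ i, (-p i * z i ^ 2 + q i * z i)`. -/
def quadForm (z : EuclideanSpace ℝ (Fin n)) : ((Fin n → ℝ) × (Fin n → ℝ)) →L[ℝ] ℝ :=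
  ∑ i, ((-z i ^ 2) • (ContinuousLinearMap.proj i ∘L ContinuousLinearMap.fst ℝ _ _) +
    z i • (ContinuousLinearMap.proj i ∘L ContinuousLinearMap.snd ℝ _ _))

lemma quadForm_apply (z : EuclideanSpace ℝ (Fin n)) (θ : (Fin n → ℝ) × (Fin n → ℝ)) :
    quadForm z θ = ∑ i, (-θ.1 i * z i ^ 2 + θ.2 i * z i) := by
  simp [quadForm, mul_comm]

lemma continuous_quadForm : Continuous (quadForm (n := n)) := by
  unfold quadForm
  fun_prop

lemma norm_quadForm_le (z : EuclideanSpace ℝ (Fin n)) :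
    ‖quadForm z‖ ≤ ∑ i, (z i ^ 2 + |z i|) := by
  refine ContinuousLinearMap.opNorm_le_bound _ (Finset.sum_nonneg fun i _ => by positivity)
    fun θ => ?_
  rw [quadForm_apply, Finset.sum_mul]
  refine (norm_sum_le _ _).trans (Finset.sum_le_sum fun i _ => ?_)
  have h1 : |θ.1 i| ≤ ‖θ‖ := (norm_le_pi_norm θ.1 i).trans (norm_fst_le θ)
  have h2 : |θ.2 i| ≤ ‖θ‖ := (norm_le_pi_norm θ.2 i).trans (norm_snd_le θ)
  rw [Real.norm_eq_abs]
  calc _ ≤ |-θ.1 i * z i ^ 2| + |θ.2 i * z i| := abs_add_le _ _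
    _ = |θ.1 i| * z i ^ 2 + |θ.2 i| * |z i| := by
        rw [abs_mul, abs_mul, abs_neg, abs_of_nonneg (sq_nonneg (z i))]
    _ ≤ ‖θ‖ * z i ^ 2 + ‖θ‖ * |z i| := by gcongr
    _ = _ := by ring

/-- A quadratic polynomial with negative leading coefficient is dominated by a Gaussian. -/
lemma exists_quadratic_bound (θ : (Fin n → ℝ) × (Fin n → ℝ)) (hθ : ∀ i, 0 < θ.1 i) :
    ∃ δ > 0, ∃ C ε : ℝ, 0 < ε ∧ ∀ z : EuclideanSpace ℝ (Fin n),
      exp (quadForm z θ + δ * ‖quadForm z‖) ≤ C * exp (-ε * ‖z‖ ^ 2) := by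
  obtain ⟨ε, hε, hεθ⟩ := exists_pos_forall_le hθ
  -- Of the decay εz², the margin δ = ε/2 uses ε/2 and the linear term c|z| ≤ c²/ε + (ε/4)z² uses
  -- ε/4. This leaves the rate ε/4 and the constant exp(∑ c²/ε).
  refine ⟨ε / 2, half_pos hε, exp (∑ i, (|θ.2 i| + ε / 2) ^ 2 / ε), ε / 4, by positivity,
    fun z => ?_⟩
  have h1 : ε / 2 * ‖quadForm z‖ ≤ ∑ i, ε / 2 * (z i ^ 2 + |z i|) := by
    rw [← Finset.mul_sum]; gcongr; exact norm_quadForm_le z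
  rw [← exp_add, norm_sq_eq_sum, Finset.mul_sum, ← Finset.sum_add_distrib, quadForm_apply]
  refine exp_le_exp.2 ((add_le_add_right h1 _).trans ?_)
  rw [← Finset.sum_add_distrib]
  refine Finset.sum_le_sum fun i _ => ?_
  have h2 : θ.2 i * z i ≤ |θ.2 i| * |z i| := (le_abs_self _).trans (abs_mul _ _).le
  have h3 := mul_le_mul_of_nonneg_right (hεθ i) (sq_nonneg (z i))
  set c := |θ.2 i| + ε / 2 with hc
  have h4 : c * |z i| ≤ c ^ 2 / ε + ε / 4 * z i ^ 2 := by
    rw [← sub_le_iff_le_add, le_div_iff₀ hε, ← sq_abs (z i)]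
    nlinarith [sq_nonneg (c - ε / 2 * |z i|)]
  have h5 : c * |z i| = |θ.2 i| * |z i| + ε / 2 * |z i| := by rw [hc]; ring
  rw [h5] at h4
  linarith

/-- The Gaussian-weighted Laplace transform of `h`. -/
def laplaceInt (h : EuclideanSpace ℝ (Fin n) → ℝ) (θ : (Fin n → ℝ) × (Fin n → ℝ)) : ℝ :=
  ∫ z, exp (quadForm z θ) • h z

variable {h : EuclideanSpace ℝ (Fin n) → ℝ} {θ : (Fin n → ℝ) × (Fin n → ℝ)}

lemma GaussIntegrable.exists_integrable_exp_quadForm (hh : GaussIntegrable h)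
    (hθ : ∀ i, 0 < θ.1 i) :
    ∃ δ > 0, Integrable fun z => exp (quadForm z θ + δ * ‖quadForm z‖) * ‖h z‖ := by
  obtain ⟨δ, hδ, C, ε, hε, hb⟩ := exists_quadratic_bound θ hθ
  refine ⟨δ, hδ, ?_⟩
  have hc : Continuous fun z : EuclideanSpace ℝ (Fin n) =>
      exp (quadForm z θ + δ * ‖quadForm z‖) := by
    have := continuous_quadForm (n := n)
    fun_prop
  refine (hh.integrable_mul hc.aestronglyMeasurable hε (C := C) fun z => ?_).norm.congr
    (Eventually.of_forall fun z => ?_)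
  · rw [abs_of_pos (exp_pos _)]; exact hb z
  · simp only [norm_mul, norm_of_nonneg (exp_pos _).le]

lemma GaussIntegrable.integrable_exp_quadForm (hh : GaussIntegrable h) (hθ : ∀ i, 0 < θ.1 i) :
    Integrable fun z => exp (quadForm z θ) * h z := by
  obtain ⟨δ, hδ, C, ε, hε, hb⟩ := exists_quadratic_bound θ hθ
  have hc : Continuous fun z : EuclideanSpace ℝ (Fin n) => exp (quadForm z θ) := by
    have := continuous_quadForm (n := n)
    fun_prop
  refine hh.integrable_mul hc.aestronglyMeasurable hε (C := C) fun z => ?_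
  rw [abs_of_pos (exp_pos _)]
  refine (exp_le_exp.2 ?_).trans (hb z)
  have := mul_nonneg hδ.le (norm_nonneg (quadForm z))
  linarith

lemma isOpen_fst_pos : IsOpen {θ : (Fin n → ℝ) × (Fin n → ℝ) | ∀ i, 0 < θ.1 i} := by
  rw [ofPred_forall]
  exact isOpen_iInter_of_finite fun i => isOpen_lt continuous_const (by fun_prop)

lemma contDiffAt_laplaceInt (hh : GaussIntegrable h) (hθ : ∀ i, 0 < θ.1 i) :
    ContDiffAt ℝ (⊤ : ℕ∞) (laplaceInt h) θ := by
  refine ContDiffOn.contDiffAt (contDiffOn_infty.2 fun k => ?_) (isOpen_fst_pos.mem_nhds hθ)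
  exact contDiffOn_integral_exp_smul isOpen_fst_pos
    continuous_quadForm.aestronglyMeasurable k hh.aestronglyMeasurable
    fun θ hθ => hh.exists_integrable_exp_quadForm hθ

/-- A derivative in the quadratic parameter pᵢ brings down -zᵢ², one in the linear parameter qᵢ
brings down zᵢ. Stated along a curve, the formula serves both the time derivative and the space
derivatives. -/
lemma laplaceInt_hasDerivAt (hh : GaussIntegrable h) {γ : ℝ → (Fin n → ℝ) × (Fin n → ℝ)} {s : ℝ}
    {γ' : (Fin n → ℝ) × (Fin n → ℝ)} (hγ : HasDerivAt γ γ' s) (hpos : ∀ i, 0 < (γ s).1 i) :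
    HasDerivAt (fun s => laplaceInt h (γ s))
      (∑ i, (-γ'.1 i * laplaceInt (fun z => z i * (z i * h z)) (γ s) +
        γ'.2 i * laplaceInt (fun z => z i * h z) (γ s))) s := by
  obtain ⟨δ, hδ, hi⟩ := hh.exists_integrable_exp_quadForm hpos
  have h1 := (hasFDerivAt_integral_exp_smul continuous_quadForm.aestronglyMeasurable
    hh.aestronglyMeasurable hδ hi).comp_hasDerivAt s hγ
  have hint : Integrable fun z => exp (quadForm z (γ s)) • (quadForm z).smulRight (h z) := by
    refine (hi.const_mul (δ⁻¹)).mono' ?_ (Eventually.of_forall fun z => ?_)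
    · have hc : Continuous fun z : EuclideanSpace ℝ (Fin n) => exp (quadForm z (γ s)) := by
        have := continuous_quadForm (n := n)
        fun_prop
      exact hc.aestronglyMeasurable.smul
        ((ContinuousLinearMap.smulRightL ℝ _ ℝ).aestronglyMeasurable_comp₂
          continuous_quadForm.aestronglyMeasurable hh.aestronglyMeasurable)
    · rw [norm_smul, ContinuousLinearMap.norm_smulRight_apply, norm_of_nonneg (exp_pos _).le,
        exp_add]
      have := exp_mul_le_inv_mul_exp (t := ‖quadForm z‖) hδ
      calc _ = exp (quadForm z (γ s)) * ‖quadForm z‖ * ‖h z‖ := by ring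
        _ ≤ exp (quadForm z (γ s)) * (δ⁻¹ * exp (δ * ‖quadForm z‖)) * ‖h z‖ := by gcongr
        _ = _ := by ring
  refine HasDerivAt.congr_deriv h1 ?_
  rw [ContinuousLinearMap.integral_apply hint]
  have e : ∀ z, (exp (quadForm z (γ s)) • (quadForm z).smulRight (h z)) γ'
      = ∑ i, (-γ'.1 i * (exp (quadForm z (γ s)) • (z i * (z i * h z))) +
        γ'.2 i * (exp (quadForm z (γ s)) • (z i * h z))) := fun z => by
    simp only [smul_apply, ContinuousLinearMap.smulRight_apply, smul_eq_mul]
    rw [quadForm_apply z γ', Finset.sum_mul, Finset.mul_sum]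
    exact Finset.sum_congr rfl fun i _ => by ring
  simp_rw [e]
  have i1 : ∀ i, Integrable fun z => exp (quadForm z (γ s)) • (z i * h z) := fun i =>
    (hh.coord_mul i).integrable_exp_quadForm hpos
  have i2 : ∀ i, Integrable fun z => exp (quadForm z (γ s)) • (z i * (z i * h z)) := fun i =>
    ((hh.coord_mul i).coord_mul i).integrable_exp_quadForm hpos
  have i3 : ∀ i, Integrable fun z => -γ'.1 i * (exp (quadForm z (γ s)) • (z i * (z i * h z))) +
      γ'.2 i * (exp (quadForm z (γ s)) • (z i * h z)) := fun i =>
    ((i2 i).const_mul _).add ((i1 i).const_mul _)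
  rw [integral_finsetSum _ fun i _ => i3 i]
  refine Finset.sum_congr rfl fun i _ => ?_
  rw [integral_add ((i2 i).const_mul _) ((i1 i).const_mul _), integral_const_mul,
    integral_const_mul]
  rfl

end

/-! ### Smoothness of the kernel integral and the differential equation. -/

noncomputable section

section Coefficients

variable {ω τ : ℝ}

lemma hasDerivAt_sinh_two_mul (ω τ : ℝ) :
    HasDerivAt (fun τ => sinh (2 * τ * ω)) (2 * ω * cosh (2 * τ * ω)) τ := by
  have h : HasDerivAt (fun τ : ℝ => 2 * τ * ω) (2 * ω) τ := by
    simpa using ((hasDerivAt_id τ).const_mul 2).mul_const ω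
  exact h.sinh.congr_deriv (by ring)

lemma hasDerivAt_cosh_two_mul (ω τ : ℝ) :
    HasDerivAt (fun τ => cosh (2 * τ * ω)) (2 * ω * sinh (2 * τ * ω)) τ := by
  have h : HasDerivAt (fun τ : ℝ => 2 * τ * ω) (2 * ω) τ := by
    simpa using ((hasDerivAt_id τ).const_mul 2).mul_const ω
  exact h.cosh.congr_deriv (by ring)

/-- With A = `mehlerCoth` and B = `mehlerCsch`, this is the first equation of the system A' = -2B²,
B' = -2AB, amp' = -A amp, along which A² - B² is conserved. -/
lemma hasDerivAt_mehlerCoth (hω : 0 < ω) (hτ : 0 < τ) :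
    HasDerivAt (mehlerCoth ω) (-2 * mehlerCsch ω τ ^ 2) τ := by
  have hs := (sinh_two_mul_pos hω hτ).ne'
  have h := ((hasDerivAt_cosh_two_mul ω τ).div (hasDerivAt_sinh_two_mul ω τ) hs).const_mul ω
  refine h.congr_deriv ?_
  have h2 := cosh_sq (2 * τ * ω)
  unfold mehlerCsch
  generalize sinh (2 * τ * ω) = s at *
  generalize cosh (2 * τ * ω) = c at *
  field_simp
  linear_combination (-1 : ℝ) * h2

lemma hasDerivAt_mehlerCsch (hω : 0 < ω) (hτ : 0 < τ) :
    HasDerivAt (mehlerCsch ω) (-2 * mehlerCsch ω τ * mehlerCoth ω τ) τ := by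
  have hs := (sinh_two_mul_pos hω hτ).ne'
  have h := (hasDerivAt_const τ ω).div (hasDerivAt_sinh_two_mul ω τ) hs
  refine h.congr_deriv ?_
  unfold mehlerCsch mehlerCoth
  generalize sinh (2 * τ * ω) = s at *
  generalize cosh (2 * τ * ω) = c at *
  field_simp
  ring

lemma hasDerivAt_mehlerAmp (hω : 0 < ω) (hτ : 0 < τ) :
    HasDerivAt (mehlerAmp ω) (-mehlerCoth ω τ * mehlerAmp ω τ) τ := by
  have hs := sinh_two_mul_pos hω hτ
  have hpos : 0 < ω / (2 * π * sinh (2 * τ * ω)) := by positivity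
  have h := ((hasDerivAt_const τ ω).div ((hasDerivAt_sinh_two_mul ω τ).const_mul (2 * π))
    (by positivity)).sqrt hpos.ne'
  refine h.congr_deriv ?_
  have h2 : mehlerAmp ω τ * mehlerAmp ω τ = ω / (2 * π * sinh (2 * τ * ω)) :=
    mul_self_sqrt hpos.le
  have h3 := (mehlerAmp_pos hω hτ).ne'
  change _ / (2 * mehlerAmp ω τ) = _
  rw [div_eq_iff (by positivity), show -mehlerCoth ω τ * mehlerAmp ω τ * (2 * mehlerAmp ω τ)
    = -2 * mehlerCoth ω τ * (mehlerAmp ω τ * mehlerAmp ω τ) by ring, h2]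
  unfold mehlerCoth
  have hs' := hs.ne'
  generalize sinh (2 * τ * ω) = s at *
  generalize cosh (2 * τ * ω) = c at *
  field_simp
  ring

end Coefficients


variable {n : ℕ} {d : Fin n → ℝ} {t₀ t : ℝ} {h : EuclideanSpace ℝ (Fin n) → ℝ}

/-- The part of the kernel that does not depend on the integration variable. -/
def kernelPrefactor (d : Fin n → ℝ) (τ : ℝ) (y : EuclideanSpace ℝ (Fin n)) : ℝ :=
  (∏ i, mehlerAmp (√(d i)) τ) * exp (∑ i, -(mehlerCoth (√(d i)) τ / 2) * y i ^ 2)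

/-- The parameter of the Gaussian-weighted Laplace transform that represents the kernel integral. -/
def kernelParam (d : Fin n → ℝ) (τ : ℝ) (y : EuclideanSpace ℝ (Fin n)) :
    (Fin n → ℝ) × (Fin n → ℝ) :=
  (fun i => mehlerCoth (√(d i)) τ / 2, fun i => mehlerCsch (√(d i)) τ * y i)

/-- The function `h` propagated by the kernel. -/
def kernelInt (d : Fin n → ℝ) (t₀ : ℝ) (h : EuclideanSpace ℝ (Fin n) → ℝ) (t : ℝ)
    (y : EuclideanSpace ℝ (Fin n)) : ℝ :=
  ∫ z, kernelPP d t₀ y t z * h z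

lemma kernelPP_eq_prefactor_mul (hd : ∀ i, 0 < d i) (ht : t₀ < t)
    (y z : EuclideanSpace ℝ (Fin n)) :
    kernelPP d t₀ y t z
      = kernelPrefactor d (t - t₀) y * exp (quadForm z (kernelParam d (t - t₀) y)) := by
  rw [kernelPP_eq_prod d hd ht, kernelPrefactor, quadForm_apply, mul_assoc, ← exp_add,
    ← Finset.sum_add_distrib]
  simp only [mehlerKernel]
  rw [Finset.prod_mul_distrib, ← exp_sum]
  congr 2
  refine Finset.sum_congr rfl fun i _ => ?_
  simp only [kernelParam]
  ring

/-- Time and y enter only through an explicit prefactor and the parameter of the Laplace transform,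
so regularity and derivatives follow from the chain rule. -/
lemma kernelInt_eq (hd : ∀ i, 0 < d i) (ht : t₀ < t) (y : EuclideanSpace ℝ (Fin n)) :
    kernelInt d t₀ h t y
      = kernelPrefactor d (t - t₀) y * laplaceInt h (kernelParam d (t - t₀) y) := by
  unfold kernelInt laplaceInt
  simp_rw [kernelPP_eq_prefactor_mul hd ht, mul_assoc, smul_eq_mul]
  rw [integral_const_mul]

lemma kernelParam_pos (hd : ∀ i, 0 < d i) {τ : ℝ} (hτ : 0 < τ) (y : EuclideanSpace ℝ (Fin n))
    (i : Fin n) : 0 < (kernelParam d τ y).1 i :=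
  half_pos (mehlerCoth_pos (sqrt_pos.2 (hd i)) hτ)

lemma continuous_kernelPP (hd : ∀ i, 0 < d i) (ht : t₀ < t) :
    Continuous fun p : EuclideanSpace ℝ (Fin n) × EuclideanSpace ℝ (Fin n) =>
      kernelPP d t₀ p.1 t p.2 := by
  simp_rw [kernelPP_eq_prod d hd ht]
  refine continuous_finsetProd _ fun i _ => ?_
  exact (continuous_mehlerKernel (√(d i)) (t - t₀)).comp
    (g := fun q : ℝ × ℝ => mehlerKernel (√(d i)) (t - t₀) q.1 q.2)
    (f := fun p : EuclideanSpace ℝ (Fin n) × EuclideanSpace ℝ (Fin n) => (p.1 i, p.2 i))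
    (by fun_prop)

lemma integrable_kernelPP_mul (hd : ∀ i, 0 < d i) (hh : GaussIntegrable h) (ht : t₀ < t)
    (y : EuclideanSpace ℝ (Fin n)) : Integrable fun z => kernelPP d t₀ y t z * h z := by
  simp_rw [kernelPP_eq_prefactor_mul hd ht, mul_assoc]
  exact (hh.integrable_exp_quadForm (kernelParam_pos hd (sub_pos.2 ht) y)).const_mul _

lemma hasDerivAt_kernelPrefactor (hd : ∀ i, 0 < d i) {τ : ℝ} (hτ : 0 < τ)
    (y : EuclideanSpace ℝ (Fin n)) :
    HasDerivAt (fun τ => kernelPrefactor d τ y)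
      ((∑ i, (-mehlerCoth (√(d i)) τ + mehlerCsch (√(d i)) τ ^ 2 * y i ^ 2)) *
        kernelPrefactor d τ y) τ := by
  have hω : ∀ i, 0 < √(d i) := fun i => sqrt_pos.2 (hd i)
  have h1 : HasDerivAt (fun τ => ∏ i, mehlerAmp (√(d i)) τ)
      ((∑ i, -mehlerCoth (√(d i)) τ) * ∏ i, mehlerAmp (√(d i)) τ) τ := by
    refine (HasDerivAt.fun_finsetProd (u := Finset.univ)
      fun i _ => hasDerivAt_mehlerAmp (hω i) hτ).congr_deriv ?_
    rw [Finset.sum_mul]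
    refine Finset.sum_congr rfl fun i _ => ?_
    rw [← Finset.prod_erase_mul _ _ (Finset.mem_univ i), smul_eq_mul]
    ring
  have h2 : HasDerivAt (fun τ => ∑ i, -(mehlerCoth (√(d i)) τ / 2) * y i ^ 2)
      (∑ i, mehlerCsch (√(d i)) τ ^ 2 * y i ^ 2) τ := by
    refine (HasDerivAt.fun_sum (u := Finset.univ) fun i _ =>
      (((hasDerivAt_mehlerCoth (hω i) hτ).div_const 2).neg.mul_const (y i ^ 2))).congr_deriv ?_
    exact Finset.sum_congr rfl fun i _ => by ring
  refine (h1.mul h2.exp).congr_deriv ?_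
  rw [kernelPrefactor, Finset.sum_add_distrib]
  ring

lemma hasDerivAt_kernelParam (hd : ∀ i, 0 < d i) {τ : ℝ} (hτ : 0 < τ)
    (y : EuclideanSpace ℝ (Fin n)) :
    HasDerivAt (fun τ => kernelParam d τ y)
      (fun i => -mehlerCsch (√(d i)) τ ^ 2,
        fun i => -2 * mehlerCsch (√(d i)) τ * mehlerCoth (√(d i)) τ * y i) τ := by
  have hω : ∀ i, 0 < √(d i) := fun i => sqrt_pos.2 (hd i)
  refine HasDerivAt.prodMk (hasDerivAt_pi.2 fun i => ?_) (hasDerivAt_pi.2 fun i => ?_)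
  · exact ((hasDerivAt_mehlerCoth (hω i) hτ).div_const 2).congr_deriv (by ring)
  · exact (hasDerivAt_mehlerCsch (hω i) hτ).mul_const (y i)

/-- Evolution of the kernel integral in time. -/
lemma hasDerivAt_kernelInt (hd : ∀ i, 0 < d i) (hh : GaussIntegrable h) (ht : t₀ < t)
    (y : EuclideanSpace ℝ (Fin n)) :
    HasDerivAt (fun t => kernelInt d t₀ h t y)
      (∑ i, ((-mehlerCoth (√(d i)) (t - t₀) + mehlerCsch (√(d i)) (t - t₀) ^ 2 * y i ^ 2) *
          kernelInt d t₀ h t y +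
        mehlerCsch (√(d i)) (t - t₀) ^ 2 * kernelInt d t₀ (fun z => z i * (z i * h z)) t y -
        2 * mehlerCsch (√(d i)) (t - t₀) * mehlerCoth (√(d i)) (t - t₀) * y i *
          kernelInt d t₀ (fun z => z i * h z) t y)) t := by
  have hτ : 0 < t - t₀ := sub_pos.2 ht
  have h1 := (hasDerivAt_kernelPrefactor hd hτ y).mul
    (laplaceInt_hasDerivAt hh (hasDerivAt_kernelParam hd hτ y) (kernelParam_pos hd hτ y))
  have h2 := HasDerivAt.comp_sub_const (f := fun τ => kernelPrefactor d τ y *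
    laplaceInt h (kernelParam d τ y)) t t₀ h1
  have h3 := h2.congr_of_eventuallyEq (f₁ := fun t => kernelInt d t₀ h t y)
    ((eventually_gt_nhds ht).mono fun s hs => kernelInt_eq hd hs y)
  refine h3.congr_deriv ?_
  simp_rw [kernelInt_eq hd ht]
  rw [Finset.sum_mul, Finset.mul_sum, Finset.sum_mul, ← Finset.sum_add_distrib]
  refine Finset.sum_congr rfl fun i _ => ?_
  ring

lemma hasDerivAt_coord (y : EuclideanSpace ℝ (Fin n)) (i j : Fin n) :
    HasDerivAt (fun x : ℝ => (y + x • EuclideanSpace.single j (1 : ℝ)) i)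
      (if i = j then 1 else 0) 0 := by
  have h : HasDerivAt (fun x : ℝ => y i + x * (if i = j then (1 : ℝ) else 0))
      (if i = j then 1 else 0) 0 := by
    simpa using ((hasDerivAt_id (0 : ℝ)).mul_const (if i = j then (1 : ℝ) else 0)).const_add (y i)
  convert h using 2 with x
  simp

/-- Evolution of the kernel integral along a coordinate direction. -/
lemma hasLineDerivAt_kernelInt (hd : ∀ i, 0 < d i) (hh : GaussIntegrable h) (ht : t₀ < t)
    (y : EuclideanSpace ℝ (Fin n)) (j : Fin n) :
    HasLineDerivAt ℝ (kernelInt d t₀ h t)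
      (-mehlerCoth (√(d j)) (t - t₀) * (y j * kernelInt d t₀ h t y) +
        mehlerCsch (√(d j)) (t - t₀) * kernelInt d t₀ (fun z => z j * h z) t y)
      y (EuclideanSpace.single j 1) := by
  have hτ : 0 < t - t₀ := sub_pos.2 ht
  have h1 : HasDerivAt (fun x : ℝ => kernelPrefactor d (t - t₀)
      (y + x • EuclideanSpace.single j (1 : ℝ)))
      (-mehlerCoth (√(d j)) (t - t₀) * y j * kernelPrefactor d (t - t₀) y) 0 := by
    have h2 := ((HasDerivAt.fun_sum (u := Finset.univ) fun i _ =>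
      ((hasDerivAt_coord y i j).pow 2).const_mul
        (-(mehlerCoth (√(d i)) (t - t₀) / 2))).exp).const_mul (∏ i, mehlerAmp (√(d i)) (t - t₀))
    refine h2.congr_deriv ?_
    simp [kernelPrefactor]
    ring
  have h2 : HasDerivAt (fun x : ℝ => kernelParam d (t - t₀)
      (y + x • EuclideanSpace.single j (1 : ℝ)))
      (fun _ => 0, fun i => mehlerCsch (√(d i)) (t - t₀) * (if i = j then 1 else 0)) 0 :=
    (hasDerivAt_const (0 : ℝ) fun i => mehlerCoth (√(d i)) (t - t₀) / 2).prodMk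
      (hasDerivAt_pi.2 fun i => (hasDerivAt_coord y i j).const_mul _)
  have h3 := h1.mul (laplaceInt_hasDerivAt hh h2 (kernelParam_pos hd hτ _))
  have e : kernelInt d t₀ h t = fun y =>
    kernelPrefactor d (t - t₀) y * laplaceInt h (kernelParam d (t - t₀) y) :=
    funext fun y => kernelInt_eq hd ht y
  unfold HasLineDerivAt
  rw [kernelInt_eq hd ht, kernelInt_eq hd ht, e]
  refine h3.congr_deriv ?_
  simp
  ring

/-- The hyperbolic coefficients are smooth jointly in time and space because sinh does not vanish
for positive elapsed time; the rest is composition with the smooth Laplace transform. -/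
lemma contDiffAt_kernelInt (hd : ∀ i, 0 < d i) (hh : GaussIntegrable h) (ht : t₀ < t)
    (y : EuclideanSpace ℝ (Fin n)) :
    ContDiffAt ℝ (⊤ : ℕ∞) (Function.uncurry (kernelInt d t₀ h)) (t, y) := by
  have hω : ∀ i, 0 < √(d i) := fun i => sqrt_pos.2 (hd i)
  have hτ : 0 < t - t₀ := sub_pos.2 ht
  have hs : ∀ i, ContDiffAt ℝ (⊤ : ℕ∞) (fun p : ℝ × EuclideanSpace ℝ (Fin n) =>
      sinh (2 * (p.1 - t₀) * √(d i))) (t, y) := fun i => by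
    have : ContDiff ℝ (⊤ : ℕ∞) sinh := contDiff_sinh
    exact (this.comp (f := fun p : ℝ × EuclideanSpace ℝ (Fin n) => 2 * (p.1 - t₀) * √(d i))
      (by fun_prop)).contDiffAt
  have hc : ∀ i, ContDiffAt ℝ (⊤ : ℕ∞) (fun p : ℝ × EuclideanSpace ℝ (Fin n) =>
      cosh (2 * (p.1 - t₀) * √(d i))) (t, y) := fun i => by
    have : ContDiff ℝ (⊤ : ℕ∞) cosh := contDiff_cosh
    exact (this.comp (f := fun p : ℝ × EuclideanSpace ℝ (Fin n) => 2 * (p.1 - t₀) * √(d i))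
      (by fun_prop)).contDiffAt
  have hcoord : ∀ i, ContDiffAt ℝ (⊤ : ℕ∞) (fun p : ℝ × EuclideanSpace ℝ (Fin n) =>
      p.2 i) (t, y) := fun i => by fun_prop
  have h0 : ∀ i, 0 < sinh (2 * (t - t₀) * √(d i)) := fun i => sinh_two_mul_pos (hω i) hτ
  have hcoth : ∀ i, ContDiffAt ℝ (⊤ : ℕ∞) (fun p : ℝ × EuclideanSpace ℝ (Fin n) =>
      mehlerCoth (√(d i)) (p.1 - t₀)) (t, y) := fun i =>
    contDiffAt_const.mul ((hc i).div (hs i) (h0 i).ne')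
  have hcsch : ∀ i, ContDiffAt ℝ (⊤ : ℕ∞) (fun p : ℝ × EuclideanSpace ℝ (Fin n) =>
      mehlerCsch (√(d i)) (p.1 - t₀)) (t, y) := fun i =>
    contDiffAt_const.div (hs i) (h0 i).ne'
  have hamp : ∀ i, ContDiffAt ℝ (⊤ : ℕ∞) (fun p : ℝ × EuclideanSpace ℝ (Fin n) =>
      mehlerAmp (√(d i)) (p.1 - t₀)) (t, y) := fun i => by
    have h1 := h0 i
    have h2 := hω i
    exact (contDiffAt_const.div (contDiffAt_const.mul (hs i)) (mul_pos two_pi_pos h1).ne').sqrt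
      (div_pos h2 (mul_pos two_pi_pos h1)).ne'
  have hpre : ContDiffAt ℝ (⊤ : ℕ∞) (fun p : ℝ × EuclideanSpace ℝ (Fin n) =>
      kernelPrefactor d (p.1 - t₀) p.2) (t, y) :=
    (contDiffAt_prod fun i _ => hamp i).mul
      (ContDiffAt.sum fun i _ => ((hcoth i).div_const 2).neg.mul ((hcoord i).pow 2)).exp
  have hpar : ContDiffAt ℝ (⊤ : ℕ∞) (fun p : ℝ × EuclideanSpace ℝ (Fin n) =>
      kernelParam d (p.1 - t₀) p.2) (t, y) :=
    (contDiffAt_pi.2 fun i => (hcoth i).div_const 2).prodMk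
      (contDiffAt_pi.2 fun i => (hcsch i).mul (hcoord i))
  have hlap := ContDiffAt.comp (t, y) (g := laplaceInt h)
    (contDiffAt_laplaceInt hh (kernelParam_pos hd hτ y)) hpar
  refine (hpre.mul hlap).congr_of_eventuallyEq ?_
  have : ∀ᶠ p : ℝ × EuclideanSpace ℝ (Fin n) in 𝓝 (t, y), t₀ < p.1 :=
    continuousAt_fst.eventually (eventually_gt_nhds ht)
  exact this.mono fun p hp => kernelInt_eq hd hp p.2

/-- For a C² function the Hessian trace in the standard basis can be read off from derivatives along
coordinate lines: first ones everywhere, second ones only at the point. -/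
lemma laplacian_eq_sum_of_hasLineDerivAt {f : EuclideanSpace ℝ (Fin n) → ℝ} (hf : ContDiff ℝ 2 f)
    {g : Fin n → EuclideanSpace ℝ (Fin n) → ℝ} {g' : Fin n → ℝ} {y : EuclideanSpace ℝ (Fin n)}
    (h1 : ∀ i x, HasLineDerivAt ℝ f (g i x) x (EuclideanSpace.single i 1))
    (h2 : ∀ i, HasLineDerivAt ℝ (g i) (g' i) y (EuclideanSpace.single i 1)) :
    Laplacian.laplacian f y = ∑ i, g' i := by
  rw [InnerProductSpace.laplacian_eq_iteratedFDeriv_orthonormalBasis f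
    (EuclideanSpace.basisFun (Fin n) ℝ)]
  refine Finset.sum_congr rfl fun i _ => ?_
  rw [iteratedFDeriv_two_apply]
  simp only [EuclideanSpace.basisFun_apply, Matrix.cons_val_zero, Matrix.cons_val_one]
  have hd : Differentiable ℝ f := hf.differentiable (by norm_num)
  have hd2 : Differentiable ℝ (fderiv ℝ f) :=
    (hf.fderiv_right (m := 1) (by norm_num)).differentiable (by norm_num)
  have e : g i = fun x => fderiv ℝ f x (EuclideanSpace.single i 1) := funext fun x =>
    (h1 i x).unique ((hd x).hasFDerivAt.hasLineDerivAt _)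
  have h3 : HasFDerivAt (g i)
      ((ContinuousLinearMap.apply ℝ ℝ (EuclideanSpace.single i (1 : ℝ))).comp
        (fderiv ℝ (fderiv ℝ f) y)) y := by
    rw [e]
    exact (ContinuousLinearMap.apply ℝ ℝ (EuclideanSpace.single i (1 : ℝ))).hasFDerivAt.comp y
      (hd2 y).hasFDerivAt
  exact ((h3.hasLineDerivAt _).unique (h2 i))

lemma contDiff_kernelInt (hd : ∀ i, 0 < d i) (hh : GaussIntegrable h) (ht : t₀ < t) :
    ContDiff ℝ (⊤ : ℕ∞) (kernelInt d t₀ h t) :=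
  contDiff_iff_contDiffAt.2 fun y => ContDiffAt.comp y (g := Function.uncurry (kernelInt d t₀ h))
    (f := fun y => (t, y)) (contDiffAt_kernelInt hd hh ht y) (by fun_prop)

lemma laplacian_kernelInt (hd : ∀ i, 0 < d i) (hh : GaussIntegrable h) (ht : t₀ < t)
    (y : EuclideanSpace ℝ (Fin n)) :
    Laplacian.laplacian (kernelInt d t₀ h t) y =
      ∑ i, ((-mehlerCoth (√(d i)) (t - t₀) + mehlerCoth (√(d i)) (t - t₀) ^ 2 * y i ^ 2) *
          kernelInt d t₀ h t y +
        mehlerCsch (√(d i)) (t - t₀) ^ 2 * kernelInt d t₀ (fun z => z i * (z i * h z)) t y -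
        2 * mehlerCsch (√(d i)) (t - t₀) * mehlerCoth (√(d i)) (t - t₀) * y i *
          kernelInt d t₀ (fun z => z i * h z) t y) := by
  refine laplacian_eq_sum_of_hasLineDerivAt
    (contDiff_infty.1 (contDiff_kernelInt hd hh ht) 2)
    (fun i x => hasLineDerivAt_kernelInt hd hh ht x i) fun i => ?_
  have h1 := hasLineDerivAt_kernelInt hd hh ht y i
  have h2 := hasLineDerivAt_kernelInt hd (hh.coord_mul i) ht y i
  have h0 := hasDerivAt_coord y i i
  unfold HasLineDerivAt at h1 h2 ⊢
  refine (((h0.mul h1).const_mul (-mehlerCoth (√(d i)) (t - t₀))).add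
    (h2.const_mul (mehlerCsch (√(d i)) (t - t₀)))).congr_deriv ?_
  simp only [zero_smul, add_zero, if_true]
  ring

/-- The kernel integral solves the equation. -/
lemma hasDerivAt_kernelInt_pde (hd : ∀ i, 0 < d i) (hh : GaussIntegrable h) (ht : t₀ < t)
    (y : EuclideanSpace ℝ (Fin n)) :
    HasDerivAt (fun s => kernelInt d t₀ h s y)
      (Laplacian.laplacian (kernelInt d t₀ h t) y
        - (y.ofLp ⬝ᵥ (Matrix.diagonal d *ᵥ y.ofLp)) * kernelInt d t₀ h t y) t := by
  refine (hasDerivAt_kernelInt hd hh ht y).congr_deriv ?_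
  have hV : y.ofLp ⬝ᵥ (Matrix.diagonal d *ᵥ y.ofLp) = ∑ i, d i * y i ^ 2 := by
    simp only [dotProduct, Matrix.mulVec_diagonal]
    exact Finset.sum_congr rfl fun i _ => by ring
  rw [laplacian_kernelInt hd hh ht, hV, Finset.sum_mul, ← Finset.sum_sub_distrib]
  refine Finset.sum_congr rfl fun i _ => ?_
  -- The time derivative and the Laplacian differ only in having csch² or coth² in front of yᵢ²; the
  -- difference ω² = dᵢ is the potential.
  have h1 := mehlerCoth_sq_sub (sqrt_pos.2 (hd i)) (sub_pos.2 ht)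
  rw [sq_sqrt (hd i).le] at h1
  linear_combination (-(y i ^ 2 * kernelInt d t₀ h t y)) * h1

/-- Iterated space derivatives of a jointly smooth function are jointly smooth. -/
lemma contDiffAt_iteratedFDeriv_slice {E : Type*} [NormedAddCommGroup E] [NormedSpace ℝ E]
    {f : ℝ → E → ℝ} {s : Set ℝ}
    (hf : ∀ t ∈ s, ∀ y, ContDiffAt ℝ (⊤ : ℕ∞) (Function.uncurry f) (t, y)) (k : ℕ) :
    ∀ t ∈ s, ∀ y, ContDiffAt ℝ (⊤ : ℕ∞)
      (fun p : ℝ × E => iteratedFDeriv ℝ k (f p.1) p.2) (t, y) := by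
  induction k with
  | zero =>
    intro t ht y
    simp_rw [iteratedFDeriv_zero_eq_comp]
    exact ((continuousMultilinearCurryFin0 ℝ E ℝ).symm.contDiff.contDiffAt).comp (t, y) (hf t ht y)
  | succ k ih =>
    intro t ht y
    have h1 : ContDiffAt ℝ (⊤ : ℕ∞)
        (fun p : ℝ × E => fderiv ℝ (iteratedFDeriv ℝ k (f p.1)) p.2) (t, y) := by
      refine ContDiffAt.fderiv (n := (⊤ : ℕ∞)) (f := fun p : ℝ × E => iteratedFDeriv ℝ k (f p.1))
        (g := Prod.snd) ?_ contDiffAt_snd (by simp)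
      exact ContDiffAt.comp ((t, y), y) (g := fun p : ℝ × E => iteratedFDeriv ℝ k (f p.1) p.2)
        (f := fun q : (ℝ × E) × E => (q.1.1, q.2)) (ih t ht y) (by fun_prop)
    exact h1.continuousLinearMap_comp ((continuousMultilinearCurryLeftEquiv ℝ
      (fun _ : Fin (k + 1) => E) ℝ).symm : _ →L[ℝ] E [×(k + 1)]→L[ℝ] ℝ)

end

/-! ### The ground state and the weighted L¹ contraction. -/

noncomputable section

section Product

variable {n : ℕ}

lemma integrable_prod_coord {f : Fin n → ℝ → ℝ} (hf : ∀ i, Integrable (f i)) :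
    Integrable fun z : EuclideanSpace ℝ (Fin n) => ∏ i, f i (z i) :=
  ((PiLp.volume_preserving_ofLp (Fin n)).integrable_comp_emb
    (MeasurableEquiv.toLp 2 (Fin n → ℝ)).symm.measurableEmbedding).2 (Integrable.fintype_prod hf)

lemma integral_prod_coord (f : Fin n → ℝ → ℝ) :
    ∫ z : EuclideanSpace ℝ (Fin n), ∏ i, f i (z i) = ∏ i, ∫ x, f i x := by
  rw [← integral_fintype_prod_volume_eq_prod]
  exact (PiLp.volume_preserving_ofLp (Fin n)).integral_comp
    (MeasurableEquiv.toLp 2 (Fin n → ℝ)).symm.measurableEmbedding (fun x => ∏ i, f i (x i))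

end Product

lemma mehlerKernel_mul_gaussian (ω τ y z : ℝ) :
    mehlerKernel ω τ y z * exp (-(ω / 2) * z ^ 2) =
      mehlerAmp ω τ * exp (-(mehlerCoth ω τ / 2) * y ^ 2) *
        exp (-((mehlerCoth ω τ + ω) / 2) * z ^ 2 + (mehlerCsch ω τ * y) * z) := by
  rw [mehlerKernel, mul_assoc, mul_assoc, ← exp_add, ← exp_add]
  ring_nf

/-- The Gaussian ground state is an eigenfunction of the Mehler kernel. -/
lemma integral_mehlerKernel_mul_gaussian {ω τ : ℝ} (hω : 0 < ω) (hτ : 0 < τ) (y : ℝ) :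
    ∫ z, mehlerKernel ω τ y z * exp (-(ω / 2) * z ^ 2)
      = exp (-τ * ω) * exp (-(ω / 2) * y ^ 2) := by
  simp_rw [mehlerKernel_mul_gaussian]
  have hb := half_pos (add_pos (mehlerCoth_pos hω hτ) hω)
  rw [integral_const_mul, integral_exp_quadratic hb]
  set x := 2 * τ * ω with hx
  have hs : 0 < sinh x := sinh_two_mul_pos hω hτ
  have hce : cosh x + sinh x = exp x := cosh_add_sinh x
  -- The integral of the Gaussian in z contributes √(π/((A + ω)/2)). Since A + ω = ω exp(x)/sinh x,
  -- its product with the amplitude is exp(-x/2) = exp(-τω).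
  have hsum : (mehlerCoth ω τ + ω) / 2 = ω * exp x / (2 * sinh x) := by
    rw [mehlerCoth, ← hx, ← hce]; field_simp
  have h1 : mehlerAmp ω τ * √(π / ((mehlerCoth ω τ + ω) / 2)) = exp (-τ * ω) := by
    have e : exp (-τ * ω) = √(exp (-x)) := by rw [← exp_half, hx]; ring_nf
    rw [hsum, mehlerAmp, ← hx, ← sqrt_mul (by positivity), e, exp_neg]
    congr 1
    have := pi_pos
    field_simp
  -- From B² = (A - ω)(A + ω), the completed square contributes (A - ω)y²/2, which leaves -ωy²/2.
  have h2 : -(mehlerCoth ω τ / 2) * y ^ 2 +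
      (mehlerCsch ω τ * y) ^ 2 / (4 * ((mehlerCoth ω τ + ω) / 2)) = -(ω / 2) * y ^ 2 := by
    have h3 := mehlerCoth_sq_sub hω hτ
    have h4 := mehlerCoth_pos hω hτ
    generalize mehlerCoth ω τ = a at *
    generalize mehlerCsch ω τ = b at *
    have : a + ω ≠ 0 := by positivity
    field_simp
    rw [show b ^ 2 = a ^ 2 - ω ^ 2 by linarith]
    ring
  rw [mul_mul_mul_comm, h1, ← exp_add, h2]

section GroundState

variable {n : ℕ} {d : Fin n → ℝ} {t₀ t : ℝ} {h : EuclideanSpace ℝ (Fin n) → ℝ}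

/-- The ground state of the harmonic oscillator `-Δ + yᵀ D y`. -/
def groundState (d : Fin n → ℝ) (z : EuclideanSpace ℝ (Fin n)) : ℝ :=
  ∏ i, exp (-(√(d i) / 2) * z i ^ 2)

lemma groundState_pos (d : Fin n → ℝ) (z : EuclideanSpace ℝ (Fin n)) : 0 < groundState d z :=
  Finset.prod_pos fun _ _ => exp_pos _

lemma groundState_le_one (d : Fin n → ℝ) (z : EuclideanSpace ℝ (Fin n)) : groundState d z ≤ 1 :=
  Finset.prod_le_one (fun _ _ => (exp_pos _).le) fun i _ => exp_le_one_iff.2 (by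
    have := mul_nonneg (half_pos one_pos).le (mul_nonneg (sqrt_nonneg (d i)) (sq_nonneg (z i)))
    linarith)

lemma continuous_groundState (d : Fin n → ℝ) : Continuous (groundState d) := by
  unfold groundState; fun_prop

lemma exists_groundState_le (hd : ∀ i, 0 < d i) :
    ∃ ε : ℝ, 0 < ε ∧ ∀ z, groundState d z ≤ exp (-ε * ‖z‖ ^ 2) := by
  obtain ⟨ε, hε, h⟩ := exists_pos_forall_le (β := fun i => √(d i) / 2)
    fun i => half_pos (sqrt_pos.2 (hd i))
  exact ⟨ε, hε, prod_exp_le h⟩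

lemma exists_le_groundState (d : Fin n → ℝ) :
    ∃ a : ℝ, ∀ z, exp (-a * ‖z‖ ^ 2) ≤ groundState d z := by
  refine ⟨∑ i, √(d i) / 2, fun z => ?_⟩
  rw [groundState, ← exp_sum, norm_sq_eq_sum, Finset.mul_sum]
  refine exp_le_exp.2 (Finset.sum_le_sum fun i _ => ?_)
  have := Finset.single_le_sum (f := fun i => √(d i) / 2)
    (fun i _ => div_nonneg (sqrt_nonneg _) two_pos.le) (Finset.mem_univ i)
  nlinarith [sq_nonneg (z i)]

lemma integrable_groundState (hd : ∀ i, 0 < d i) : Integrable (groundState d) :=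
  integrable_prod_coord (f := fun i x => exp (-(√(d i) / 2) * x ^ 2)) fun i =>
    integrable_exp_neg_mul_sq (half_pos (sqrt_pos.2 (hd i)))

lemma gaussIntegrable_of_le_groundState (hd : ∀ i, 0 < d i) (hm : AEStronglyMeasurable h) {C : ℝ}
    (hC : ∀ z, |h z| ≤ C * groundState d z) : GaussIntegrable h := fun ε hε => by
  refine ((integrable_groundState hd).const_mul C).mono' (by fun_prop)
    (Eventually.of_forall fun z => ?_)
  rw [norm_mul, norm_of_nonneg (exp_pos _).le, Real.norm_eq_abs]
  have h1 : exp (-ε * ‖z‖ ^ 2) ≤ 1 := exp_le_one_iff.2 (by nlinarith [sq_nonneg ‖z‖])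
  exact (mul_le_of_le_one_left (abs_nonneg _) h1).trans (hC z)

lemma gaussIntegrable_groundState (hd : ∀ i, 0 < d i) : GaussIntegrable (groundState d) :=
  gaussIntegrable_of_le_groundState hd (continuous_groundState d).aestronglyMeasurable (C := 1)
    fun z => by rw [abs_of_pos (groundState_pos d z), one_mul]

lemma GaussIntegrable.integrable_groundState_mul (hd : ∀ i, 0 < d i) (hh : GaussIntegrable h) :
    Integrable fun z => groundState d z * h z := by
  obtain ⟨ε, hε, hle⟩ := exists_groundState_le hd
  exact hh.integrable_mul (continuous_groundState d).aestronglyMeasurable hε (C := 1) fun z => by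
    rw [abs_of_pos (groundState_pos d z), one_mul]; exact hle z

lemma kernelPP_pos (hd : ∀ i, 0 < d i) (ht : t₀ < t) (y z : EuclideanSpace ℝ (Fin n)) :
    0 < kernelPP d t₀ y t z := by
  rw [kernelPP_eq_prod d hd ht]
  exact Finset.prod_pos fun i _ => mehlerKernel_pos (sqrt_pos.2 (hd i)) (sub_pos.2 ht) _ _

lemma kernelPP_comm (hd : ∀ i, 0 < d i) (ht : t₀ < t) (y z : EuclideanSpace ℝ (Fin n)) :
    kernelPP d t₀ y t z = kernelPP d t₀ z t y := by
  rw [kernelPP_eq_prod d hd ht, kernelPP_eq_prod d hd ht]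
  exact Finset.prod_congr rfl fun i _ => mehlerKernel_comm _ _ _ _

lemma kernelInt_groundState (hd : ∀ i, 0 < d i) (ht : t₀ < t) (y : EuclideanSpace ℝ (Fin n)) :
    kernelInt d t₀ (groundState d) t y
      = exp (-(t - t₀) * ∑ i, √(d i)) * groundState d y := by
  unfold kernelInt groundState
  simp_rw [kernelPP_eq_prod d hd ht, ← Finset.prod_mul_distrib]
  rw [integral_prod_coord fun i x => mehlerKernel (√(d i)) (t - t₀) (y i) x *
    exp (-(√(d i) / 2) * x ^ 2), Finset.mul_sum, exp_sum, ← Finset.prod_mul_distrib]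
  exact Finset.prod_congr rfl fun i _ =>
    integral_mehlerKernel_mul_gaussian (sqrt_pos.2 (hd i)) (sub_pos.2 ht) (y i)

lemma kernelInt_groundState_le (hd : ∀ i, 0 < d i) (ht : t₀ < t)
    (y : EuclideanSpace ℝ (Fin n)) :
    kernelInt d t₀ (groundState d) t y ≤ groundState d y := by
  rw [kernelInt_groundState hd ht]
  refine mul_le_of_le_one_left (groundState_pos d y).le (exp_le_one_iff.2 ?_)
  have := mul_nonneg (sub_pos.2 ht).le (Finset.sum_nonneg fun (i : Fin n) (_ : i ∈ Finset.univ) =>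
    sqrt_nonneg (d i))
  linarith

/-- The propagator is a contraction in `L¹` weighted with the ground state. -/
lemma groundState_mul_kernelInt (hd : ∀ i, 0 < d i) (hh : GaussIntegrable h) (ht : t₀ < t) :
    Integrable (fun y => groundState d y * kernelInt d t₀ h t y) ∧
      ∫ y, groundState d y * |kernelInt d t₀ h t y| ≤ ∫ z, groundState d z * |h z| := by
  -- Fubini for ψ(y)κ(y,z)h(z): by symmetry the integral over y propagates ψ, and the result is at
  -- most ψ(z).
  set F : EuclideanSpace ℝ (Fin n) × EuclideanSpace ℝ (Fin n) → ℝ := fun p =>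
    groundState d p.1 * (kernelPP d t₀ p.1 t p.2 * h p.2) with hF
  have hψ := continuous_groundState d
  have hκ := continuous_kernelPP (n := n) hd ht
  have hFm : AEStronglyMeasurable F (volume.prod volume) := by
    refine AEStronglyMeasurable.mul (by fun_prop) (AEStronglyMeasurable.mul ?_ ?_)
    · exact hκ.aestronglyMeasurable
    · exact hh.aestronglyMeasurable.comp_snd
  have hnorm : ∀ y z, ‖F (y, z)‖ = (kernelPP d t₀ z t y * groundState d y) * |h z| := fun y z => by
    rw [hF, norm_mul, norm_mul, Real.norm_eq_abs, Real.norm_eq_abs, Real.norm_eq_abs,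
      abs_of_pos (groundState_pos d y), abs_of_pos (kernelPP_pos hd ht y z),
      kernelPP_comm hd ht y z]
    ring
  have hinner : ∀ z, ∫ y, ‖F (y, z)‖ = kernelInt d t₀ (groundState d) t z * |h z| := fun z => by
    simp_rw [hnorm, integral_mul_const]
    rfl
  have hle : ∀ z, kernelInt d t₀ (groundState d) t z * |h z| ≤ groundState d z * |h z| := fun z =>
    mul_le_mul_of_nonneg_right (kernelInt_groundState_le hd ht z) (abs_nonneg _)
  have hψh : Integrable fun z => groundState d z * |h z| :=
    (hh.integrable_groundState_mul hd).norm.congr (Eventually.of_forall fun z => by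
      simp only [norm_mul, Real.norm_eq_abs, abs_of_pos (groundState_pos d z)])
  have hFi : Integrable F (volume.prod volume) := by
    refine (integrable_prod_iff' hFm).2 ⟨Eventually.of_forall fun z => ?_, ?_⟩
    · have h1 := ((integrable_kernelPP_mul hd (gaussIntegrable_groundState hd) ht z).mul_const (h z))
      refine h1.congr (Eventually.of_forall fun y => ?_)
      simp only [hF, kernelPP_comm hd ht y z]
      ring
    · simp_rw [hinner]
      have hc : Continuous (kernelInt d t₀ (groundState d) t) :=
        (contDiff_kernelInt hd (gaussIntegrable_groundState hd) ht).continuous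
      refine hψh.mono' (hc.aestronglyMeasurable.mul hh.aestronglyMeasurable.norm)
        (Eventually.of_forall fun z => ?_)
      rw [kernelInt_groundState hd ht, norm_of_nonneg
        (mul_nonneg (mul_pos (exp_pos _) (groundState_pos d z)).le (abs_nonneg _)),
        ← kernelInt_groundState hd ht]
      exact hle z
  have heq : ∀ y, groundState d y * kernelInt d t₀ h t y = ∫ z, F (y, z) := fun y => by
    simp only [hF]
    rw [integral_const_mul]
    rfl
  constructor
  · simp_rw [heq]
    exact hFi.integral_prod_left
  · calc ∫ y, groundState d y * |kernelInt d t₀ h t y| ≤ ∫ y, ∫ z, ‖F (y, z)‖ := by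
          have h1 : ∀ y, groundState d y * |kernelInt d t₀ h t y| = ‖∫ z, F (y, z)‖ := fun y => by
            rw [← heq, norm_mul, Real.norm_eq_abs, Real.norm_eq_abs,
              abs_of_pos (groundState_pos d y)]
          simp_rw [h1]
          exact integral_mono hFi.integral_prod_left.norm hFi.norm.integral_prod_left fun y =>
            norm_integral_le_integral_norm _
      _ = ∫ z, ∫ y, ‖F (y, z)‖ := integral_integral_swap hFi.norm
      _ ≤ ∫ z, groundState d z * |h z| := by
          simp_rw [hinner]
          refine integral_mono_of_nonneg (Eventually.of_forall fun z => ?_) hψh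
            (Eventually.of_forall hle)
          simp only [Pi.zero_apply, ← hinner]
          exact integral_nonneg fun _ => norm_nonneg _

/-- Some Gaussian lies below the ground state, so the contraction bounds the Gaussian-weighted norm
with constants valid for all later times. -/
lemma kernelInt_growth (hd : ∀ i, 0 < d i) (hh : GaussIntegrable h) :
    ∃ a C : ℝ, ∀ t, t₀ < t →
      Integrable (fun y => exp (-a * ‖y‖ ^ 2) * kernelInt d t₀ h t y) ∧
        ∫ y, exp (-a * ‖y‖ ^ 2) * |kernelInt d t₀ h t y| ≤ C := by
  obtain ⟨a, ha⟩ := exists_le_groundState d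
  refine ⟨a, ∫ z, groundState d z * |h z|, fun t ht => ?_⟩
  obtain ⟨h1, h2⟩ := groundState_mul_kernelInt hd hh ht
  have hc := (contDiff_kernelInt hd hh ht).continuous
  have hle : ∀ y, exp (-a * ‖y‖ ^ 2) * |kernelInt d t₀ h t y|
      ≤ groundState d y * |kernelInt d t₀ h t y| := fun y =>
    mul_le_mul_of_nonneg_right (ha y) (abs_nonneg _)
  have h3 : Integrable fun y => groundState d y * |kernelInt d t₀ h t y| :=
    h1.norm.congr (Eventually.of_forall fun y => by
      simp only [norm_mul, Real.norm_eq_abs, abs_of_pos (groundState_pos d y)])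
  refine ⟨h3.mono' (by fun_prop) (Eventually.of_forall fun y => ?_), (integral_mono_of_nonneg
    (Eventually.of_forall fun y => mul_nonneg (exp_pos _).le (abs_nonneg _)) h3
    (Eventually.of_forall hle)).trans h2⟩
  rw [norm_mul, norm_of_nonneg (exp_pos _).le]
  exact hle y

end GroundState

end

/-! ### Short-time kernel bounds and the datum at points of continuity. -/

noncomputable section

lemma self_le_sinh {x : ℝ} (hx : 0 ≤ x) : x ≤ sinh x := self_le_sinh_iff.2 hx

lemma sinh_le_two_mul {x : ℝ} (hx : 0 ≤ x) (hx1 : x ≤ 1) : sinh x ≤ 2 * x := by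
  have h1 := abs_le.1 (abs_exp_sub_one_sub_id_le (x := x) (by rw [abs_of_nonneg hx]; exact hx1))
  have h2 := add_one_le_exp (-x)
  rw [sinh_eq]
  nlinarith

/-- Since coth exceeds csch, the exponent is at most -B(y - z)²/2, and x ≤ sinh x ≤ 2x puts B
between 1/(4τ) and 1/(2τ). The amplitude bound 1/τ is not sharp, but powers of 1/τ are harmless
against exp(-c/τ). -/
lemma mehlerKernel_le {ω τ : ℝ} (hω : 0 < ω) (hτ : 0 < τ) (hτ1 : τ ≤ 1) (hωτ : 2 * τ * ω ≤ 1)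
    (y z : ℝ) : mehlerKernel ω τ y z ≤ τ⁻¹ * exp (-(8 * τ)⁻¹ * (y - z) ^ 2) := by
  have hx : 0 < 2 * τ * ω := by positivity
  have hs := sinh_two_mul_pos hω hτ
  have h1 : mehlerCsch ω τ ≤ (2 * τ)⁻¹ := by
    rw [mehlerCsch, div_le_iff₀ hs, inv_mul_eq_div, le_div_iff₀ (by positivity)]
    linarith [self_le_sinh hx.le]
  have h2 : (4 * τ)⁻¹ ≤ mehlerCsch ω τ := by
    rw [mehlerCsch, le_div_iff₀ hs, inv_mul_eq_div, div_le_iff₀ (by positivity)]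
    linarith [sinh_le_two_mul hx.le hωτ]
  have h3 : mehlerAmp ω τ ≤ τ⁻¹ := by
    have e : ω / (2 * π * sinh (2 * τ * ω)) = mehlerCsch ω τ / (2 * π) := by
      rw [mehlerCsch, div_div, mul_comm (sinh _)]
    rw [mehlerAmp, e, sqrt_le_left (by positivity)]
    have h4 : mehlerCsch ω τ / (2 * π) ≤ mehlerCsch ω τ :=
      div_le_self (mehlerCsch_pos hω hτ).le (by linarith [pi_gt_three])
    have h5 : (2 * τ)⁻¹ ≤ τ⁻¹ := inv_anti₀ hτ (by linarith)
    have h6 : 1 ≤ τ⁻¹ := (one_le_inv₀ hτ).2 hτ1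
    nlinarith
  have h4 := mehlerCsch_lt_mehlerCoth hω hτ
  refine mul_le_mul h3 (exp_le_exp.2 ?_) (exp_pos _).le (by positivity)
  have h5 : (8 * τ)⁻¹ = (4 * τ)⁻¹ / 2 := by field_simp; norm_num
  rw [h5]
  nlinarith [sq_nonneg (y - z), sq_nonneg y, sq_nonneg z]

section InitialDatum

variable {n : ℕ} {d : Fin n → ℝ} {t₀ t : ℝ} {h : EuclideanSpace ℝ (Fin n) → ℝ}

lemma kernelPP_le (hd : ∀ i, 0 < d i) (ht : t₀ < t) (ht1 : t - t₀ ≤ 1)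
    (hdt : ∀ i, 2 * (t - t₀) * √(d i) ≤ 1) (y z : EuclideanSpace ℝ (Fin n)) :
    kernelPP d t₀ y t z ≤ (t - t₀)⁻¹ ^ n * exp (-(8 * (t - t₀))⁻¹ * ‖y - z‖ ^ 2) := by
  have hτ := sub_pos.2 ht
  rw [kernelPP_eq_prod d hd ht, norm_sq_eq_sum, Finset.mul_sum, exp_sum]
  calc _ ≤ ∏ i, ((t - t₀)⁻¹ * exp (-(8 * (t - t₀))⁻¹ * (y i - z i) ^ 2)) :=
        Finset.prod_le_prod (fun i _ => (mehlerKernel_pos (sqrt_pos.2 (hd i)) hτ _ _).le)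
          fun i _ => mehlerKernel_le (sqrt_pos.2 (hd i)) hτ ht1 (hdt i) _ _
    _ = _ := by
        rw [Finset.prod_mul_distrib, Finset.prod_const, Finset.card_univ, Fintype.card_fin]
        simp

lemma GaussIntegrable.integrable_exp_sub (hh : GaussIntegrable h) (y : EuclideanSpace ℝ (Fin n)) :
    Integrable fun z => exp (-‖z - y‖ ^ 2) * h z := by
  refine hh.integrable_mul (by fun_prop) (ε := 1 / 2) (C := exp (‖y‖ ^ 2)) (by norm_num)
    fun z => ?_
  rw [abs_of_pos (exp_pos _), ← exp_add]
  refine exp_le_exp.2 ?_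
  have h1 : ‖z‖ ≤ ‖z - y‖ + ‖y‖ := by simpa using norm_add_le (z - y) y
  nlinarith [norm_nonneg z, norm_nonneg y, norm_nonneg (z - y), sq_nonneg (‖z - y‖ - ‖y‖),
    mul_self_le_mul_self (norm_nonneg z) h1]

lemma GaussIntegrable.add {f g : EuclideanSpace ℝ (Fin n) → ℝ} (hf : GaussIntegrable f)
    (hg : GaussIntegrable g) : GaussIntegrable fun z => f z + g z := fun ε hε =>
  ((hf ε hε).add (hg ε hε)).congr (Eventually.of_forall fun z => by
    simp only [Pi.add_apply]; ring)

lemma GaussIntegrable.const_mul {f : EuclideanSpace ℝ (Fin n) → ℝ} (hf : GaussIntegrable f)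
    (c : ℝ) : GaussIntegrable fun z => c * f z := fun ε hε =>
  ((hf ε hε).const_mul c).congr (Eventually.of_forall fun z => by simp only; ring)

lemma GaussIntegrable.abs {f : EuclideanSpace ℝ (Fin n) → ℝ} (hf : GaussIntegrable f) :
    GaussIntegrable fun z => |f z| := fun ε hε =>
  (hf ε hε).norm.congr (Eventually.of_forall fun z => by
    simp only [norm_mul, Real.norm_eq_abs, abs_of_pos (exp_pos _)])

lemma kernelInt_add (hd : ∀ i, 0 < d i) (ht : t₀ < t) {f g : EuclideanSpace ℝ (Fin n) → ℝ}
    (hf : GaussIntegrable f) (hg : GaussIntegrable g) (y : EuclideanSpace ℝ (Fin n)) :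
    kernelInt d t₀ (fun z => f z + g z) t y = kernelInt d t₀ f t y + kernelInt d t₀ g t y := by
  unfold kernelInt
  simp_rw [mul_add]
  exact integral_add (integrable_kernelPP_mul hd hf ht y) (integrable_kernelPP_mul hd hg ht y)

lemma kernelInt_const_mul (c : ℝ) (f : EuclideanSpace ℝ (Fin n) → ℝ)
    (y : EuclideanSpace ℝ (Fin n)) :
    kernelInt d t₀ (fun z => c * f z) t y = c * kernelInt d t₀ f t y := by
  unfold kernelInt
  rw [← integral_const_mul]
  exact integral_congr_ae (Eventually.of_forall fun z => by simp only; ring)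

lemma tendsto_inv_pow_mul_exp_neg_div (n : ℕ) {c : ℝ} (hc : 0 < c) :
    Tendsto (fun τ : ℝ => τ⁻¹ ^ n * exp (-c * τ⁻¹)) (𝓝[>] 0) (𝓝 0) := by
  have h : Tendsto (fun x : ℝ => x ^ n * exp (-c * x)) atTop (𝓝 0) := by
    have := (isLittleO_pow_exp_pos_mul_atTop n hc).tendsto_div_nhds_zero
    refine this.congr fun x => ?_
    rw [neg_mul, exp_neg, div_eq_mul_inv]
  exact h.comp tendsto_inv_nhdsGT_zero

/-- Off-diagonal smallness of the kernel for short times. -/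
lemma kernelPP_le_of_dist (hd : ∀ i, 0 < d i) (ht : t₀ < t) (ht1 : t - t₀ ≤ 1 / 64)
    (hdt : ∀ i, 2 * (t - t₀) * √(d i) ≤ 1) {y y' z : EuclideanSpace ℝ (Fin n)} {δ : ℝ}
    (hδ : 0 < δ) (hy : ‖y' - y‖ ≤ δ / 2) (hz : δ ≤ ‖z - y‖) :
    kernelPP d t₀ y' t z
      ≤ (t - t₀)⁻¹ ^ n * exp (-(δ ^ 2 / 64) * (t - t₀)⁻¹) * exp (-‖z - y‖ ^ 2) := by
  have hτ := sub_pos.2 ht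
  refine (kernelPP_le hd ht (by linarith) hdt y' z).trans ?_
  rw [mul_assoc, ← exp_add]
  refine mul_le_mul_of_nonneg_left (exp_le_exp.2 ?_) (by positivity)
  -- As ‖y' - y‖ ≤ δ/2 ≤ ‖z - y‖/2, the kernel exponent is at most -‖z - y‖²/(32τ). One half of it
  -- gives -δ²/(64τ); the other gives -‖z - y‖² because τ ≤ 1/64.
  have h1 : ‖z - y‖ / 2 ≤ ‖y' - z‖ := by
    have : ‖z - y‖ ≤ ‖y' - z‖ + ‖y' - y‖ := by
      have h := norm_add_le (-(y' - z)) (y' - y)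
      rwa [norm_neg, show -(y' - z) + (y' - y) = z - y by abel] at h
    linarith
  have h2 : ‖z - y‖ ^ 2 / 4 ≤ ‖y' - z‖ ^ 2 := by nlinarith [norm_nonneg (z - y)]
  have h3 : δ ^ 2 ≤ ‖z - y‖ ^ 2 := by gcongr
  have h4 : 64 ≤ (t - t₀)⁻¹ := by
    rw [le_inv_comm₀ (by norm_num) hτ]; linarith
  rw [mul_inv]
  generalize (t - t₀)⁻¹ = s at *
  nlinarith [mul_le_mul_of_nonneg_left h2 (by linarith : 0 ≤ s),
    mul_le_mul_of_nonneg_left h3 (by linarith : 0 ≤ s),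
    mul_le_mul_of_nonneg_right h4 (sq_nonneg ‖z - y‖)]

lemma eventually_short_time (hd : ∀ i, 0 < d i) :
    ∀ᶠ t in 𝓝[>] t₀, t₀ < t ∧ t - t₀ ≤ 1 / 64 ∧ ∀ i, 2 * (t - t₀) * √(d i) ≤ 1 := by
  obtain ⟨r, hr, hr2⟩ := exists_pos_forall_le (β := fun i => (2 * √(d i))⁻¹) fun i => by
    have := sqrt_pos.2 (hd i); positivity
  have : Ioo t₀ (t₀ + min r (1 / 64)) ∈ 𝓝[>] t₀ :=
    Ioo_mem_nhdsGT (by have := lt_min hr (by norm_num : (0 : ℝ) < 1 / 64); linarith)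
  filter_upwards [this] with t ht
  have h1 := ht.2
  have h2 := min_le_left r (1 / 64)
  have h3 := min_le_right r (1 / 64)
  refine ⟨ht.1, by linarith, fun i => ?_⟩
  have h4 := sqrt_pos.2 (hd i)
  have h5 : t - t₀ ≤ (2 * √(d i))⁻¹ := by linarith [hr2 i]
  rw [← one_div, le_div_iff₀ (by positivity)] at h5
  linarith

lemma tendsto_sub_nhdsGT (t₀ : ℝ) : Tendsto (fun t => t - t₀) (𝓝[>] t₀) (𝓝[>] 0) := by
  refine tendsto_nhdsWithin_iff.2 ⟨?_, eventually_mem_nhdsWithin.mono fun t ht =>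
    mem_Ioi.2 (sub_pos.2 (mem_Ioi.1 ht))⟩
  have : Tendsto (fun t => t - t₀) (𝓝 t₀) (𝓝 (t₀ - t₀)) := by
    exact (continuous_id.sub continuous_const).tendsto t₀
  rw [sub_self] at this
  exact this.mono_left nhdsWithin_le_nhds

/-- The kernel integral of a datum that vanishes continuously at `y` tends to zero there. -/
lemma tendsto_kernelInt_zero (hd : ∀ i, 0 < d i) {f : EuclideanSpace ℝ (Fin n) → ℝ}
    (hf : GaussIntegrable f) {y : EuclideanSpace ℝ (Fin n)} (hfc : ContinuousAt f y)
    (hfy : f y = 0) :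
    Tendsto (fun p : ℝ × EuclideanSpace ℝ (Fin n) => kernelInt d t₀ f p.1 p.2)
      (𝓝[>] t₀ ×ˢ 𝓝 y) (𝓝 0) := by
  rw [Metric.tendsto_nhds]
  intro ε hε
  have hψ := continuous_groundState d
  -- Dividing by ψ bounds the datum near y by (ε/2)ψ, whose propagation is at most (ε/2)ψ ≤ ε/2. The
  -- total mass of the kernel is never needed.
  have hq : ContinuousAt (fun z => f z / groundState d z) y :=
    hfc.div hψ.continuousAt (groundState_pos d y).ne'
  obtain ⟨δ, hδ, hnear⟩ := Metric.continuousAt_iff.1 hq (ε / 2) (half_pos hε)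
  have hnear' : ∀ z, ‖z - y‖ < δ → |f z| ≤ ε / 2 * groundState d z := fun z hz => by
    have h1 := hnear (show dist z y < δ by rwa [dist_eq_norm])
    rw [hfy, zero_div, dist_zero_right, Real.norm_eq_abs, abs_div,
      abs_of_pos (groundState_pos d z), div_lt_iff₀ (groundState_pos d z)] at h1
    exact h1.le
  -- The contribution of the points at distance at least δ is at most this finite integral times a
  -- factor tending to zero with the elapsed time.
  set I := ∫ z, exp (-‖z - y‖ ^ 2) * |f z| with hI
  have hfar : Tendsto (fun t => (t - t₀)⁻¹ ^ n * exp (-(δ ^ 2 / 64) * (t - t₀)⁻¹) * I)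
      (𝓝[>] t₀) (𝓝 0) := by
    have := ((tendsto_inv_pow_mul_exp_neg_div n (c := δ ^ 2 / 64) (by positivity)).comp
      (tendsto_sub_nhdsGT t₀)).mul_const I
    simpa using this
  have e1 : ∀ᶠ t in 𝓝[>] t₀, (t - t₀)⁻¹ ^ n * exp (-(δ ^ 2 / 64) * (t - t₀)⁻¹) * I < ε / 2 :=
    hfar.eventually_lt_const (half_pos hε)
  have e2 : ∀ᶠ y' in 𝓝 y, ‖y' - y‖ ≤ δ / 2 := by
    filter_upwards [Metric.ball_mem_nhds y (half_pos hδ)] with y' hy'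
    rw [← dist_eq_norm]; exact (Metric.mem_ball.1 hy').le
  filter_upwards [(e1.and (eventually_short_time (t₀ := t₀) hd)).prod_mk e2] with p hp
  obtain ⟨t, y'⟩ := p
  obtain ⟨⟨h1, ht, ht1, hdt⟩, h2⟩ := hp
  simp only at h1 h2 ht ht1 hdt ⊢
  rw [dist_zero_right]
  set G := (t - t₀)⁻¹ ^ n * exp (-(δ ^ 2 / 64) * (t - t₀)⁻¹) with hG
  have hG0 : 0 ≤ G := by have := sub_pos.2 ht; positivity
  have i1 := (integrable_kernelPP_mul hd (gaussIntegrable_groundState hd) ht y').const_mul (ε / 2)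
  have i2 := (hf.abs.integrable_exp_sub y).const_mul G
  have key : ‖kernelInt d t₀ f t y'‖ ≤
      ∫ z, (ε / 2 * (kernelPP d t₀ y' t z * groundState d z) +
        G * (exp (-‖z - y‖ ^ 2) * |f z|)) := by
    refine norm_integral_le_of_norm_le (i1.add i2) (Eventually.of_forall fun z => ?_)
    have hκ := kernelPP_pos hd ht y' z
    have hψz := groundState_pos d z
    rw [norm_mul, Real.norm_eq_abs, Real.norm_eq_abs, abs_of_pos hκ]
    rcases lt_or_ge ‖z - y‖ δ with hz | hz
    · have h3 := mul_le_mul_of_nonneg_left (hnear' z hz) hκ.le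
      have h4 : 0 ≤ G * (exp (-‖z - y‖ ^ 2) * |f z|) := by positivity
      linarith
    · have h3 := mul_le_mul_of_nonneg_right (kernelPP_le_of_dist hd ht ht1 hdt hδ h2 hz)
        (abs_nonneg (f z))
      have h4 : 0 ≤ ε / 2 * (kernelPP d t₀ y' t z * groundState d z) := by positivity
      rw [← hG] at h3
      linarith
  rw [integral_add i1 i2, integral_const_mul, integral_const_mul] at key
  have h3 := (kernelInt_groundState_le hd ht y').trans (groundState_le_one d y')
  unfold kernelInt at h3
  nlinarith

/-- The datum is attained pointwise at its points of continuity. -/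
lemma tendsto_kernelInt (hd : ∀ i, 0 < d i) (hh : GaussIntegrable h)
    {y : EuclideanSpace ℝ (Fin n)} (hc : ContinuousAt h y) :
    Tendsto (fun p : ℝ × EuclideanSpace ℝ (Fin n) => kernelInt d t₀ h p.1 p.2)
      (𝓝[>] t₀ ×ˢ 𝓝 y) (𝓝 (h y)) := by
  -- Subtracting cψ instead of a constant makes the datum vanish at y, and the evolution of cψ is
  -- explicit.
  set c := h y / groundState d y with hcdef
  have hψ := continuous_groundState d
  have hψG := gaussIntegrable_groundState hd
  have hψy := (groundState_pos d y).ne'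
  have hf : GaussIntegrable fun z => h z + (-c) * groundState d z := hh.add (hψG.const_mul (-c))
  have h1 := tendsto_kernelInt_zero (t₀ := t₀) hd hf (hc.add (hψ.continuousAt.const_mul (-c)))
    (by simp only [hcdef]; field_simp; ring)
  have h2 : Tendsto (fun p : ℝ × EuclideanSpace ℝ (Fin n) =>
      c * (exp (-(p.1 - t₀) * ∑ i, √(d i)) * groundState d p.2)) (𝓝[>] t₀ ×ˢ 𝓝 y)
      (𝓝 (h y)) := by
    have hcont : Continuous fun p : ℝ × EuclideanSpace ℝ (Fin n) =>
        c * (exp (-(p.1 - t₀) * ∑ i, √(d i)) * groundState d p.2) := by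
      have : Continuous fun p : ℝ × EuclideanSpace ℝ (Fin n) => groundState d p.2 :=
        hψ.comp continuous_snd
      fun_prop
    have h3 := (hcont.tendsto (t₀, y)).mono_left
      (show 𝓝[>] t₀ ×ˢ 𝓝 y ≤ 𝓝 (t₀, y) by
        rw [nhds_prod_eq]; exact prod_mono nhdsWithin_le_nhds le_rfl)
    have e : c * (exp (-(t₀ - t₀) * ∑ i, √(d i)) * groundState d y) = h y := by
      simp only [hcdef]; simp [hψy]
    simp only [e] at h3
    exact h3
  have h3 := h1.add h2
  rw [zero_add] at h3
  refine h3.congr' ?_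
  have : ∀ᶠ p : ℝ × EuclideanSpace ℝ (Fin n) in 𝓝[>] t₀ ×ˢ 𝓝 y, t₀ < p.1 :=
    tendsto_fst.eventually eventually_mem_nhdsWithin
  filter_upwards [this] with p hp
  rw [kernelInt_add hd hp hh (hψG.const_mul (-c)), kernelInt_const_mul,
    kernelInt_groundState hd hp]
  ring

end InitialDatum

end

/-! ### Attainment of the datum in L¹_loc. -/

noncomputable section

variable {n : ℕ} {d : Fin n → ℝ} {t₀ t : ℝ} {h : EuclideanSpace ℝ (Fin n) → ℝ}

lemma GaussIntegrable.integrableOn (hh : GaussIntegrable h) {K : Set (EuclideanSpace ℝ (Fin n))}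
    (hK : IsCompact K) : IntegrableOn h K := by
  have h1 : IntegrableOn (fun z => exp (-1 * ‖z‖ ^ 2) * h z) K := (hh 1 one_pos).integrableOn
  have h2 : ContinuousOn (fun z : EuclideanSpace ℝ (Fin n) => exp (‖z‖ ^ 2)) K := by fun_prop
  refine (h1.continuousOn_mul h2 hK).congr (Eventually.of_forall fun z => ?_)
  simp only
  rw [← mul_assoc, ← exp_add]
  simp

lemma integrableOn_kernelInt_sub (hd : ∀ i, 0 < d i) (hh : GaussIntegrable h) (ht : t₀ < t)
    {K : Set (EuclideanSpace ℝ (Fin n))} (hK : IsCompact K) :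
    IntegrableOn (fun y => kernelInt d t₀ h t y - h y) K :=
  ((contDiff_kernelInt hd hh ht).continuous.continuousOn.integrableOn_compact hK).sub
    (hh.integrableOn hK)

lemma exists_one_le_mul_groundState (d : Fin n → ℝ) {K : Set (EuclideanSpace ℝ (Fin n))}
    (hK : IsCompact K) : ∃ M : ℝ, 0 < M ∧ ∀ y ∈ K, 1 ≤ M * groundState d y := by
  obtain ⟨C, hC⟩ := hK.exists_bound_of_continuousOn (f := fun y => (groundState d y)⁻¹)
    ((continuous_groundState d).inv₀ fun y => (groundState_pos d y).ne').continuousOn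
  refine ⟨max C 1, lt_max_of_lt_right one_pos, fun y hy => ?_⟩
  have h0 := groundState_pos d y
  have h1 := hC y hy
  rw [norm_of_nonneg (inv_nonneg.2 h0.le), inv_le_iff_one_le_mul₀ h0] at h1
  exact h1.trans (mul_le_mul_of_nonneg_right (le_max_left _ _) h0.le)

lemma setIntegral_abs_le {K : Set (EuclideanSpace ℝ (Fin n))}
    (hK : IsCompact K) {M : ℝ} (hM : ∀ y ∈ K, 1 ≤ M * groundState d y)
    {f : EuclideanSpace ℝ (Fin n) → ℝ} (hM0 : 0 < M)
    (hf : Integrable fun y => groundState d y * f y) :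
    ∫ y in K, |f y| ≤ M * ∫ y, groundState d y * |f y| := by
  have hf' : Integrable fun y => M * (groundState d y * |f y|) :=
    (hf.norm.congr (Eventually.of_forall fun y => by
      simp only [norm_mul, Real.norm_eq_abs, abs_of_pos (groundState_pos d y)])).const_mul M
  have h0 : ∀ y, 0 ≤ M * (groundState d y * |f y|) := fun y =>
    mul_nonneg hM0.le (mul_nonneg (groundState_pos d y).le (abs_nonneg _))
  rw [← integral_const_mul]
  refine le_trans ?_ (setIntegral_le_integral hf' (Eventually.of_forall h0) (s := K))
  refine integral_mono_of_nonneg (Eventually.of_forall fun y => abs_nonneg _) hf'.integrableOn ?_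
  filter_upwards [ae_restrict_mem hK.measurableSet] with y hy
  rw [← mul_assoc]
  exact le_mul_of_one_le_left (abs_nonneg _) (hM y hy)

lemma tendsto_kernelInt_sub_abs (hd : ∀ i, 0 < d i) (hh : GaussIntegrable h)
    {y : EuclideanSpace ℝ (Fin n)} (hc : ContinuousAt h y) :
    Tendsto (fun t => |kernelInt d t₀ h t y - h y|) (𝓝[>] t₀) (𝓝 0) := by
  have h0 : Tendsto (fun t : ℝ => (t, y)) (𝓝[>] t₀) (𝓝[>] t₀ ×ˢ 𝓝 y) :=
    tendsto_id.prodMk tendsto_const_nhds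
  have h1 := (tendsto_kernelInt (t₀ := t₀) hd hh hc).comp h0
  have h2 := (h1.sub_const (h y)).abs
  rw [sub_self, abs_zero] at h2
  exact h2

/-- For data bounded by the ground state, the datum is attained in `L¹_loc`. -/
lemma tendsto_setIntegral_kernelInt_of_continuous (hd : ∀ i, 0 < d i)
    {g : EuclideanSpace ℝ (Fin n) → ℝ} (hg : Continuous g) {C : ℝ}
    (hC : ∀ z, |g z| ≤ C * groundState d z) {K : Set (EuclideanSpace ℝ (Fin n))}
    (hK : IsCompact K) :
    Tendsto (fun t => ∫ y in K, |kernelInt d t₀ g t y - g y|) (𝓝[>] t₀) (𝓝 0) := by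
  have hgG := gaussIntegrable_of_le_groundState hd hg.aestronglyMeasurable hC
  have hψG := gaussIntegrable_groundState hd
  have hC0 : 0 ≤ C := by
    by_contra hneg
    have := (abs_nonneg _).trans (hC 0)
    nlinarith [groundState_pos d 0]
  have hle1 : ∀ z, C * groundState d z ≤ C := fun z =>
    mul_le_of_le_one_right hC0 (groundState_le_one d z)
  -- Positivity of the kernel propagates |g| ≤ Cψ, so C is a bound for all times and dominated
  -- convergence applies on the compact set.
  have hbd : ∀ t, t₀ < t → ∀ y, |kernelInt d t₀ g t y| ≤ C := fun t ht y => by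
    have h1 : ‖kernelInt d t₀ g t y‖ ≤ ∫ z, C * (kernelPP d t₀ y t z * groundState d z) := by
      refine norm_integral_le_of_norm_le ((integrable_kernelPP_mul hd hψG ht y).const_mul C)
        (Eventually.of_forall fun z => ?_)
      rw [norm_mul, Real.norm_eq_abs, Real.norm_eq_abs, abs_of_pos (kernelPP_pos hd ht y z),
        mul_left_comm]
      exact mul_le_mul_of_nonneg_left (hC z) (kernelPP_pos hd ht y z).le
    rw [integral_const_mul, Real.norm_eq_abs] at h1
    refine h1.trans ((mul_le_mul_of_nonneg_left (kernelInt_groundState_le hd ht y) hC0).trans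
      (hle1 y))
  have : Tendsto (fun t => ∫ y in K, |kernelInt d t₀ g t y - g y|) (𝓝[>] t₀)
      (𝓝 (∫ _y in K, (0 : ℝ))) := by
    refine tendsto_integral_filter_of_dominated_convergence (fun _ => C + C) ?_ ?_
      (integrableOn_const hK.measure_lt_top.ne) (Eventually.of_forall fun y => ?_)
    · filter_upwards [eventually_mem_nhdsWithin] with t ht
      have hc := (contDiff_kernelInt hd hgG (mem_Ioi.1 ht)).continuous
      exact Continuous.aestronglyMeasurable (by fun_prop)
    · filter_upwards [eventually_mem_nhdsWithin] with t ht
      refine Eventually.of_forall fun y => ?_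
      rw [Real.norm_eq_abs, abs_abs]
      exact (abs_sub _ _).trans (add_le_add (hbd t ht y) ((hC y).trans (hle1 y)))
    · exact tendsto_kernelInt_sub_abs hd hgG hg.continuousAt
  simpa using this

/-- The datum is attained in `L¹_loc`. -/
lemma tendsto_setIntegral_kernelInt (hd : ∀ i, 0 < d i) (hh : GaussIntegrable h)
    {K : Set (EuclideanSpace ℝ (Fin n))} (hK : IsCompact K) :
    Tendsto (fun t => ∫ y in K, |kernelInt d t₀ h t y - h y|) (𝓝[>] t₀) (𝓝 0) := by
  rw [Metric.tendsto_nhds]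
  intro ε hε
  obtain ⟨M, hM0, hM⟩ := exists_one_le_mul_groundState d hK
  have hψ := continuous_groundState d
  -- The function ψh is approximated in L¹ and divided by ψ afterwards. With M ψ ≥ 1 on K, the error
  -- and its propagation each contribute at most M · ε/(4M) = ε/4; the continuous part contributes
  -- less than ε/2.
  obtain ⟨g₀, hg₀s, hg₀, hg₀c, -⟩ := (hh.integrable_groundState_mul hd)
    |>.exists_hasCompactSupport_integral_sub_le (ε := ε / (4 * M)) (by positivity)
  set g : EuclideanSpace ℝ (Fin n) → ℝ := fun z => g₀ z / groundState d z with hg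
  have hgc : Continuous g := hg₀c.div hψ fun z => (groundState_pos d z).ne'
  obtain ⟨C, hC⟩ : ∃ C, ∀ z, |g z| ≤ C * groundState d z := by
    have hc : Continuous fun z => g z / groundState d z :=
      hgc.div hψ fun z => (groundState_pos d z).ne'
    have hs : HasCompactSupport fun z => g z / groundState d z := by
      refine hg₀s.mono fun z hz => ?_
      contrapose! hz
      simp [hg, Function.notMem_support.1 hz]
    obtain ⟨C, hC⟩ := hs.exists_bound_of_continuous hc
    refine ⟨C, fun z => ?_⟩
    have := hC z
    rwa [Real.norm_eq_abs, abs_div, abs_of_pos (groundState_pos d z),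
      div_le_iff₀ (groundState_pos d z)] at this
  have hgG := gaussIntegrable_of_le_groundState hd hgc.aestronglyMeasurable hC
  set f : EuclideanSpace ℝ (Fin n) → ℝ := fun z => h z + (-1) * g z with hf
  have hfG : GaussIntegrable f := hh.add (hgG.const_mul (-1))
  have hfint : ∫ z, groundState d z * |f z| ≤ ε / (4 * M) := by
    refine le_of_eq_of_le (integral_congr_ae (Eventually.of_forall fun z => ?_)) hg₀
    have h0 := groundState_pos d z
    simp only [Real.norm_eq_abs]
    nth_rw 1 [← abs_of_pos h0]
    rw [← abs_mul]
    congr 1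
    simp only [hf, hg]
    field_simp
    ring
  have hlim := tendsto_setIntegral_kernelInt_of_continuous (t₀ := t₀) hd hgc hC hK
  filter_upwards [hlim.eventually_lt_const (half_pos hε), eventually_mem_nhdsWithin]
    with t ht1 ht
  rw [dist_zero_right, norm_of_nonneg (integral_nonneg fun _ => abs_nonneg _)]
  obtain ⟨c1, c2⟩ := groundState_mul_kernelInt hd hfG (mem_Ioi.1 ht)
  have b1 := setIntegral_abs_le hK hM hM0 c1
  have b2 := setIntegral_abs_le hK hM hM0 (hfG.integrable_groundState_mul hd)
  have hcf := (contDiff_kernelInt hd hfG (mem_Ioi.1 ht)).continuous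
  have j1 : IntegrableOn (fun y => |kernelInt d t₀ f t y|) K :=
    hcf.abs.continuousOn.integrableOn_compact hK
  have j2 : IntegrableOn (fun y => |f y|) K := (hfG.integrableOn hK).abs
  have j3 : IntegrableOn (fun y => |kernelInt d t₀ g t y - g y|) K :=
    (integrableOn_kernelInt_sub hd hgG (mem_Ioi.1 ht) hK).abs
  have b3 : ∫ y in K, |kernelInt d t₀ h t y - h y| ≤ ∫ y in K,
      (|kernelInt d t₀ f t y| + |kernelInt d t₀ g t y - g y| + |f y|) := by
    refine integral_mono (integrableOn_kernelInt_sub hd hh (mem_Ioi.1 ht) hK).abs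
      ((j1.add j3).add j2) fun y => ?_
    have e : kernelInt d t₀ f t y = kernelInt d t₀ h t y + (-1) * kernelInt d t₀ g t y := by
      rw [← kernelInt_const_mul, ← kernelInt_add hd (mem_Ioi.1 ht) hh (hgG.const_mul (-1))]
    have e2 : kernelInt d t₀ h t y - h y
        = kernelInt d t₀ f t y + (kernelInt d t₀ g t y - g y) + -f y := by
      rw [e]; simp only [hf]; ring
    simp only
    rw [e2]
    refine (abs_add_le _ _).trans ?_
    rw [abs_neg]
    linarith [abs_add_le (kernelInt d t₀ f t y) (kernelInt d t₀ g t y - g y)]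
  have j4 : IntegrableOn (fun y => |kernelInt d t₀ f t y| + |kernelInt d t₀ g t y - g y|) K :=
    j1.add j3
  rw [integral_add j4 j2, integral_add j1 j3] at b3
  have b4 : M * (ε / (4 * M)) = ε / 4 := by field_simp
  have b5 := mul_le_mul_of_nonneg_left hfint hM0.le
  have b6 := mul_le_mul_of_nonneg_left c2 hM0.le
  linarith

lemma isIVPSolution_kernelInt (hd : ∀ i, 0 < d i) (hh : GaussIntegrable h) :
    IsIVPSolution d t₀ h (kernelInt d t₀ h) where
  contDiff t ht := contDiff_infty.1 (contDiff_kernelInt hd hh ht) 2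
  continuousOn k _ := fun p hp =>
    (contDiffAt_iteratedFDeriv_slice (s := Ioi t₀)
      (fun t ht y => contDiffAt_kernelInt hd hh ht y) k p.1 hp.1 p.2).continuousAt.continuousWithinAt
  pde t ht y := hasDerivAt_kernelInt_pde hd hh ht y
  initial K hK := ⟨fun t ht => integrableOn_kernelInt_sub hd hh ht hK,
    tendsto_setIntegral_kernelInt hd hh hK⟩
  growth T _ := by
    obtain ⟨a, C, hC⟩ := kernelInt_growth (t₀ := t₀) hd hh
    exact ⟨a, C, fun t ht => hC t ht.1⟩

end

/-! ### Cut-off Gaussian weights. -/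

noncomputable section

lemma deriv_eq_zero_of_eventuallyEq_const {f : ℝ → ℝ} {x c : ℝ} (h : f =ᶠ[𝓝 x] fun _ => c) :
    deriv f x = 0 := by rw [h.deriv_eq]; simp

/-- The first two derivatives of the smooth transition are bounded and vanish beyond one. -/
lemma exists_smoothTransition_bound :
    ∃ (S' S'' : ℝ → ℝ) (B : ℝ), 0 ≤ B ∧ (∀ x, HasDerivAt smoothTransition (S' x) x) ∧
      (∀ x, HasDerivAt S' (S'' x) x) ∧ (∀ x, |S' x| ≤ B) ∧ (∀ x, |S'' x| ≤ B) ∧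
      ∀ x, 1 < x → S' x = 0 ∧ S'' x = 0 := by
  have hS : ContDiff ℝ 2 smoothTransition := smoothTransition.contDiff (n := 2)
  have hS' : ContDiff ℝ 1 (deriv smoothTransition) := hS.deriv' (n := 1)
  have z1 : ∀ x, x < 0 → deriv smoothTransition x = 0 := fun x hx =>
    deriv_eq_zero_of_eventuallyEq_const ((eventually_lt_nhds hx).mono fun y hy =>
      smoothTransition.zero_of_nonpos hy.le)
  have z2 : ∀ x, 1 < x → deriv smoothTransition x = 0 := fun x hx =>
    deriv_eq_zero_of_eventuallyEq_const ((eventually_gt_nhds hx).mono fun y hy =>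
      smoothTransition.one_of_one_le hy.le)
  have z3 : ∀ x, x < 0 → deriv (deriv smoothTransition) x = 0 := fun x hx =>
    deriv_eq_zero_of_eventuallyEq_const ((eventually_lt_nhds hx).mono fun y hy => z1 y hy)
  have z4 : ∀ x, 1 < x → deriv (deriv smoothTransition) x = 0 := fun x hx =>
    deriv_eq_zero_of_eventuallyEq_const ((eventually_gt_nhds hx).mono fun y hy => z2 y hy)
  have hc' : Continuous (deriv (deriv smoothTransition)) := hS'.continuous_deriv le_rfl
  obtain ⟨B₁, hB₁⟩ := (isCompact_Icc (a := (0 : ℝ)) (b := 1)).exists_bound_of_continuousOn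
    hS'.continuous.continuousOn
  obtain ⟨B₂, hB₂⟩ := (isCompact_Icc (a := (0 : ℝ)) (b := 1)).exists_bound_of_continuousOn
    hc'.continuousOn
  have hB : 0 ≤ max B₁ B₂ :=
    le_max_of_le_left ((norm_nonneg _).trans (hB₁ 0 ⟨le_rfl, zero_le_one⟩))
  refine ⟨deriv smoothTransition, deriv (deriv smoothTransition), max B₁ B₂, hB,
    fun x => (hS.differentiable (by norm_num) x).hasDerivAt,
    fun x => (hS'.differentiable (by norm_num) x).hasDerivAt, fun x => ?_, fun x => ?_,
    fun x hx => ⟨z2 x hx, z4 x hx⟩⟩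
  · rcases lt_or_ge x 0 with h | h
    · rw [z1 x h, abs_zero]; exact hB
    rcases lt_or_ge 1 x with h' | h'
    · rw [z2 x h', abs_zero]; exact hB
    · exact (hB₁ x ⟨h, h'⟩).trans (le_max_left _ _)
  · rcases lt_or_ge x 0 with h | h
    · rw [z3 x h, abs_zero]; exact hB
    rcases lt_or_ge 1 x with h' | h'
    · rw [z4 x h', abs_zero]; exact hB
    · exact (hB₂ x ⟨h, h'⟩).trans (le_max_right _ _)

variable {n : ℕ}

lemma hasDerivAt_norm_sq_line (y : EuclideanSpace ℝ (Fin n)) (j : Fin n) :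
    HasDerivAt (fun x : ℝ => ‖y + x • EuclideanSpace.single j (1 : ℝ)‖ ^ 2) (2 * y j) 0 := by
  simp_rw [norm_sq_eq_sum]
  refine (HasDerivAt.fun_sum (u := Finset.univ) fun i _ =>
    (hasDerivAt_coord y i j).pow 2).congr_deriv ?_
  simp

lemma laplacian_radial {G G' G'' : ℝ → ℝ}
    (h1 : ∀ s, HasDerivAt G (G' s) s) (h2 : ∀ s, HasDerivAt G' (G'' s) s)
    (hc : ContDiff ℝ 2 fun y : EuclideanSpace ℝ (Fin n) => G (‖y‖ ^ 2))
    (y : EuclideanSpace ℝ (Fin n)) :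
    Laplacian.laplacian (fun y : EuclideanSpace ℝ (Fin n) => G (‖y‖ ^ 2)) y
      = 4 * ‖y‖ ^ 2 * G'' (‖y‖ ^ 2) + 2 * n * G' (‖y‖ ^ 2) := by
  rw [laplacian_eq_sum_of_hasLineDerivAt hc (g := fun i y => G' (‖y‖ ^ 2) * (2 * y i))
    (g' := fun i => G'' (‖y‖ ^ 2) * (2 * y i) * (2 * y i) + G' (‖y‖ ^ 2) * 2)]
  · rw [norm_sq_eq_sum, Finset.sum_add_distrib, Finset.mul_sum, Finset.sum_mul]
    simp only [Finset.sum_const, Finset.card_univ, Fintype.card_fin, nsmul_eq_mul]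
    congr 1
    · exact Finset.sum_congr rfl fun i _ => by ring
    · ring
  · intro i x
    have h := hasDerivAt_norm_sq_line x i
    have e : ‖x + (0 : ℝ) • EuclideanSpace.single i (1 : ℝ)‖ ^ 2 = ‖x‖ ^ 2 := by simp
    exact HasDerivAt.comp (h₂ := G) (h := fun t : ℝ => ‖x + t • EuclideanSpace.single i (1 : ℝ)‖ ^ 2)
      0 (by rw [e]; exact h1 _) h
  · intro i
    have h := hasDerivAt_norm_sq_line y i
    have e : ‖y + (0 : ℝ) • EuclideanSpace.single i (1 : ℝ)‖ ^ 2 = ‖y‖ ^ 2 := by simp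
    have h3 := HasDerivAt.comp (h₂ := G')
      (h := fun t : ℝ => ‖y + t • EuclideanSpace.single i (1 : ℝ)‖ ^ 2)
      0 (by rw [e]; exact h2 _) h
    have h4 := h3.mul ((hasDerivAt_coord y i i).const_mul 2)
    refine HasDerivAt.congr_deriv h4 ?_
    simp

/-- A Gaussian weight of rate `b`, cut off smoothly outside `‖y‖² ≤ R + 1`. -/
def cutoffGaussian (R b : ℝ) (y : EuclideanSpace ℝ (Fin n)) : ℝ :=
  exp (-b * ‖y‖ ^ 2) * smoothTransition (R + 1 - ‖y‖ ^ 2)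

lemma cutoffGaussian_nonneg (R b : ℝ) (y : EuclideanSpace ℝ (Fin n)) :
    0 ≤ cutoffGaussian R b y :=
  mul_nonneg (exp_pos _).le (smoothTransition.nonneg _)

lemma contDiff_cutoffGaussian (R b : ℝ) :
    ContDiff ℝ 2 (cutoffGaussian R b : EuclideanSpace ℝ (Fin n) → ℝ) := by
  have h1 : ContDiff ℝ 2 fun y : EuclideanSpace ℝ (Fin n) => ‖y‖ ^ 2 := contDiff_norm_sq ℝ
  have h2 : ContDiff ℝ 2 smoothTransition := smoothTransition.contDiff (n := 2)
  exact (contDiff_const.mul h1).exp.mul (h2.comp (contDiff_const.sub h1))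

lemma cutoffGaussian_eq_zero {R b : ℝ} (hR : 0 ≤ R) {y : EuclideanSpace ℝ (Fin n)}
    (hy : y ∉ Metric.closedBall 0 (R + 1)) : cutoffGaussian R b y = 0 := by
  have h1 : R + 1 < ‖y‖ := by simpa using hy
  -- As R + 1 ≥ 1, a norm above R + 1 has square above R + 1; the closed ball of radius R + 1 is a
  -- generous support.
  rw [cutoffGaussian, smoothTransition.zero_of_nonpos (by nlinarith), mul_zero]

lemma hasCompactSupport_cutoffGaussian {R : ℝ} (hR : 0 ≤ R) (b : ℝ) :
    HasCompactSupport (cutoffGaussian R b : EuclideanSpace ℝ (Fin n) → ℝ) :=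
  HasCompactSupport.intro (isCompact_closedBall 0 (R + 1)) fun _ hy => cutoffGaussian_eq_zero hR hy

/-- The cut-off Gaussian is a subsolution up to an exponentially small error. -/
lemma exists_laplacian_cutoffGaussian_le (n : ℕ) {a : ℝ} (ha : 0 ≤ a) :
    ∃ L : ℝ, 0 ≤ L ∧ ∀ R b : ℝ, 0 ≤ R → a + 1 ≤ b → b ≤ 2 * (a + 1) →
      ∀ y : EuclideanSpace ℝ (Fin n), Laplacian.laplacian (cutoffGaussian R b) y
        ≤ 4 * b ^ 2 * ‖y‖ ^ 2 * cutoffGaussian R b y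
          + L * exp (-R / 2) * exp (-a * ‖y‖ ^ 2) := by
  obtain ⟨S', S'', B, hB, hS', hS'', b1, b2, hz⟩ := exists_smoothTransition_bound
  set K : ℝ := 4 * (4 * (a + 1) + 1) * B + 2 * n * B with hK
  have hK0 : 0 ≤ K := by positivity
  refine ⟨2 * K, by positivity, fun R b hR hb1 hb2 y => ?_⟩
  have d0 : ∀ s, HasDerivAt (fun s => R + 1 - s) (-1) s := fun s => by
    simpa using (hasDerivAt_id s).const_sub (R + 1)
  have d1 : ∀ s, HasDerivAt (fun s => exp (-b * s)) (exp (-b * s) * -b) s := fun s => by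
    simpa using ((hasDerivAt_id s).const_mul (-b)).exp
  have d2 : ∀ s, HasDerivAt (fun s => smoothTransition (R + 1 - s)) (-S' (R + 1 - s)) s := fun s =>
    (HasDerivAt.comp s (hS' (R + 1 - s)) (d0 s)).congr_deriv (by ring)
  have d3 : ∀ s, HasDerivAt (fun s => S' (R + 1 - s)) (-S'' (R + 1 - s)) s := fun s =>
    (HasDerivAt.comp s (hS'' (R + 1 - s)) (d0 s)).congr_deriv (by ring)
  have d4 : ∀ s, HasDerivAt (fun s => -b * smoothTransition (R + 1 - s) - S' (R + 1 - s))
      (-b * -S' (R + 1 - s) - -S'' (R + 1 - s)) s := fun s =>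
    ((d2 s).const_mul (-b)).sub (d3 s)
  have h := laplacian_radial (n := n) (G := fun s => exp (-b * s) * smoothTransition (R + 1 - s))
    (G' := fun s => exp (-b * s) * (-b * smoothTransition (R + 1 - s) - S' (R + 1 - s)))
    (G'' := fun s => exp (-b * s) *
      (b ^ 2 * smoothTransition (R + 1 - s) + 2 * b * S' (R + 1 - s) + S'' (R + 1 - s)))
    (fun s => ((d1 s).mul (d2 s)).congr_deriv (by ring))
    (fun s => ((d1 s).mul (d4 s)).congr_deriv (by ring))
    (contDiff_cutoffGaussian R b) y
  have h' : Laplacian.laplacian (cutoffGaussian R b) y = _ := h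
  rw [h', cutoffGaussian]
  set s := ‖y‖ ^ 2 with hs
  have hs0 : 0 ≤ s := sq_nonneg _
  set w := smoothTransition (R + 1 - s) with hw
  have hw0 : 0 ≤ w := smoothTransition.nonneg _
  have hb0 : 0 ≤ b := by linarith
  -- Derivatives of the cut-off vanish for s < R, and for s ≥ R the factor exp((s - R)/2) is at
  -- least 1; it records the localisation.
  have key : 4 * s * (2 * b * S' (R + 1 - s) + S'' (R + 1 - s)) - 2 * n * S' (R + 1 - s)
      ≤ K * (1 + s) * exp ((s - R) / 2) := by
    rcases lt_or_ge s R with hsR | hsR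
    · obtain ⟨e1, e2⟩ := hz (R + 1 - s) (by linarith)
      rw [e1, e2]
      simp only [mul_zero, add_zero, sub_zero]
      positivity
    · have c1 := abs_le.1 (b1 (R + 1 - s))
      have c2 := abs_le.1 (b2 (R + 1 - s))
      have c3 : 2 * b * S' (R + 1 - s) ≤ 2 * (2 * (a + 1)) * B := by
        calc 2 * b * S' (R + 1 - s) ≤ 2 * b * B := by gcongr; exact c1.2
          _ ≤ _ := by gcongr
      have c4 : 4 * s * (2 * b * S' (R + 1 - s) + S'' (R + 1 - s))
          ≤ 4 * s * (2 * (2 * (a + 1)) * B + B) := by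
        gcongr; exact c2.2
      have c5 : -(2 * n * S' (R + 1 - s)) ≤ 2 * n * B := by
        have : (2 * n : ℝ) * -S' (R + 1 - s) ≤ 2 * n * B := by gcongr; linarith [c1.1]
        linarith
      have c6 : 1 ≤ exp ((s - R) / 2) := one_le_exp (by linarith)
      have c7 : K * (1 + s) ≤ K * (1 + s) * exp ((s - R) / 2) :=
        le_mul_of_one_le_right (by positivity) c6
      have c8 : 4 * s * (2 * (2 * (a + 1)) * B + B) + 2 * n * B ≤ K * (1 + s) := by
        have p1 : 0 ≤ 4 * (4 * (a + 1) + 1) * B := by positivity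
        have p2 : 0 ≤ 2 * n * B * s := by positivity
        rw [hK]; nlinarith
      linarith
  -- A rate b ≥ a + 1 leaves a spare exp(-s): one half absorbs the polynomial 1 + s, the other
  -- cancels exp(s/2) in the localisation factor and leaves exp(-R/2).
  have hexp : exp (-b * s) ≤ exp (-(a + 1) * s) := exp_le_exp.2 (by nlinarith)
  have hpoly : 1 + s ≤ 2 * exp (s / 2) := by linarith [add_one_le_exp (s / 2)]
  have hmain : exp (-b * s) *
      (4 * s * (2 * b * S' (R + 1 - s) + S'' (R + 1 - s)) - 2 * n * S' (R + 1 - s))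
      ≤ 2 * K * exp (-R / 2) * exp (-a * s) := by
    calc _ ≤ exp (-b * s) * (K * (1 + s) * exp ((s - R) / 2)) := by gcongr
      _ ≤ exp (-(a + 1) * s) * (K * (2 * exp (s / 2)) * exp ((s - R) / 2)) := by gcongr
      _ = 2 * K * (exp (-(a + 1) * s) * exp (s / 2) * exp ((s - R) / 2)) := by ring
      _ = 2 * K * (exp (-R / 2) * exp (-a * s)) := by
          rw [← exp_add, ← exp_add, ← exp_add]; ring_nf
      _ = _ := by ring
  -- The first-order term of the Laplacian of the Gaussian has a favourable sign and is dropped.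
  have hneg : 0 ≤ 2 * n * b * (exp (-b * s) * w) := by positivity
  linarith

end

/-! ### Green's identity, a Kato inequality and differentiation of localised integrals. -/

noncomputable section

section Laplacian

variable {n : ℕ} {f g : EuclideanSpace ℝ (Fin n) → ℝ}

lemma contDiff_fderiv_apply (hf : ContDiff ℝ 2 f) (v : EuclideanSpace ℝ (Fin n)) :
    ContDiff ℝ 1 fun y => fderiv ℝ f y v :=
  (hf.fderiv_right (m := 1) (by norm_num)).clm_apply contDiff_const

lemma continuous_fderiv_fderiv_apply (hf : ContDiff ℝ 2 f) (v : EuclideanSpace ℝ (Fin n)) :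
    Continuous fun y => fderiv ℝ (fun x => fderiv ℝ f x v) y v :=
  ((contDiff_fderiv_apply hf v).continuous_fderiv (by norm_num)).clm_apply continuous_const

lemma laplacian_eq_sum_fderiv (hf : ContDiff ℝ 2 f) (y : EuclideanSpace ℝ (Fin n)) :
    Laplacian.laplacian f y = ∑ i, fderiv ℝ
      (fun x => fderiv ℝ f x (EuclideanSpace.single i 1)) y (EuclideanSpace.single i 1) :=
  laplacian_eq_sum_of_hasLineDerivAt hf
    (fun i x => ((hf.differentiable (by norm_num)) x).hasFDerivAt.hasLineDerivAt _)
    fun i => (((contDiff_fderiv_apply hf _).differentiable (by norm_num)) y).hasFDerivAt.hasLineDerivAt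
      _

lemma continuous_laplacian (hf : ContDiff ℝ 2 f) : Continuous (Laplacian.laplacian f) := by
  rw [show Laplacian.laplacian f = _ from funext (laplacian_eq_sum_fderiv hf)]
  exact continuous_finsetSum _ fun i _ => continuous_fderiv_fderiv_apply hf _

lemma hasCompactSupport_laplacian (hfs : HasCompactSupport f) :
    HasCompactSupport (Laplacian.laplacian f) := by
  refine HasCompactSupport.of_support_subset_isCompact hfs fun y hy => ?_
  by_contra hy'
  refine hy ?_
  have h : f =ᶠ[𝓝 y] fun _ => (0 : ℝ) := notMem_tsupport_iff_eventuallyEq.1 hy'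
  rw [(InnerProductSpace.laplacian_congr_nhds h).eq_of_nhds]
  simp

/-- Green's identity for a compactly supported test function. -/
lemma integral_mul_laplacian (hf : ContDiff ℝ 2 f) (hfs : HasCompactSupport f)
    (hg : ContDiff ℝ 2 g) :
    ∫ y, f y * Laplacian.laplacian g y = ∫ y, Laplacian.laplacian f y * g y := by
  simp_rw [laplacian_eq_sum_fderiv hf, laplacian_eq_sum_fderiv hg, Finset.mul_sum, Finset.sum_mul]
  have hdf : Differentiable ℝ f := hf.differentiable (by norm_num)
  have hdg : Differentiable ℝ g := hg.differentiable (by norm_num)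
  have hfs' : ∀ v, HasCompactSupport fun y => fderiv ℝ f y v := fun v => hfs.fderiv_apply ℝ v
  have hfs'' : ∀ v, HasCompactSupport fun y => fderiv ℝ (fun x => fderiv ℝ f x v) y v := fun v =>
    (hfs' v).fderiv_apply ℝ v
  have cf := hf.continuous
  have cg := hg.continuous
  have cf' := fun v => (contDiff_fderiv_apply hf v).continuous
  have cg' := fun v => (contDiff_fderiv_apply hg v).continuous
  have cf'' := continuous_fderiv_fderiv_apply hf
  have cg'' := continuous_fderiv_fderiv_apply hg
  have i1 : ∀ v, Integrable fun y => f y * fderiv ℝ (fun x => fderiv ℝ g x v) y v := fun v =>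
    (cf.mul (cg'' v)).integrable_of_hasCompactSupport hfs.mul_right
  have i2 : ∀ v, Integrable fun y => fderiv ℝ (fun x => fderiv ℝ f x v) y v * g y := fun v =>
    ((cf'' v).mul cg).integrable_of_hasCompactSupport (hfs'' v).mul_right
  have i3 : ∀ v, Integrable fun y => fderiv ℝ f y v * fderiv ℝ g y v := fun v =>
    ((cf' v).mul (cg' v)).integrable_of_hasCompactSupport (hfs' v).mul_right
  have i4 : ∀ v, Integrable fun y => f y * fderiv ℝ g y v := fun v =>
    (cf.mul (cg' v)).integrable_of_hasCompactSupport hfs.mul_right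
  have i5 : ∀ v, Integrable fun y => fderiv ℝ f y v * g y := fun v =>
    ((cf' v).mul cg).integrable_of_hasCompactSupport (hfs' v).mul_right
  rw [integral_finsetSum _ fun i _ => i1 _, integral_finsetSum _ fun i _ => i2 _]
  refine Finset.sum_congr rfl fun i _ => ?_
  rw [integral_mul_fderiv_eq_neg_fderiv_mul_of_integrable (i3 _) (i1 _) (i4 _)
      (fun x _ => hdf x) (fun x _ => ((contDiff_fderiv_apply hg _).differentiable (by norm_num)) x),
    integral_mul_fderiv_eq_neg_fderiv_mul_of_integrable (i2 _) (i3 _) (i5 _)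
      (fun x _ => ((contDiff_fderiv_apply hf _).differentiable (by norm_num)) x) (fun x _ => hdg x),
    neg_neg]

end Laplacian

/-- A smooth convex substitute for the absolute value. -/
def softAbs (x : ℝ) : ℝ := √(1 + x ^ 2) - 1

section SoftAbs

lemma softAbs_pos {x : ℝ} (hx : x ≠ 0) : 0 < softAbs x := by
  have : 0 < x ^ 2 := by positivity
  rw [softAbs, sub_pos, lt_sqrt zero_le_one]
  linarith

lemma softAbs_zero : softAbs 0 = 0 := by simp [softAbs]

lemma softAbs_nonneg (x : ℝ) : 0 ≤ softAbs x := by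
  rw [softAbs, sub_nonneg, one_le_sqrt]
  nlinarith [sq_nonneg x]

lemma softAbs_le_abs (x : ℝ) : softAbs x ≤ |x| := by
  rw [softAbs, sub_le_iff_le_add, sqrt_le_left (by positivity)]
  nlinarith [abs_nonneg x, sq_abs x]

lemma hasDerivAt_softAbs (x : ℝ) : HasDerivAt softAbs (x / √(1 + x ^ 2)) x := by
  have h0 : (1 + x ^ 2) ≠ 0 := by positivity
  have h1 : HasDerivAt (fun x : ℝ => 1 + x ^ 2) (2 * x) x := by
    simpa using (hasDerivAt_pow 2 x).const_add 1
  exact ((h1.sqrt h0).sub_const 1).congr_deriv (by field_simp)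

lemma hasDerivAt_softAbs_deriv (x : ℝ) :
    HasDerivAt (fun x => x / √(1 + x ^ 2)) (1 / √(1 + x ^ 2) ^ 3) x := by
  have hp : 0 < 1 + x ^ 2 := by positivity
  have h1 : HasDerivAt (fun x : ℝ => 1 + x ^ 2) (2 * x) x := by
    simpa using (hasDerivAt_pow 2 x).const_add 1
  have hs := sqrt_pos.2 hp
  have h2 := (hasDerivAt_id x).div (h1.sqrt hp.ne') hs.ne'
  refine HasDerivAt.congr_deriv h2 ?_
  have h3 : √(1 + x ^ 2) ^ 2 = 1 + x ^ 2 := sq_sqrt hp.le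
  simp only [id_eq]
  generalize √(1 + x ^ 2) = q at *
  field_simp
  linarith

lemma contDiff_softAbs : ContDiff ℝ 2 softAbs := by
  unfold softAbs
  refine ContDiff.sub (ContDiff.sqrt (by fun_prop) fun x => ?_) contDiff_const
  positivity

variable {n : ℕ}

/-- A Kato-type inequality. -/
lemma softAbs_laplacian_le {u : EuclideanSpace ℝ (Fin n) → ℝ} (hu : ContDiff ℝ 2 u)
    (y : EuclideanSpace ℝ (Fin n)) :
    u y / √(1 + u y ^ 2) * Laplacian.laplacian u y
      ≤ Laplacian.laplacian (fun y => softAbs (u y)) y := by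
  have hdu : Differentiable ℝ u := hu.differentiable (by norm_num)
  have hline : ∀ (x v : EuclideanSpace ℝ (Fin n)),
      HasDerivAt (fun t : ℝ => u (x + t • v)) (fderiv ℝ u x v) 0 := fun x v =>
    (hdu x).hasFDerivAt.hasLineDerivAt v
  have e0 : ∀ x v : EuclideanSpace ℝ (Fin n), u (x + (0 : ℝ) • v) = u x := fun x v => by simp
  rw [laplacian_eq_sum_of_hasLineDerivAt (f := fun y => softAbs (u y)) (contDiff_softAbs.comp hu)
    (g := fun i x => u x / √(1 + u x ^ 2) * fderiv ℝ u x (EuclideanSpace.single i 1))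
    (g' := fun i => 1 / √(1 + u y ^ 2) ^ 3 * fderiv ℝ u y (EuclideanSpace.single i 1) *
        fderiv ℝ u y (EuclideanSpace.single i 1) + u y / √(1 + u y ^ 2) *
          fderiv ℝ (fun x => fderiv ℝ u x (EuclideanSpace.single i 1)) y
            (EuclideanSpace.single i 1)),
    laplacian_eq_sum_fderiv hu, Finset.mul_sum]
  -- The term with the second derivative of `softAbs` is nonnegative by convexity and is discarded.
  · refine Finset.sum_le_sum fun i _ => le_add_of_nonneg_left ?_
    rw [mul_assoc]
    exact mul_nonneg (by positivity) (mul_self_nonneg _)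
  · intro i x
    exact HasDerivAt.comp (h₂ := softAbs)
      (h := fun t : ℝ => u (x + t • EuclideanSpace.single i (1 : ℝ)))
      0 (by rw [e0]; exact hasDerivAt_softAbs _) (hline x _)
  · intro i
    have h1 := HasDerivAt.comp (h₂ := fun x => x / √(1 + x ^ 2))
      (h := fun t : ℝ => u (y + t • EuclideanSpace.single i (1 : ℝ)))
      0 (by rw [e0]; exact hasDerivAt_softAbs_deriv _) (hline y _)
    have h2 : HasDerivAt (fun t : ℝ => fderiv ℝ u (y + t • EuclideanSpace.single i (1 : ℝ))
        (EuclideanSpace.single i 1)) _ 0 :=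
      (((contDiff_fderiv_apply hu (EuclideanSpace.single i 1)).differentiable
        (by norm_num)) y).hasFDerivAt.hasLineDerivAt (EuclideanSpace.single i 1)
    refine HasDerivAt.congr_deriv (h1.mul h2) ?_
    simp

end SoftAbs

/-- Differentiation under the integral sign for functions supported in a fixed compact set. -/
lemma hasDerivAt_integral_of_compact {E : Type*} [NormedAddCommGroup E] [MeasurableSpace E]
    [BorelSpace E] [SecondCountableTopology E] {μ : Measure E} [IsFiniteMeasureOnCompacts μ]
    {f f' : ℝ → E → ℝ} {I : Set ℝ} {K : Set E} (hI : IsOpen I) (hK : IsCompact K)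
    (hf : ∀ t ∈ I, Continuous (f t)) (hder : ∀ t ∈ I, ∀ y, HasDerivAt (fun s => f s y) (f' t y) t)
    (hf' : ContinuousOn (fun p : ℝ × E => f' p.1 p.2) (I ×ˢ univ))
    (hz : ∀ t ∈ I, ∀ y ∉ K, f t y = 0) (hz' : ∀ t ∈ I, ∀ y ∉ K, f' t y = 0) {t : ℝ} (ht : t ∈ I) :
    HasDerivAt (fun t => ∫ y, f t y ∂μ) (∫ y, f' t y ∂μ) t := by
  -- On a compact time interval times K the continuous derivative is bounded, and a constant on K is
  -- an integrable majorant.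
  obtain ⟨ε, hε, hball⟩ := Metric.nhds_basis_closedBall.mem_iff.1 (hI.mem_nhds ht)
  obtain ⟨C, hC⟩ := ((isCompact_closedBall t ε).prod hK).exists_bound_of_continuousOn
    (hf'.mono (prod_mono hball (subset_univ K)))
  have hc' : Continuous (f' t) := continuousOn_univ.1 <| hf'.comp (t := I ×ˢ univ)
    (f := fun y : E => (t, y)) (by fun_prop) fun y _ => ⟨ht, mem_univ y⟩
  refine (hasDerivAt_integral_of_dominated_loc_of_deriv_le (F := f) (F' := f')
    (bound := K.indicator fun _ => C) (Metric.closedBall_mem_nhds t hε) ?_ ?_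
    hc'.aestronglyMeasurable (Eventually.of_forall fun y s hs => ?_) ?_
    (Eventually.of_forall fun y s hs => hder s (hball hs) y)).2
  · exact eventually_of_mem (hI.mem_nhds ht) fun s hs => (hf s hs).aestronglyMeasurable
  · exact (hf t ht).integrable_of_hasCompactSupport (HasCompactSupport.intro hK (hz t ht))
  · by_cases hy : y ∈ K
    · rw [indicator_of_mem hy]; exact hC (s, y) ⟨hs, hy⟩
    · rw [indicator_of_notMem hy, hz' s (hball hs) y hy, norm_zero]
  · exact (integrable_indicator_iff hK.measurableSet).2
      (integrableOn_const hK.measure_lt_top.ne)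

end

/-! ### The difference of two solutions and the energy inequality. -/

noncomputable section

variable {n : ℕ} {d : Fin n → ℝ} {t₀ : ℝ} {η₀ : EuclideanSpace ℝ (Fin n) → ℝ}
  {u : ℝ → EuclideanSpace ℝ (Fin n) → ℝ}

lemma IsIVPSolution.continuousOn_uncurry (hu : IsIVPSolution d t₀ η₀ u) :
    ContinuousOn (fun p : ℝ × EuclideanSpace ℝ (Fin n) => u p.1 p.2) (Ioi t₀ ×ˢ univ) :=
  (ContinuousMultilinearMap.apply ℝ (fun _ : Fin 0 => EuclideanSpace ℝ (Fin n)) ℝ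
    0).continuous.comp_continuousOn (hu.continuousOn 0 (by norm_num))

lemma IsIVPSolution.continuousOn_laplacian (hu : IsIVPSolution d t₀ η₀ u) :
    ContinuousOn (fun p : ℝ × EuclideanSpace ℝ (Fin n) => Laplacian.laplacian (u p.1) p.2)
      (Ioi t₀ ×ˢ univ) := by
  simp_rw [fun f => InnerProductSpace.laplacian_eq_iteratedFDeriv_orthonormalBasis f
    (EuclideanSpace.basisFun (Fin n) ℝ)]
  refine continuousOn_finsetSum _ fun i _ => ?_
  exact (ContinuousMultilinearMap.apply ℝ (fun _ : Fin 2 => EuclideanSpace ℝ (Fin n)) ℝ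
    ![EuclideanSpace.basisFun (Fin n) ℝ i, EuclideanSpace.basisFun (Fin n) ℝ i]
    ).continuous.comp_continuousOn (hu.continuousOn 2 le_rfl)

/-- The difference of two solutions solves the homogeneous problem. -/
lemma IsIVPSolution.sub {v : ℝ → EuclideanSpace ℝ (Fin n) → ℝ} (hu : IsIVPSolution d t₀ η₀ u)
    (hv : IsIVPSolution d t₀ η₀ v) :
    IsIVPSolution d t₀ (fun _ => 0) fun t y => u t y - v t y where
  contDiff t ht := (hu.contDiff t ht).sub (hv.contDiff t ht)
  continuousOn k hk := by
    refine ((hu.continuousOn k hk).sub (hv.continuousOn k hk)).congr fun p hp => ?_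
    have hk' : (k : WithTop ℕ∞) ≤ 2 := by exact_mod_cast hk
    exact iteratedFDeriv_sub_apply (((hu.contDiff p.1 hp.1).of_le hk').contDiffAt)
      (((hv.contDiff p.1 hp.1).of_le hk').contDiffAt)
  pde t ht y := by
    have h := (hu.pde t ht y).sub (hv.pde t ht y)
    have e : Laplacian.laplacian (fun y => u t y - v t y) y
        = Laplacian.laplacian (u t) y - Laplacian.laplacian (v t) y :=
      (hu.contDiff t ht).contDiffAt.laplacian_sub (hv.contDiff t ht).contDiffAt
    refine HasDerivAt.congr_deriv h ?_
    rw [e]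
    ring
  initial K hK := by
    obtain ⟨i1, l1⟩ := hu.initial K hK
    obtain ⟨i2, l2⟩ := hv.initial K hK
    have e : ∀ t y, u t y - v t y - 0 = (u t y - η₀ y) - (v t y - η₀ y) := fun t y => by ring
    have i3 : ∀ t, t₀ < t → IntegrableOn (fun y => u t y - v t y - 0) K := fun t ht => by
      simp_rw [e]
      exact (i1 t ht).sub (i2 t ht)
    refine ⟨i3, squeeze_zero' (Eventually.of_forall fun t => integral_nonneg fun y => abs_nonneg _)
      ?_ (by simpa using l1.add l2)⟩
    filter_upwards [eventually_mem_nhdsWithin] with t ht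
    rw [← integral_add (i1 t ht).abs (i2 t ht).abs]
    refine integral_mono (i3 t ht).abs ((i1 t ht).abs.add (i2 t ht).abs) fun y => ?_
    simp only [e]
    exact abs_sub _ _
  growth T hT := by
    obtain ⟨a, C, h1⟩ := hu.growth T hT
    obtain ⟨a', C', h2⟩ := hv.growth T hT
    refine ⟨max a a', C + C', fun t ht => ?_⟩
    obtain ⟨i1, b1⟩ := h1 t ht
    obtain ⟨i2, b2⟩ := h2 t ht
    have j1 : Integrable fun y => exp (-a * ‖y‖ ^ 2) * |u t y| :=
      i1.norm.congr (Eventually.of_forall fun y => by simp)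
    have j2 : Integrable fun y => exp (-a' * ‖y‖ ^ 2) * |v t y| :=
      i2.norm.congr (Eventually.of_forall fun y => by simp)
    have hle : ∀ y, exp (-max a a' * ‖y‖ ^ 2) * |u t y - v t y|
        ≤ exp (-a * ‖y‖ ^ 2) * |u t y| + exp (-a' * ‖y‖ ^ 2) * |v t y| := fun y => by
      have p1 : exp (-max a a' * ‖y‖ ^ 2) ≤ exp (-a * ‖y‖ ^ 2) := by
        gcongr; exact le_max_left _ _
      have p2 : exp (-max a a' * ‖y‖ ^ 2) ≤ exp (-a' * ‖y‖ ^ 2) := by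
        gcongr; exact le_max_right _ _
      calc _ ≤ exp (-max a a' * ‖y‖ ^ 2) * (|u t y| + |v t y|) := by gcongr; exact abs_sub _ _
        _ = exp (-max a a' * ‖y‖ ^ 2) * |u t y| + exp (-max a a' * ‖y‖ ^ 2) * |v t y| := mul_add ..
        _ ≤ _ := by gcongr
    have hc : Continuous fun y => u t y - v t y :=
      ((hu.contDiff t ht.1).sub (hv.contDiff t ht.1)).continuous
    refine ⟨(j1.add j2).mono' (by fun_prop) (Eventually.of_forall fun y => ?_), ?_⟩
    · rw [norm_mul, norm_of_nonneg (exp_pos _).le]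
      exact hle y
    · refine (integral_mono_of_nonneg (Eventually.of_forall fun y => by positivity) (j1.add j2)
        (Eventually.of_forall hle)).trans ?_
      simp only [Pi.add_apply]
      rw [integral_add j1 j2]
      exact add_le_add b1 b2

/-- The Gaussian rate of the weight in the energy estimate. -/
def energyRate (a τ t : ℝ) : ℝ := (a + 1) * (1 + 16 * (a + 1) * (t - τ))

/-- The localised weighted `L¹`-type energy. -/
def energy (u : ℝ → EuclideanSpace ℝ (Fin n) → ℝ) (a τ R t : ℝ) : ℝ :=
  ∫ y, cutoffGaussian R (energyRate a τ t) y * softAbs (u t y)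

/-- The integrand of the time derivative of the energy. -/
def energyDensity (d : Fin n → ℝ) (u : ℝ → EuclideanSpace ℝ (Fin n) → ℝ) (a τ R t : ℝ)
    (y : EuclideanSpace ℝ (Fin n)) : ℝ :=
  -(16 * (a + 1) ^ 2) * ‖y‖ ^ 2 * cutoffGaussian R (energyRate a τ t) y * softAbs (u t y) +
    cutoffGaussian R (energyRate a τ t) y * (u t y / √(1 + u t y ^ 2) *
      (Laplacian.laplacian (u t) y - (y.ofLp ⬝ᵥ (Matrix.diagonal d *ᵥ y.ofLp)) * u t y))

lemma continuous_softAbs : Continuous softAbs := contDiff_softAbs.continuous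

lemma hasDerivAt_energy (hu : IsIVPSolution d t₀ η₀ u) {a τ R t : ℝ} (hR : 0 ≤ R) (ht : t₀ < t) :
    HasDerivAt (energy u a τ R) (∫ y, energyDensity d u a τ R t y) t := by
  have hcw : Continuous fun p : ℝ × EuclideanSpace ℝ (Fin n) =>
      cutoffGaussian R (energyRate a τ p.1) p.2 := by
    have := smoothTransition.continuous
    unfold cutoffGaussian energyRate
    fun_prop
  have hcu := hu.continuousOn_uncurry
  have hcl := hu.continuousOn_laplacian
  refine hasDerivAt_integral_of_compact isOpen_Ioi
    (isCompact_closedBall (0 : EuclideanSpace ℝ (Fin n)) (R + 1))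
    (f := fun t y => cutoffGaussian R (energyRate a τ t) y * softAbs (u t y))
    (f' := energyDensity d u a τ R) (fun s hs => ?_) (fun s hs y => ?_) ?_ (fun s hs y hy => ?_)
    (fun s hs y hy => ?_) ht
  · exact (contDiff_cutoffGaussian _ _).continuous.mul
      (continuous_softAbs.comp (hu.contDiff s hs).continuous)
  · have h1 : HasDerivAt (fun s => energyRate a τ s) (16 * (a + 1) ^ 2) s := by
      unfold energyRate
      exact (((((hasDerivAt_id s).sub_const τ).const_mul (16 * (a + 1))).const_add 1).const_mul
        (a + 1)).congr_deriv (by ring)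
    have h2 : HasDerivAt (fun s => cutoffGaussian R (energyRate a τ s) y)
        (-(16 * (a + 1) ^ 2) * ‖y‖ ^ 2 * cutoffGaussian R (energyRate a τ s) y) s := by
      unfold cutoffGaussian
      exact ((h1.neg.mul_const (‖y‖ ^ 2)).exp.mul_const _).congr_deriv
        (by simp only [Pi.neg_apply]; ring)
    have h3 := HasDerivAt.comp s (hasDerivAt_softAbs (u s y)) (hu.pde s hs y)
    exact h2.mul h3
  · have hV : Continuous fun p : ℝ × EuclideanSpace ℝ (Fin n) =>
        p.2.ofLp ⬝ᵥ (Matrix.diagonal d *ᵥ p.2.ofLp) := by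
      simp only [dotProduct, Matrix.mulVec_diagonal]
      fun_prop
    have hden : ∀ p ∈ Ioi t₀ ×ˢ (univ : Set (EuclideanSpace ℝ (Fin n))),
        √(1 + u p.1 p.2 ^ 2) ≠ 0 := fun p _ => by positivity
    unfold energyDensity
    refine ContinuousOn.add ?_ (hcw.continuousOn.mul (((hcu.div
      ((continuousOn_const.add (hcu.pow 2)).sqrt) hden)).mul
        (hcl.sub (hV.continuousOn.mul hcu))))
    refine ContinuousOn.mul (Continuous.continuousOn ?_)
      (continuous_softAbs.comp_continuousOn hcu)
    exact (continuous_const.mul (by fun_prop)).mul hcw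
  · simp only [cutoffGaussian_eq_zero hR hy, zero_mul]
  · simp only [energyDensity, cutoffGaussian_eq_zero hR hy, zero_mul, mul_zero, add_zero]

/-- The rate b starts at a + 1 and increases with speed 16(a + 1)². As long as b ≤ 2(a + 1), this
speed is at least 4b², so the decay of the weight in time absorbs the main term of its Laplacian.
The nonnegative potential only helps, and the remaining cut-off error is controlled by the growth
bound. -/
lemma integral_energyDensity_le (hd : ∀ i, 0 < d i) (hu : IsIVPSolution d t₀ η₀ u) {a τ R t : ℝ}
    (ha : 0 ≤ a) (hR : 0 ≤ R) (ht : t₀ < t) (hτ : τ ≤ t) (hτ' : 16 * (a + 1) * (t - τ) ≤ 1)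
    {C : ℝ} (hint : Integrable fun y => exp (-a * ‖y‖ ^ 2) * u t y)
    (hC : ∫ y, exp (-a * ‖y‖ ^ 2) * |u t y| ≤ C) {L : ℝ} (hL0 : 0 ≤ L)
    (hL : ∀ R b : ℝ, 0 ≤ R → a + 1 ≤ b → b ≤ 2 * (a + 1) →
      ∀ y : EuclideanSpace ℝ (Fin n), Laplacian.laplacian (cutoffGaussian R b) y
        ≤ 4 * b ^ 2 * ‖y‖ ^ 2 * cutoffGaussian R b y
          + L * exp (-R / 2) * exp (-a * ‖y‖ ^ 2)) :
    ∫ y, energyDensity d u a τ R t y ≤ L * exp (-R / 2) * C := by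
  set b := energyRate a τ t with hb
  have hb1 : a + 1 ≤ b := by
    rw [hb, energyRate]
    have : 0 ≤ 16 * (a + 1) * (t - τ) := mul_nonneg (by positivity) (sub_nonneg.2 hτ)
    nlinarith
  have hb2 : b ≤ 2 * (a + 1) := by rw [hb, energyRate]; nlinarith
  have hw := contDiff_cutoffGaussian (n := n) R b
  have hws := hasCompactSupport_cutoffGaussian (n := n) hR b
  have hut := hu.contDiff t ht
  have hsu : ContDiff ℝ 2 fun y => softAbs (u t y) := contDiff_softAbs.comp hut
  set v : EuclideanSpace ℝ (Fin n) → ℝ := fun y => softAbs (u t y) with hv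
  have hV : Continuous fun y : EuclideanSpace ℝ (Fin n) =>
      y.ofLp ⬝ᵥ (Matrix.diagonal d *ᵥ y.ofLp) := by
    simp only [dotProduct, Matrix.mulVec_diagonal]
    fun_prop
  have hV0 : ∀ y : EuclideanSpace ℝ (Fin n), 0 ≤ y.ofLp ⬝ᵥ (Matrix.diagonal d *ᵥ y.ofLp) :=
    fun y => by
      simp only [dotProduct, Matrix.mulVec_diagonal]
      refine Finset.sum_nonneg fun i _ => ?_
      have := mul_nonneg (hd i).le (mul_self_nonneg (y i))
      linarith
  have cw := hw.continuous
  have cv := hsu.continuous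
  have cu := hut.continuous
  have cΔu := continuous_laplacian hut
  have cΔv := continuous_laplacian hsu
  have cΔw := continuous_laplacian hw
  have cquot : Continuous fun y => u t y / √(1 + u t y ^ 2) :=
    cu.div (by fun_prop) fun y => by positivity
  have i1 : Integrable fun y => -(16 * (a + 1) ^ 2) * ‖y‖ ^ 2 * cutoffGaussian R b y * v y :=
    Continuous.integrable_of_hasCompactSupport (by fun_prop)
      (HasCompactSupport.mul_right hws.mul_left)
  have i2 : Integrable fun y => cutoffGaussian R b y * Laplacian.laplacian v y :=
    (cw.mul cΔv).integrable_of_hasCompactSupport hws.mul_right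
  have i3 : Integrable fun y => Laplacian.laplacian (cutoffGaussian R b) y * v y :=
    (cΔw.mul cv).integrable_of_hasCompactSupport (hasCompactSupport_laplacian hws).mul_right
  have i4 : Integrable (energyDensity d u a τ R t) := by
    refine i1.add (Continuous.integrable_of_hasCompactSupport ?_ hws.mul_right)
    exact cw.mul (cquot.mul (cΔu.sub (hV.mul cu)))
  have i5 : Integrable fun y => exp (-a * ‖y‖ ^ 2) * |u t y| :=
    hint.norm.congr (Eventually.of_forall fun y => by simp)
  calc ∫ y, energyDensity d u a τ R t y
      ≤ ∫ y, (-(16 * (a + 1) ^ 2) * ‖y‖ ^ 2 * cutoffGaussian R b y * v y +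
          cutoffGaussian R b y * Laplacian.laplacian v y) := by
        refine integral_mono i4 (i1.add i2) fun y => ?_
        refine add_le_add_right (mul_le_mul_of_nonneg_left ?_ (cutoffGaussian_nonneg R b y)) _
        have h1 := softAbs_laplacian_le hut y
        have h2 : 0 ≤ u t y / √(1 + u t y ^ 2) *
            ((y.ofLp ⬝ᵥ (Matrix.diagonal d *ᵥ y.ofLp)) * u t y) := by
          have : 0 ≤ (y.ofLp ⬝ᵥ (Matrix.diagonal d *ᵥ y.ofLp)) * (u t y * u t y) :=
            mul_nonneg (hV0 y) (mul_self_nonneg _)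
          rw [div_mul_eq_mul_div]
          refine div_nonneg ?_ (sqrt_nonneg _)
          linarith
        rw [mul_sub]
        linarith
    _ = ∫ y, (-(16 * (a + 1) ^ 2) * ‖y‖ ^ 2 * cutoffGaussian R b y * v y +
          Laplacian.laplacian (cutoffGaussian R b) y * v y) := by
        rw [integral_add i1 i2, integral_add i1 i3, integral_mul_laplacian hw hws hsu]
    _ ≤ ∫ y, L * exp (-R / 2) * (exp (-a * ‖y‖ ^ 2) * |u t y|) := by
        refine integral_mono (i1.add i3) (i5.const_mul _) fun y => ?_
        have h1 := hL R b hR hb1 hb2 y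
        have h2 : 0 ≤ v y := softAbs_nonneg _
        have h3 : v y ≤ |u t y| := softAbs_le_abs _
        have h4 : 4 * b ^ 2 * ‖y‖ ^ 2 * cutoffGaussian R b y
            ≤ 16 * (a + 1) ^ 2 * ‖y‖ ^ 2 * cutoffGaussian R b y := by
          have h5 : 4 * b ^ 2 ≤ 16 * (a + 1) ^ 2 := by nlinarith
          have h6 := cutoffGaussian_nonneg R b y
          gcongr
        have h7 : 0 ≤ L * exp (-R / 2) * exp (-a * ‖y‖ ^ 2) := by positivity
        calc _ = (-(16 * (a + 1) ^ 2) * ‖y‖ ^ 2 * cutoffGaussian R b y +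
              Laplacian.laplacian (cutoffGaussian R b) y) * v y := by ring
          _ ≤ (L * exp (-R / 2) * exp (-a * ‖y‖ ^ 2)) * v y := by gcongr; linarith
          _ ≤ (L * exp (-R / 2) * exp (-a * ‖y‖ ^ 2)) * |u t y| := by gcongr
          _ = _ := by ring
    _ = L * exp (-R / 2) * ∫ y, exp (-a * ‖y‖ ^ 2) * |u t y| := integral_const_mul _ _
    _ ≤ _ := by gcongr

end

/-! ### Uniqueness. -/

noncomputable section

variable {n : ℕ} {d : Fin n → ℝ} {t₀ : ℝ} {η₀ : EuclideanSpace ℝ (Fin n) → ℝ}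
  {u : ℝ → EuclideanSpace ℝ (Fin n) → ℝ}

lemma energy_nonneg (u : ℝ → EuclideanSpace ℝ (Fin n) → ℝ) (a τ R t : ℝ) :
    0 ≤ energy u a τ R t :=
  integral_nonneg fun _ => mul_nonneg (cutoffGaussian_nonneg _ _ _) (softAbs_nonneg _)

lemma cutoffGaussian_mono {R R' : ℝ} (h : R ≤ R') (b : ℝ) (y : EuclideanSpace ℝ (Fin n)) :
    cutoffGaussian R b y ≤ cutoffGaussian R' b y :=
  mul_le_mul_of_nonneg_left (smoothTransition.monotone (by linarith)) (exp_pos _).le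

lemma continuous_energy_integrand (hu : ContDiff ℝ 2 (u t₀)) (R b : ℝ) :
    Continuous fun y => cutoffGaussian R b y * softAbs (u t₀ y) :=
  (contDiff_cutoffGaussian R b).continuous.mul (continuous_softAbs.comp hu.continuous)

lemma integrable_energy_integrand (hu : ContDiff ℝ 2 (u t₀)) {R : ℝ} (hR : 0 ≤ R) (b : ℝ) :
    Integrable fun y => cutoffGaussian R b y * softAbs (u t₀ y) :=
  (continuous_energy_integrand hu R b).integrable_of_hasCompactSupport
    (hasCompactSupport_cutoffGaussian hR b).mul_right

/-- A solution whose energy vanishes initially vanishes for a short time. -/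
lemma IsIVPSolution.eq_zero_of_energy (hd : ∀ i, 0 < d i) (hu : IsIVPSolution d t₀ η₀ u)
    {a C T τ : ℝ} (ha : 0 ≤ a)
    (hg : ∀ t ∈ Ioc t₀ T, Integrable (fun y => exp (-a * ‖y‖ ^ 2) * u t y) ∧
      ∫ y, exp (-a * ‖y‖ ^ 2) * |u t y| ≤ C) (hτ : t₀ ≤ τ)
    (hlim : ∀ R, 0 ≤ R → Tendsto (energy u a τ R) (𝓝[>] τ) (𝓝 0)) {t : ℝ} (ht : τ < t)
    (htT : t ≤ T) (htτ : 16 * (a + 1) * (t - τ) ≤ 1) (y : EuclideanSpace ℝ (Fin n)) :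
    u t y = 0 := by
  obtain ⟨L, hL0, hL⟩ := exists_laplacian_cutoffGaussian_le n ha
  have ht₀ : t₀ < t := hτ.trans_lt ht
  have hut := hu.contDiff t ht₀
  have hC0 : 0 ≤ C := (integral_nonneg fun y => by positivity).trans (hg t ⟨ht₀, htT⟩).2
  have hbound : ∀ R, 0 ≤ R → energy u a τ R t ≤ L * exp (-R / 2) * C * (t - τ) := by
    intro R hR
    -- The mean value inequality is used on [s, t] with s ↓ τ, since at τ = t₀ only the limit of the
    -- energy is known.
    have hstep : ∀ s ∈ Ioo τ t,
        energy u a τ R t ≤ energy u a τ R s + L * exp (-R / 2) * C * (t - τ) := by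
      intro s hs
      have hpos : ∀ r ∈ Icc s t, t₀ < r := fun r hr => hτ.trans_lt (hs.1.trans_le hr.1)
      have h := (convex_Icc s t).image_sub_le_mul_sub_of_deriv_le (f := energy u a τ R)
        (C := L * exp (-R / 2) * C)
        (fun r hr => (hasDerivAt_energy hu hR (hpos r hr)).continuousAt.continuousWithinAt)
        (fun r hr => (hasDerivAt_energy hu hR
          (hpos r (interior_subset hr))).differentiableAt.differentiableWithinAt)
        (fun r hr => by
          have hr' := interior_subset hr
          have hr0 := hpos r hr'
          rw [(hasDerivAt_energy hu hR hr0).deriv]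
          obtain ⟨g1, g2⟩ := hg r ⟨hr0, hr'.2.trans htT⟩
          refine integral_energyDensity_le hd hu ha hR hr0 (hs.1.le.trans hr'.1) ?_ g1 g2 hL0 hL
          refine le_trans ?_ htτ
          have := hr'.2
          gcongr)
        s ⟨le_rfl, hs.2.le⟩ t ⟨hs.2.le, le_rfl⟩ hs.2.le
      have h2 : L * exp (-R / 2) * C * (t - s) ≤ L * exp (-R / 2) * C * (t - τ) := by
        have := hs.1.le
        gcongr
      linarith
    have h := (hlim R hR).add_const (L * exp (-R / 2) * C * (t - τ))
    rw [zero_add] at h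
    exact ge_of_tendsto h (eventually_of_mem (Ioo_mem_nhdsGT ht) hstep)
  by_contra hne
  have hR0 : (0 : ℝ) ≤ ‖y‖ ^ 2 := sq_nonneg _
  -- At R = ‖y‖² the cut-off equals 1 at y, so a nonzero value there makes this energy positive. The
  -- energy increases with R while its bound tends to zero, a contradiction.
  have hpos : 0 < energy u a τ (‖y‖ ^ 2) t := by
    refine (continuous_energy_integrand hut _ _).integral_pos_of_hasCompactSupport_nonneg_nonzero
      (x := y) (hasCompactSupport_cutoffGaussian hR0 _).mul_right
      (fun z => mul_nonneg (cutoffGaussian_nonneg _ _ _) (softAbs_nonneg _)) ?_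
    rw [cutoffGaussian, smoothTransition.one_of_one_le (by linarith), mul_one]
    exact mul_ne_zero (exp_pos _).ne' (softAbs_pos hne).ne'
  have hlim0 : Tendsto (fun R : ℝ => L * exp (-R / 2) * C * (t - τ)) atTop (𝓝 0) := by
    have h1 : Tendsto (fun R : ℝ => exp (-R / 2)) atTop (𝓝 0) := by
      refine tendsto_exp_atBot.comp ?_
      exact tendsto_neg_atTop_atBot.atBot_div_const two_pos
    simpa using ((h1.const_mul L).mul_const C).mul_const (t - τ)
  refine absurd (ge_of_tendsto hlim0 ?_) (not_le.2 hpos)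
  filter_upwards [eventually_ge_atTop (‖y‖ ^ 2)] with R hR
  refine le_trans ?_ (hbound R (hR0.trans hR))
  exact integral_mono (integrable_energy_integrand hut hR0 _)
    (integrable_energy_integrand hut (hR0.trans hR) _) fun z =>
      mul_le_mul_of_nonneg_right (cutoffGaussian_mono hR _ z) (softAbs_nonneg _)

/-- The weight is at most 1 and supported in a fixed ball, so the energy is bounded by the local L¹
norm, which tends to zero by the initial condition. -/
lemma IsIVPSolution.tendsto_energy (hu : IsIVPSolution d t₀ (fun _ => 0) u) {a R : ℝ}
    (ha : 0 ≤ a) (hR : 0 ≤ R) : Tendsto (energy u a t₀ R) (𝓝[>] t₀) (𝓝 0) := by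
  have hK := isCompact_closedBall (0 : EuclideanSpace ℝ (Fin n)) (R + 1)
  obtain ⟨i1, l1⟩ := hu.initial _ hK
  simp only [sub_zero] at i1 l1
  refine squeeze_zero' (Eventually.of_forall fun t => energy_nonneg u a t₀ R t) ?_ l1
  filter_upwards [eventually_mem_nhdsWithin] with t ht
  have ht' : t₀ < t := ht
  have hb : 0 ≤ energyRate a t₀ t := by
    unfold energyRate
    have := sub_pos.2 ht'
    positivity
  have e : energy u a t₀ R t = ∫ y in Metric.closedBall 0 (R + 1),
      cutoffGaussian R (energyRate a t₀ t) y * softAbs (u t y) :=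
    (setIntegral_eq_integral_of_forall_compl_eq_zero fun y hy => by
      rw [cutoffGaussian_eq_zero hR hy, zero_mul]).symm
  rw [e]
  refine integral_mono (integrable_energy_integrand (hu.contDiff t ht') hR _).integrableOn
    (i1 t ht').abs fun y => ?_
  have h1 : cutoffGaussian R (energyRate a t₀ t) y ≤ 1 := by
    refine mul_le_one₀ (exp_le_one_iff.2 ?_) (smoothTransition.nonneg _) (smoothTransition.le_one _)
    have := mul_nonneg hb (sq_nonneg ‖y‖)
    linarith
  exact (mul_le_of_le_one_left (softAbs_nonneg _) h1).trans (softAbs_le_abs _)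

/-- The homogeneous problem has only the trivial solution. -/
lemma IsIVPSolution.eq_zero (hd : ∀ i, 0 < d i) (hu : IsIVPSolution d t₀ (fun _ => 0) u) {T : ℝ}
    (hT : t₀ < T) (y : EuclideanSpace ℝ (Fin n)) : u T y = 0 := by
  obtain ⟨a', C, hg'⟩ := hu.growth T hT
  set a := max a' 0 with hadef
  have ha : 0 ≤ a := le_max_right _ _
  have hg : ∀ t ∈ Ioc t₀ T, Integrable (fun y => exp (-a * ‖y‖ ^ 2) * u t y) ∧
      ∫ y, exp (-a * ‖y‖ ^ 2) * |u t y| ≤ C := fun t ht => by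
    obtain ⟨g1, g2⟩ := hg' t ht
    have hle : ∀ y : EuclideanSpace ℝ (Fin n), exp (-a * ‖y‖ ^ 2) ≤ exp (-a' * ‖y‖ ^ 2) :=
      fun y => by gcongr; exact le_max_left _ _
    have hc := (hu.contDiff t ht.1).continuous
    have g3 : Integrable fun y => exp (-a' * ‖y‖ ^ 2) * |u t y| :=
      g1.norm.congr (Eventually.of_forall fun y => by simp)
    refine ⟨g3.mono' (by fun_prop) (Eventually.of_forall fun y => ?_),
      (integral_mono_of_nonneg (Eventually.of_forall fun y => by positivity) g3
        (Eventually.of_forall fun y => ?_)).trans g2⟩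
    · rw [norm_mul, norm_of_nonneg (exp_pos _).le]
      exact mul_le_mul_of_nonneg_right (hle y) (norm_nonneg _)
    · exact mul_le_mul_of_nonneg_right (hle y) (abs_nonneg _)
  have hq : 0 < 16 * (a + 1) := by positivity
  -- The growth constants are uniform on (t₀, T], so the step length 1/(16(a + 1)) does not shrink
  -- and finitely many steps reach T.
  have main : ∀ k : ℕ, ∀ t, t₀ < t → t ≤ T → 16 * (a + 1) * (t - t₀) ≤ k → ∀ y, u t y = 0 := by
    intro k
    induction k with
    | zero =>
      intro t ht _ hk
      have := mul_pos hq (sub_pos.2 ht)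
      rw [Nat.cast_zero] at hk
      linarith
    | succ k ih =>
      intro t ht htT hk y
      rcases le_or_gt (16 * (a + 1) * (t - t₀)) k with h | h
      · exact ih t ht htT h y
      set τ := t₀ + k / (16 * (a + 1)) with hτ
      have e : 16 * (a + 1) * (τ - t₀) = k := by rw [hτ]; field_simp; ring
      have h1 : t₀ ≤ τ := le_add_of_nonneg_right (by positivity)
      have h2 : τ < t := by nlinarith
      refine hu.eq_zero_of_energy hd ha hg h1 (fun R hR => ?_) h2 htT ?_ y
      · rcases h1.eq_or_lt with h3 | h3
        · rw [← h3]; exact hu.tendsto_energy ha hR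
        · have h4 := (hasDerivAt_energy hu (a := a) (τ := τ) hR h3).continuousAt.tendsto
          have h5 : energy u a τ R τ = 0 := by
            unfold energy
            simp [ih τ h3 (h2.le.trans htT) e.le, softAbs_zero]
          rw [h5] at h4
          exact h4.mono_left nhdsWithin_le_nhds
      · push_cast at hk
        linarith
  obtain ⟨k, hk⟩ := exists_nat_ge (16 * (a + 1) * (T - t₀))
  exact main k T hT le_rfl hk y

lemma IsIVPSolution.unique (hd : ∀ i, 0 < d i) {v : ℝ → EuclideanSpace ℝ (Fin n) → ℝ}
    (hu : IsIVPSolution d t₀ η₀ u) (hv : IsIVPSolution d t₀ η₀ v) {t : ℝ} (ht : t₀ < t)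
    (y : EuclideanSpace ℝ (Fin n)) : u t y = v t y :=
  sub_eq_zero.1 ((hu.sub hv).eq_zero hd ht y)

end
theorem theorem4p3 {n : ℕ} (d : Fin n → ℝ) (hd : ∀ i, 0 < d i) (t₀ : ℝ) (ht₀ : 0 ≤ t₀)
    (η₀ : EuclideanSpace ℝ (Fin n) → ℝ)
    (hη₀ : ∀ ε : ℝ, 0 < ε → Integrable (fun z => exp (-ε * ‖z‖ ^ 2) * η₀ z)) :
    -- the kernel integral is a solution of the initial value problem
    IsIVPSolution d t₀ η₀ (fun t y => ∫ z, kernelPP d t₀ y t z * η₀ z) ∧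
    -- it is the only one
    (∀ η : ℝ → EuclideanSpace ℝ (Fin n) → ℝ, IsIVPSolution d t₀ η₀ η →
      ∀ t, t₀ < t → ∀ y, η t y = ∫ z, kernelPP d t₀ y t z * η₀ z) ∧
    -- the datum is attained pointwise wherever it is continuous
    (∀ y, ContinuousAt η₀ y →
      Tendsto (fun p : ℝ × EuclideanSpace ℝ (Fin n) => ∫ z, kernelPP d t₀ p.2 p.1 z * η₀ z)
        (𝓝[>] t₀ ×ˢ 𝓝 y) (𝓝 (η₀ y))) ∧
    -- all integrals converge, and the Hermite series sums to the kernel integral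
    (∀ t, t₀ < t → ∀ y,
      Integrable (fun z => kernelPP d t₀ y t z * η₀ z) ∧
      (∀ m : Fin n → ℕ, Integrable (fun z => hermiteTerm d t₀ t m y z * η₀ z)) ∧
      HasSum (fun m : Fin n → ℕ => ∫ z, hermiteTerm d t₀ t m y z * η₀ z)
        (∫ z, kernelPP d t₀ y t z * η₀ z)) := by
  have hG : GaussIntegrable η₀ := hη₀
  have hsol : IsIVPSolution d t₀ η₀ (kernelInt d t₀ η₀) := isIVPSolution_kernelInt hd hG
  exact ⟨hsol, fun η hη t ht y => hη.unique hd hsol ht y, fun y hy => tendsto_kernelInt hd hG hy,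
    fun t ht y => ⟨integrable_kernelPP_mul hd hG ht y,
      fun m => integrable_hermiteTerm_mul hd hG ht m y, hasSum_integral_hermiteTerm hd hG ht y⟩⟩
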